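/- Let $Q$ be a smooth finite-dimensional manifold without boundary, $T^*Q$ its cotangent bundle with Liouville form $\theta_Q$ and canonical symplectic form $\omega=-d\theta_Q$, and let $\omega^\sharp$ be the inverse of $\omega^\flat\colon X\mapsto i_X\omega$. A *discretization map* on $Q$ is a smooth map $R_d=(R^1,R^2)\colon U\to Q\times Q$ on an open neighbourhood $U\subseteq TQ$ of the zero section such that $R_d(0_x)=(x,x)$ and $T_{0_x}R^2_x-T_{0_x}R^1_x=\mathrm{Id}_{T_xQ}$ for all $x\in Q$, where $R^a_x$ is the restriction of $R^a$ to $T_xQ$. Its *cotangent lift* is $R_d^{T^*}=\Phi^{-1}\circ\widehat{R_d}\circ\alpha_Q$, a map from (an open part of) $TT^*Q$ to $T^*Q\times T^*Q$, where $\alpha_Q\colon TT^*Q\to T^*TQ$, $(q,p,\dot q,\dot p)\mapsto(q,\dot q,\dot p,p)$, where $\widehat{R_d}(\beta_v)=\beta_v\circ(T_vR_d)^{-1}\in T^*_{R_d(v)}(Q\times Q)$, and where $\Phi\colon T^*Q\times T^*Q\to T^*(Q\times Q)$, $(q_0,p_0;q_1,p_1)\mapsto(q_0,q_1,-p_0,p_1)$.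 Let $\tau\colon TT^*Q\to T^*Q$ be the projection. Let $R_d\colon U\to Q\times Q$ be a discretization map on $Q$ and $H\colon T^*Q\to\mathbb R$ a smooth function, with Hamiltonian vector field $X_H=\omega^\sharp(dH)$. Then every zero vector $0_q$ has an open neighbourhood $V\subseteq U$ that $R_d$ maps diffeomorphically onto an open subset of $Q\times Q$. Let $V\subseteq U$ be any open set that $R_d$ maps diffeomorphically onto an open subset of $Q\times Q$, and let $(R_d^{T^*})^{-1}$ be the inverse of the cotangent lift of $R_d|_V$. For $h\in\mathbb R$ let $S_h\subseteq T^*Q\times T^*Q$ be the set of pairs $(z_0,z_1)$ at which this inverse is defined and $$(R_d^{T^*})^{-1}(z_0,z_1)=\omega^\sharp\Big(h\,dH\big(\tau((R_d^{T^*})^{-1}(z_0,z_1))\big)\Big).$$ Then this implicit scheme defines a symplectic integrator of $(T^*Q,\omega,H)$, in the following sense. 1. For every $h\in\mathbb R$ the set $S_h$ is a Lagrangian submanifold of $(T^*Q\times T^*Q,\ \mathrm{pr}_2^*\omega-\mathrm{pr}_1^*\omega)$. 2. For every $h\in\mathbb R$, every smooth map $\varphi\colon D\to T^*Q$ on an open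 set $D\subseteq T^*Q$ whose graph is contained in $S_h$ is a local diffeomorphism with $\varphi^*\omega=\omega$. 3. For every $x\in T^*Q$ over a point $q\in Q$ with $0_q\in V$ there are $\varepsilon>0$, open neighbourhoods $A,B$ of $x$ in $T^*Q$ and a smooth map $(-\varepsilon,\varepsilon)\times A\to B$, $(h,z)\mapsto\varphi_h(z)$, such that for $|h|<\varepsilon$ one has $S_h\cap(A\times B)=\{(z,\varphi_h(z)):z\in A\}$ and $\varphi_h$ is a symplectomorphism of $A$ onto an open subset of $T^*Q$; moreover $\varphi_0(z)=z$ and $\frac{d}{dh}\big|_{h=0}\varphi_h(z)=X_H(z)$ for all $z\in A$. -/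

import Mathlib

open scoped Manifold ContDiff Topology

noncomputable section

namespace Discretization

variable {E : Type*} [NormedAddCommGroup E] [NormedSpace ℝ E]
  {Q : Type*} [TopologicalSpace Q] [ChartedSpace E Q]

/-- A cotangent vector at `x`, for a manifold `M` with model `I`. -/
abbrev CotangentSpace {F : Type*} [NormedAddCommGroup F] [NormedSpace ℝ F]
    {K : Type*} [TopologicalSpace K] (I : ModelWithCorners ℝ F K)
    {M : Type*} [TopologicalSpace M] [ChartedSpace K M] (x : M) : Type _ :=
  TangentSpace I x →L[ℝ] Bundle.Trivial M ℝ x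

/-- The cotangent bundle `T*M`, as the vector bundle of homomorphisms from the tangent bundle to
the trivial line bundle.  Its manifold structure is Mathlib's structure on the total space of a
bundle of homomorphisms. -/
abbrev CotangentBundle {F : Type*} [NormedAddCommGroup F] [NormedSpace ℝ F]
    {K : Type*} [TopologicalSpace K] (I : ModelWithCorners ℝ F K)
    (M : Type*) [TopologicalSpace M] [ChartedSpace K M] : Type _ :=
  Bundle.TotalSpace (F →L[ℝ] ℝ) (fun x : M => CotangentSpace I x)

/-- The model with corners of `TQ`, for `Q` modelled on `E`. -/
abbrev tModel (E : Type*) [NormedAddCommGroup E] [NormedSpace ℝ E] :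
    ModelWithCorners ℝ (E × E) (ModelProd E E) :=
  𝓘(ℝ, E).prod 𝓘(ℝ, E)

/-- The model with corners of `T*Q`, for `Q` modelled on `E`. -/
abbrev cModel (E : Type*) [NormedAddCommGroup E] [NormedSpace ℝ E] :
    ModelWithCorners ℝ (E × (E →L[ℝ] ℝ)) (ModelProd E (E →L[ℝ] ℝ)) :=
  𝓘(ℝ, E).prod 𝓘(ℝ, E →L[ℝ] ℝ)

variable (E Q) in
/-- `TQ`. -/
abbrev TQ : Type _ := TangentBundle 𝓘(ℝ, E) Q

variable (E Q) in
/-- `T*Q`. -/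
abbrev CQ : Type _ := CotangentBundle 𝓘(ℝ, E) Q

variable [IsManifold 𝓘(ℝ, E) ∞ Q]

/-- The Liouville one-form of `T*Q`. -/
def liouville (z : CQ E Q) : TangentSpace (cModel E) z →L[ℝ] ℝ :=
  z.2 ∘L mfderiv (cModel E) 𝓘(ℝ, E) (Bundle.TotalSpace.proj : CQ E Q → Q) z

/-- The Liouville one-form, read in the preferred chart of `T*Q` at `z`. -/
def liouvilleInChart (z : CQ E Q) (u : E × (E →L[ℝ] ℝ)) : (E × (E →L[ℝ] ℝ)) →L[ℝ] ℝ :=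
  liouville ((extChartAt (cModel E) z).symm u) ∘L
    mfderiv 𝓘(ℝ, E × (E →L[ℝ] ℝ)) (cModel E) (extChartAt (cModel E) z).symm u

/-- In induced coordinates `(q, p)`, the Liouville form is `p dq`. -/
theorem liouvilleInChart_eq (z : CQ E Q) (u : E × (E →L[ℝ] ℝ))
    (hu : u ∈ (extChartAt (cModel E) z).target) :
    liouvilleInChart z u = u.2 ∘L ContinuousLinearMap.fst ℝ E (E →L[ℝ] ℝ) := by
  have hM : IsManifold (cModel E) 1 (CQ E Q) := inferInstance
  have hM0 : IsManifold 𝓘(ℝ, E) 1 Q := IsManifold.of_le (n := ∞) (by exact_mod_cast le_top)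
  obtain ⟨w, hw⟩ : ∃ w, w = (extChartAt (cModel E) z).symm u := ⟨_, rfl⟩
  have hws : w ∈ (extChartAt (cModel E) z).source := by
    rw [hw]; exact (extChartAt (cModel E) z).map_target hu
  have hwu : extChartAt (cModel E) z w = u := by
    rw [hw]; exact (extChartAt (cModel E) z).right_inv hu
  have htu : (extChartAt (cModel E) z).target ∈ 𝓝 u :=
    (isOpen_extChartAt_target (I := cModel E) z).mem_nhds hu
  rw [FiberBundle.extChartAt] at hws hwu
  have hq : w.proj ∈ (chartAt E z.proj).source := by
    have h1 := hws.1
    simpa using h1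
  have hwu1 : extChartAt 𝓘(ℝ, E) z.proj w.proj = u.1 := by
    rw [← hwu]; rfl
  have hwu2 : (w.2 : TangentSpace 𝓘(ℝ, E) w.proj →L[ℝ] ℝ) ∘L
      (trivializationAt E (TangentSpace 𝓘(ℝ, E)) z.proj).symmL ℝ w.proj = u.2 := by
    rw [← hwu]
    ext v
    simp [hom_trivializationAt_apply, ContinuousLinearMap.inCoordinates]
  have hwit : (Bundle.TotalSpace.proj : CQ E Q → Q) ∘ (extChartAt (cModel E) z).symm =ᶠ[𝓝 u]
      (extChartAt 𝓘(ℝ, E) z.proj).symm ∘ Prod.fst := by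
    filter_upwards [htu] with y hy
    obtain ⟨x, hx⟩ : ∃ x, x = (extChartAt (cModel E) z).symm y := ⟨_, rfl⟩
    have hxs : x ∈ (extChartAt (cModel E) z).source := by
      rw [hx]; exact (extChartAt (cModel E) z).map_target hy
    have hxy : extChartAt (cModel E) z x = y := by
      rw [hx]; exact (extChartAt (cModel E) z).right_inv hy
    rw [FiberBundle.extChartAt] at hxs hxy
    have h1 := hxs.1
    have hq' : x.proj ∈ (extChartAt 𝓘(ℝ, E) z.proj).source := by simpa using h1
    have h2 : extChartAt 𝓘(ℝ, E) z.proj x.proj = y.1 := by rw [← hxy]; rfl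
    simp only [Function.comp_apply, ← hx, ← h2]
    exact ((extChartAt 𝓘(ℝ, E) z.proj).left_inv hq').symm
  have hs : MDifferentiableAt 𝓘(ℝ, E × (E →L[ℝ] ℝ)) (cModel E)
      (extChartAt (cModel E) z).symm u := by
    have := mdifferentiableWithinAt_extChartAt_symm (I := cModel E) hu
    rwa [ModelWithCorners.range_eq_univ, mdifferentiableWithinAt_univ] at this
  have hpr : MDifferentiableAt (cModel E) 𝓘(ℝ, E) (Bundle.TotalSpace.proj : CQ E Q → Q)
      ((extChartAt (cModel E) z).symm u) := Bundle.mdifferentiableAt_proj _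
  have hu1 : u.1 ∈ (extChartAt 𝓘(ℝ, E) z.proj).target := by
    rw [← hwu1]; exact (extChartAt 𝓘(ℝ, E) z.proj).map_source (by simpa using hq)
  have hs0 : MDifferentiableAt 𝓘(ℝ, E) 𝓘(ℝ, E) (extChartAt 𝓘(ℝ, E) z.proj).symm u.1 := by
    have := mdifferentiableWithinAt_extChartAt_symm (I := 𝓘(ℝ, E)) hu1
    rwa [ModelWithCorners.range_eq_univ, mdifferentiableWithinAt_univ] at this
  have hfs : HasMFDerivAt 𝓘(ℝ, E × (E →L[ℝ] ℝ)) 𝓘(ℝ, E) (Prod.fst : E × (E →L[ℝ] ℝ) → E) u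
      (ContinuousLinearMap.fst ℝ E (E →L[ℝ] ℝ)) :=
    (ContinuousLinearMap.fst ℝ E (E →L[ℝ] ℝ)).hasMFDerivAt
  have hA := (hpr.hasMFDerivAt.comp u hs.hasMFDerivAt).mfderiv
  have hB := (hs0.hasMFDerivAt.comp u hfs).mfderiv
  have hC := TangentBundle.symmL_trivializationAt (I := 𝓘(ℝ, E)) (x₀ := z.proj) hq
  have hD := hwit.mfderiv_eq (I := 𝓘(ℝ, E × (E →L[ℝ] ℝ))) (I' := 𝓘(ℝ, E))
  rw [hwu1, ModelWithCorners.range_eq_univ, mfderivWithin_univ] at hC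
  have hE := hA.symm.trans (hD.trans hB)
  refine ContinuousLinearMap.ext fun δ => ?_
  have hEδ := DFunLike.congr_fun hE δ
  have h2 := DFunLike.congr_fun hwu2 δ.1
  have hCδ := DFunLike.congr_fun hC δ.1
  subst hw
  refine Eq.trans ?_ h2
  refine congrArg ((extChartAt (cModel E) z).symm u).2 ?_
  exact hEδ.trans hCδ.symm

/-- The canonical symplectic form `ω = -dθ` of `T*Q`. -/
def omega (z : CQ E Q) (ξ η : TangentSpace (cModel E) z) : ℝ :=
  - extDeriv (fun u => ContinuousAlternatingMap.ofSubsingleton ℝ (E × (E →L[ℝ] ℝ)) ℝ (0 : Fin 1)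
      (liouvilleInChart z u)) (extChartAt (cModel E) z z) ![ξ, η]

/-- The exterior derivative of a one-form with linear coefficients. -/
theorem extDeriv_linear {V : Type*} [NormedAddCommGroup V] [NormedSpace ℝ V]
    (L : V →L[ℝ] V →L[ℝ] ℝ) (x v w : V) :
    extDeriv (fun u => ContinuousAlternatingMap.ofSubsingleton ℝ V ℝ (0 : Fin 1) (L u)) x
      ![v, w] = L v w - L w v := by
  let L' : V →L[ℝ] (V [⋀^Fin 1]→L[ℝ] ℝ) :=
    ((ContinuousAlternatingMap.ofSubsingletonLIE (𝕜 := ℝ) (E := V) (F := ℝ) (0 : Fin 1)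
      ).toContinuousLinearEquiv : _ →L[ℝ] _) ∘L L
  have h : (fun u => ContinuousAlternatingMap.ofSubsingleton ℝ V ℝ (0 : Fin 1) (L u)) = L' := rfl
  have h' : DifferentiableAt ℝ
      (fun u => ContinuousAlternatingMap.ofSubsingleton ℝ V ℝ (0 : Fin 1) (L u)) x := by
    rw [h]; exact L'.differentiableAt
  have h2 (a : V) : fderiv ℝ (fun u => L u a) x = L.flip a := (L.flip a).hasFDerivAt.fderiv
  rw [extDeriv_apply h']
  simp [Fin.sum_univ_two, Fin.removeNth, h2, sub_eq_add_neg]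

/-- In the induced coordinates `(q, p)` on `T*Q`, the canonical form is `dq ∧ dp`. -/
theorem omega_apply (z : CQ E Q) (ξ η : E × (E →L[ℝ] ℝ)) :
    omega z ξ η = η.2 ξ.1 - ξ.2 η.1 := by
  have ht : (extChartAt (cModel E) z).target ∈ 𝓝 (extChartAt (cModel E) z z) :=
    (isOpen_extChartAt_target (I := cModel E) z).mem_nhds (mem_extChartAt_target z)
  let L : (E × (E →L[ℝ] ℝ)) →L[ℝ] (E × (E →L[ℝ] ℝ)) →L[ℝ] ℝ :=
    ((ContinuousLinearMap.compL ℝ (E × (E →L[ℝ] ℝ)) E ℝ).flip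
      (ContinuousLinearMap.fst ℝ E (E →L[ℝ] ℝ))) ∘L ContinuousLinearMap.snd ℝ E (E →L[ℝ] ℝ)
  have hL : (fun u => ContinuousAlternatingMap.ofSubsingleton ℝ (E × (E →L[ℝ] ℝ)) ℝ (0 : Fin 1)
      (liouvilleInChart z u)) =ᶠ[𝓝 (extChartAt (cModel E) z z)]
      fun u => ContinuousAlternatingMap.ofSubsingleton ℝ (E × (E →L[ℝ] ℝ)) ℝ (0 : Fin 1) (L u) := by
    filter_upwards [ht] with u hu
    rw [liouvilleInChart_eq z u hu]
    rfl
  unfold omega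
  rw [hL.extDeriv_eq]
  refine (congrArg Neg.neg (extDeriv_linear L _ ξ η)).trans ?_
  simp [L]

theorem omega_add_left (z : CQ E Q) (ξ ξ' η : TangentSpace (cModel E) z) :
    omega z (ξ + ξ') η = omega z ξ η + omega z ξ' η := by
  refine (omega_apply z _ _).trans ?_
  rw [omega_apply z ξ η, omega_apply z ξ' η]
  change η.2 (ξ.1 + ξ'.1) - (ξ.2 + ξ'.2) η.1 = _
  simp only [map_add, add_apply]
  ring

theorem omega_smul_left (z : CQ E Q) (c : ℝ) (ξ η : TangentSpace (cModel E) z) :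
    omega z (c • ξ) η = c * omega z ξ η := by
  refine (omega_apply z _ _).trans ?_
  rw [omega_apply z ξ η]
  change η.2 (c • ξ.1) - (c • ξ.2) η.1 = _
  simp only [map_smul, smul_apply, smul_eq_mul]
  ring

theorem omega_swap (z : CQ E Q) (ξ η : TangentSpace (cModel E) z) :
    omega z ξ η = - omega z η ξ := by
  rw [omega_apply z ξ η, omega_apply z η ξ]; ring

theorem omega_nondegenerate (z : CQ E Q) (ξ : TangentSpace (cModel E) z)
    (h : ∀ η, omega z ξ η = 0) : ξ = 0 := by
  have h' : ∀ η : E × (E →L[ℝ] ℝ), η.2 ξ.1 - ξ.2 η.1 = 0 :=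
    fun η => (omega_apply z ξ η).symm.trans (h η)
  refine Prod.ext ?_ (ContinuousLinearMap.ext fun e => ?_)
  · refine SeparatingDual.eq_zero_of_forall_dual_eq_zero (R := ℝ) (V := E) (x := ξ.1) fun g => ?_
    have h1 := h' (0, g)
    simpa using h1
  · have h1 := h' (e, 0)
    have h2 : ξ.2 e = 0 := by simpa using h1
    exact h2

section FiniteDim
variable [FiniteDimensional ℝ E]

/-- The map `ω^♭ : ξ ↦ i_ξ ω`. -/
def flat (z : CQ E Q) :
    TangentSpace (cModel E) z →ₗ[ℝ] (TangentSpace (cModel E) z →L[ℝ] ℝ) where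
  toFun ξ :=
    { toFun := fun η => omega z ξ η
      map_add' := fun η η' => by
        rw [omega_swap z ξ, omega_swap z ξ η, omega_swap z ξ η', omega_add_left]; ring
      map_smul' := fun c η => by
        rw [omega_swap z ξ, omega_swap z ξ η, omega_smul_left]; simp
      cont := by
        have : (fun η : E × (E →L[ℝ] ℝ) => omega z ξ η) = fun η => η.2 ξ.1 - ξ.2 η.1 :=
          funext fun η => omega_apply z ξ η
        change Continuous (fun η : E × (E →L[ℝ] ℝ) => omega z ξ η)
        rw [this]
        fun_prop }
  map_add' ξ ξ' := ContinuousLinearMap.ext fun η => omega_add_left z ξ ξ' η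
  map_smul' c ξ := ContinuousLinearMap.ext fun η => omega_smul_left z c ξ η

theorem flat_bijective (z : CQ E Q) : Function.Bijective (flat z) := by
  have hinj : Function.Injective (flat z) := by
    rw [injective_iff_map_eq_zero]
    intro ξ hξ
    exact omega_nondegenerate z ξ fun η => DFunLike.congr_fun hξ η
  have hfd : FiniteDimensional ℝ (TangentSpace (cModel E) z) :=
    inferInstanceAs (FiniteDimensional ℝ (E × (E →L[ℝ] ℝ)))
  have e : ((E × (E →L[ℝ] ℝ)) →ₗ[ℝ] ℝ) ≃ₗ[ℝ] ((E × (E →L[ℝ] ℝ)) →L[ℝ] ℝ) :=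
    LinearMap.toContinuousLinearMap
  have hr : Module.finrank ℝ ((E × (E →L[ℝ] ℝ)) →L[ℝ] ℝ) =
      Module.finrank ℝ (E × (E →L[ℝ] ℝ)) := by
    rw [← e.finrank_eq]
    exact Subspace.dual_finrank_eq
  have hfd' : FiniteDimensional ℝ (TangentSpace (cModel E) z →L[ℝ] ℝ) :=
    inferInstanceAs (FiniteDimensional ℝ ((E × (E →L[ℝ] ℝ)) →L[ℝ] ℝ))
  exact ⟨hinj, (LinearMap.injective_iff_surjective_of_finrank_eq_finrank hr.symm).1 hinj⟩

/-- The musical isomorphism `ω^♯ = (ω^♭)⁻¹`. -/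
def sharp (z : CQ E Q) :
    (TangentSpace (cModel E) z →L[ℝ] ℝ) ≃ₗ[ℝ] TangentSpace (cModel E) z :=
  (LinearEquiv.ofBijective (flat z) (flat_bijective z)).symm

/-- The differential `dH`. -/
def dH (H : CQ E Q → ℝ) (z : CQ E Q) : TangentSpace (cModel E) z →L[ℝ] ℝ :=
  mfderiv (cModel E) 𝓘(ℝ, ℝ) H z

/-- The Hamiltonian vector field `X_H = ω^♯(dH)`. -/
def hamiltonianVF (H : CQ E Q → ℝ) (z : CQ E Q) : TangentSpace (cModel E) z :=
  sharp z (dH H z)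

end FiniteDim

/-- The differential at `0_x` of the restriction of `f : TQ → Q` to the fibre `T_xQ`, as a map from
`T_{0_x}T_xQ ≃ T_xQ = E` to `T_{f(0_x)}Q = E`. -/
def fiberDeriv (f : TQ E Q → Q) (x : Q) : E →L[ℝ] E :=
  mfderiv 𝓘(ℝ, E) 𝓘(ℝ, E) (fun v : E => f ⟨x, v⟩) 0

/-- `R_d : U ⊆ TQ → Q × Q` is a (smooth) discretization map on `Q`; values off `U` are ignored. -/
structure IsDiscretizationMap (R : TQ E Q → Q × Q) (U : Set (TQ E Q)) : Prop where
  isOpen : IsOpen U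
  zero_mem : ∀ x : Q, (⟨x, 0⟩ : TQ E Q) ∈ U
  smooth : ContMDiffOn (tModel E) (𝓘(ℝ, E).prod 𝓘(ℝ, E)) ∞ R U
  map_zero : ∀ x : Q, R ⟨x, 0⟩ = (x, x)
  rigidity : ∀ x : Q,
    fiberDeriv (fun v => (R v).2) x - fiberDeriv (fun v => (R v).1) x = ContinuousLinearMap.id ℝ E

/-- `V ⊆ U` is open and `R_d` restricts to a diffeomorphism of `V` onto its (open) image, so that
`R_d⁻¹` makes sense on `R_d(V)`. -/
structure IsInvertibleOn (R : TQ E Q → Q × Q) (U V : Set (TQ E Q)) : Prop where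
  isOpen : IsOpen V
  subset : V ⊆ U
  injOn : Set.InjOn R V
  localDiffeo : ∀ v ∈ V, IsLocalDiffeomorphAt (tModel E) (𝓘(ℝ, E).prod 𝓘(ℝ, E)) ∞ R v

/-- The cotangent lift `F̂ = T*F⁻¹ : T*M₁ → T*M₂`, that is `α_x ↦ α_x ∘ (T_x F)⁻¹`, at points where
`T_x F` is invertible. -/
def hat {F₁ F₂ K₁ K₂ M₁ M₂ : Type*}
    [NormedAddCommGroup F₁] [NormedSpace ℝ F₁] [NormedAddCommGroup F₂] [NormedSpace ℝ F₂]
    [TopologicalSpace K₁] [TopologicalSpace K₂]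
    (I₁ : ModelWithCorners ℝ F₁ K₁) (I₂ : ModelWithCorners ℝ F₂ K₂)
    [TopologicalSpace M₁] [ChartedSpace K₁ M₁] [TopologicalSpace M₂] [ChartedSpace K₂ M₂]
    (F : M₁ → M₂) (β : CotangentBundle I₁ M₁) : CotangentBundle I₂ M₂ :=
  ⟨F β.proj, β.2 ∘L (mfderiv I₁ I₂ F β.proj).inverse⟩

theorem coprod_inl_inr (a b : E →L[ℝ] ℝ) (c : E × E →L[ℝ] ℝ) :
    (a.coprod b) ∘L ContinuousLinearMap.inl ℝ E E = a ∧
    (a.coprod b) ∘L ContinuousLinearMap.inr ℝ E E = b ∧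
    (c ∘L ContinuousLinearMap.inl ℝ E E).coprod (c ∘L ContinuousLinearMap.inr ℝ E E) = c := by
  refine ⟨?_, ?_, ?_⟩
  · ext; simp
  · ext; simp
  · ext <;> simp

variable (E Q) in
/-- The canonical isomorphism `α_Q : TT*Q → T*TQ`, `(q, p, q̇, ṗ) ↦ (q, q̇, ṗ, p)`.
In Mathlib the tangent space at a point is the model space, through the preferred chart at that
point; at a point of `T*Q` or `TQ` over `q` this is the chart induced by the preferred chart of `Q`
at `q`.  So the components below are induced coordinates for one and the same chart of `Q`; the
covector `(ṗ, p)` at `(q, q̇)` is `(δq, δv) ↦ ṗ δq + p δv`. -/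
def alpha : TangentBundle (cModel E) (CQ E Q) ≃ CotangentBundle (tModel E) (TQ E Q) where
  toFun ξ :=
    let p : E →L[ℝ] ℝ := ξ.proj.2
    let w : E × (E →L[ℝ] ℝ) := ξ.2
    ⟨⟨ξ.proj.proj, w.1⟩, (w.2.coprod p : E × E →L[ℝ] ℝ)⟩
  invFun β :=
    let v : E := β.proj.2
    let b : E × E →L[ℝ] ℝ := β.2
    ⟨⟨β.proj.proj, (b ∘L ContinuousLinearMap.inr ℝ E E : E →L[ℝ] ℝ)⟩,
      ((v, b ∘L ContinuousLinearMap.inl ℝ E E) : E × (E →L[ℝ] ℝ))⟩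
  left_inv := by
    rintro ⟨⟨q, p⟩, ⟨v, w⟩⟩
    obtain ⟨h1, h2, -⟩ := coprod_inl_inr (E := E) w p 0
    exact congrArg₂ (fun a b : E →L[ℝ] ℝ =>
      (⟨⟨q, a⟩, ((v, b) : E × (E →L[ℝ] ℝ))⟩ : TangentBundle (cModel E) (CQ E Q))) h2 h1
  right_inv := by
    rintro ⟨⟨q, v⟩, b⟩
    exact congrArg (fun c : E × E →L[ℝ] ℝ =>
      (⟨⟨q, v⟩, c⟩ : CotangentBundle (tModel E) (TQ E Q))) (coprod_inl_inr (E := E) 0 0 b).2.2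

variable (E Q) in
/-- The diffeomorphism `Φ : T*Q × T*Q → T*(Q × Q)`, `(q₀, p₀; q₁, p₁) ↦ (q₀, q₁, -p₀, p₁)`. -/
def Phi : CQ E Q × CQ E Q ≃ CotangentBundle (𝓘(ℝ, E).prod 𝓘(ℝ, E)) (Q × Q) where
  toFun z :=
    let p₀ : E →L[ℝ] ℝ := z.1.2
    let p₁ : E →L[ℝ] ℝ := z.2.2
    ⟨(z.1.proj, z.2.proj), ((-p₀).coprod p₁ : E × E →L[ℝ] ℝ)⟩
  invFun β :=
    let b : E × E →L[ℝ] ℝ := β.2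
    (⟨β.proj.1, (-(b ∘L ContinuousLinearMap.inl ℝ E E) : E →L[ℝ] ℝ)⟩,
      ⟨β.proj.2, (b ∘L ContinuousLinearMap.inr ℝ E E : E →L[ℝ] ℝ)⟩)
  left_inv := by
    rintro ⟨⟨q₀, p₀⟩, ⟨q₁, p₁⟩⟩
    obtain ⟨h1, h2, -⟩ := coprod_inl_inr (E := E) (-(p₀ : E →L[ℝ] ℝ)) p₁ 0
    have h3 := (congrArg Neg.neg h1).trans (neg_neg (p₀ : E →L[ℝ] ℝ))
    exact congrArg₂ (fun a b : E →L[ℝ] ℝ => ((⟨q₀, a⟩, ⟨q₁, b⟩) : CQ E Q × CQ E Q)) h3 h2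
  right_inv := by
    rintro ⟨⟨q₀, q₁⟩, b⟩
    have h1 := neg_neg ((b : E × E →L[ℝ] ℝ) ∘L ContinuousLinearMap.inl ℝ E E)
    have h2 := (congrArg (fun a : E →L[ℝ] ℝ => a.coprod
      ((b : E × E →L[ℝ] ℝ) ∘L ContinuousLinearMap.inr ℝ E E)) h1).trans
        (coprod_inl_inr (E := E) 0 0 b).2.2
    exact congrArg (fun c : E × E →L[ℝ] ℝ =>
      (⟨(q₀, q₁), c⟩ : CotangentBundle (𝓘(ℝ, E).prod 𝓘(ℝ, E)) (Q × Q))) h2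

/-- The cotangent lift `R_d^{T*} = Φ⁻¹ ∘ R̂_d ∘ α_Q : TT*Q → T*Q × T*Q`. -/
def cotangentLift (R : TQ E Q → Q × Q) (ξ : TangentBundle (cModel E) (CQ E Q)) :
    CQ E Q × CQ E Q :=
  (Phi E Q).symm (hat (tModel E) (𝓘(ℝ, E).prod 𝓘(ℝ, E)) R (alpha E Q ξ))

/-- The part of `TT*Q` on which `R_d^{T*}` is defined when `R_d` is restricted to `V`. -/
def liftDomain (V : Set (TQ E Q)) : Set (TangentBundle (cModel E) (CQ E Q)) :=
  {ξ | (alpha E Q ξ).proj ∈ V}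

/-- If `R_d` is invertible on `V`, then so is `R_d^{T*}` over `V`: its inverse is single valued. -/
theorem cotangentLift_injOn {R : TQ E Q → Q × Q} {U V : Set (TQ E Q)}
    (h : IsInvertibleOn R U V) : Set.InjOn (cotangentLift R) (liftDomain V) := by
  intro ξ hξ η hη hR
  have h1 := (Phi E Q).symm.injective hR
  change (alpha E Q ξ).proj ∈ V at hξ
  change (alpha E Q η).proj ∈ V at hη
  apply (alpha E Q).injective
  generalize alpha E Q ξ = β at *
  generalize alpha E Q η = γ at *
  obtain ⟨v, b⟩ := β
  obtain ⟨w, c⟩ := γ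
  have h2 : R v = R w := congrArg Bundle.TotalSpace.proj h1
  obtain rfl : v = w := h.injOn hξ hη h2
  have h3 := eq_of_heq (Bundle.TotalSpace.mk.inj h1).2
  obtain ⟨D, hD⟩ : (mfderiv (tModel E) (𝓘(ℝ, E).prod 𝓘(ℝ, E)) R v).IsInvertible :=
    ⟨(h.localDiffeo v hξ).mfderivToContinuousLinearEquiv (by simp), rfl⟩
  simp only [← hD, ContinuousLinearMap.inverse_equiv] at h3
  have h4 : b = c := ContinuousLinearMap.ext fun x => by
    have := DFunLike.congr_fun h3 (D x)
    simpa using this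
  rw [h4]
section Scheme
variable [FiniteDimensional ℝ E]

/-- The pairs `(z₀, z₁)` that satisfy
`(R_d^{T*})⁻¹(z₀, z₁) = ω^♯(h dH(τ((R_d^{T*})⁻¹(z₀, z₁))))`, where `R_d` is restricted to `V`.
The point `ξ` below is the value `(R_d^{T*})⁻¹(z₀, z₁)`. -/
def scheme (R : TQ E Q → Q × Q) (V : Set (TQ E Q)) (H : CQ E Q → ℝ) (h : ℝ) :
    Set (CQ E Q × CQ E Q) :=
  {z | ∃ ξ : TangentBundle (cModel E) (CQ E Q), ξ ∈ liftDomain V ∧ cotangentLift R ξ = z ∧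
    ξ = ⟨ξ.proj, sharp ξ.proj (h • dH H ξ.proj)⟩}

end Scheme

/-- The symplectic form `Ω₁₂ = pr₂^*ω - pr₁^*ω` of `T*Q × T*Q`. -/
def omega12 (z : CQ E Q × CQ E Q) (ξ η : TangentSpace ((cModel E).prod (cModel E)) z) : ℝ :=
  omega z.2 ξ.2 η.2 - omega z.1 ξ.1 η.1

/-- `S` is a Lagrangian (embedded) submanifold of `T*Q × T*Q`: near each of its points it is
the image of an open set `D` of the model space under a smooth topological embedding `f` which is
an immersion and whose tangent spaces equal their orthogonal complements with respect to `Ω₁₂`. -/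
def IsLagrangianSubmanifold (S : Set (CQ E Q × CQ E Q)) : Prop :=
  ∀ z ∈ S, ∃ (D : Set (E × (E →L[ℝ] ℝ))) (f : E × (E →L[ℝ] ℝ) → CQ E Q × CQ E Q)
    (W : Set (CQ E Q × CQ E Q)),
    IsOpen D ∧ IsOpen W ∧ z ∈ W ∧ f '' D = S ∩ W ∧
    ContMDiffOn 𝓘(ℝ, E × (E →L[ℝ] ℝ)) ((cModel E).prod (cModel E)) ∞ f D ∧
    Topology.IsEmbedding (fun u : D => f u) ∧
    ∀ u ∈ D,
      Function.Injective (mfderiv 𝓘(ℝ, E × (E →L[ℝ] ℝ)) ((cModel E).prod (cModel E)) f u) ∧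
      ∀ η : TangentSpace ((cModel E).prod (cModel E)) (f u),
        η ∈ Set.range (mfderiv 𝓘(ℝ, E × (E →L[ℝ] ℝ)) ((cModel E).prod (cModel E)) f u) ↔
        ∀ ζ ∈ Set.range (mfderiv 𝓘(ℝ, E × (E →L[ℝ] ℝ)) ((cModel E).prod (cModel E)) f u),
          omega12 (f u) η ζ = 0

/-- On `A`, the map `φ : T*Q → T*Q` is a local diffeomorphism with `φ^*ω = ω`. -/
def IsLocalSymplectomorphismOn (φ : CQ E Q → CQ E Q) (A : Set (CQ E Q)) : Prop :=
  ∀ z ∈ A, IsLocalDiffeomorphAt (cModel E) (cModel E) ∞ φ z ∧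
    ∀ ξ η : TangentSpace (cModel E) z,
      omega (φ z) (mfderiv (cModel E) (cModel E) φ z ξ) (mfderiv (cModel E) (cModel E) φ z η) =
        omega z ξ η

/-- The velocity at time `0` of a curve `c` in `T*Q`, in the coordinates of the preferred chart at
`c 0`, that is, as an element of the model space of `T_{c(0)}T*Q`. -/
def velocityAtZero (c : ℝ → CQ E Q) : TangentSpace (cModel E) (c 0) :=
  mfderiv 𝓘(ℝ, ℝ) (cModel E) c 0 (1 : ℝ)

end Discretization

end

open scoped Manifold ContDiff Topology

noncomputable section

namespace Discretization

/-! The defining equation forces `ξ = (R_d^{T*})⁻¹(z₀, z₁)` to be the value of the Hamiltonian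
vector field of `hH` at the base point `z` of `ξ`. So `S_h` is the image of `schemeMap R H h : z ↦
R_d^{T*}(X_{hH}(z))` on the open set where `legendre H h z ∈ V`. The point `z` depends smoothly on
`(z₀, z₁)` through `recover`, which makes the parametrization an injective immersion and an
embedding.

Isotropy comes from a generating function. In a chart write `X = (X_q, X_p)` for the Hamiltonian
vector field of `hH`. By construction of the cotangent lift, `p₁ dx₁ - p₀ dx₀` pulls back to `X_p dq
+ p dX_q`, and by Hamilton's equations this is `d(p X_q - hH)`. Hence `dx₁ ∧ dp₁ = dx₀ ∧ dp₀`
(`wedge_eq_of_exact`, `localScheme_isotropic`), and a dimension count makes `S_h` Lagrangian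
(`mem_range_iff_of_isotropic`). If the graph of `φ` lies in `S_h`, its tangent vectors `(ξ, dφ ξ)`
lie in these isotropic spaces, so `φ^*ω = ω`; nondegeneracy of `ω` and the inverse function theorem
then make `φ` a local diffeomorphism.

For small steps, `schemeMap R H 0 z = (z, z)` (`schemeMap_zero`), so `(h, z) ↦ (h, z₀)` and `(h, z)
↦ (h, z₁)` are local diffeomorphisms near `(0, x)`, and `φ_h` is the second after the inverse of the
first. Differentiating the chart equations at `h = 0` gives the velocity
(`hasDerivAt_scheme_curve`). Rigidity gives the position part directly; for the momentum part it is
differentiated along the zero section.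

The technical obstacle is that a tangent space is the model space read in the preferred chart at the
point, so `alpha`, `Phi` and `sharp` use a chart that moves with the point, while derivatives need a
fixed one. The bridge is `pairing_deriv`: differentiating the chart-independent pairing of covectors
with vectors shows that `(q, p, q̇, ṗ) ↦ (q, q̇, ṗ, p)` is natural under changes of chart. -/

variable {E : Type*} [NormedAddCommGroup E] [NormedSpace ℝ E]
  {Q : Type*} [TopologicalSpace Q] [ChartedSpace E Q]

/-! ### Induced charts of `TQ` and `T*Q` over a fixed chart of `Q` -/

section Charts

/-- Being differentiable at `x` as a map to a vector space means that the expression in the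
preferred chart at `x` has the manifold derivative as its derivative. -/
theorem hasFDerivAt_comp_extChartAt_symm {F K M G : Type*} [NormedAddCommGroup F]
    [NormedSpace ℝ F] [TopologicalSpace K] {I : ModelWithCorners ℝ F K} [I.Boundaryless]
    [TopologicalSpace M] [ChartedSpace K M] [NormedAddCommGroup G] [NormedSpace ℝ G]
    {f : M → G} {x : M} {L : F →L[ℝ] G} (hf : HasMFDerivAt I 𝓘(ℝ, G) f x L) :
    HasFDerivAt (f ∘ (extChartAt I x).symm) L (extChartAt I x x) := by
  have h : HasFDerivWithinAt (writtenInExtChartAt I 𝓘(ℝ, G) x f) L (Set.range I)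
      (extChartAt I x x) := hf.2
  rw [ModelWithCorners.range_eq_univ, hasFDerivWithinAt_univ] at h
  exact h

variable [IsManifold 𝓘(ℝ, E) ∞ Q]

variable (E) in
/-- The derivative at `q` of the preferred chart at `b`, on the model space. -/
def dBase (b q : Q) : E →L[ℝ] E :=
  mfderiv 𝓘(ℝ, E) 𝓘(ℝ, E) (extChartAt 𝓘(ℝ, E) b) q

variable (E) in
/-- The chart of `T*Q` induced by the preferred chart of `Q` at `b`. -/
def cotChart (b : Q) : PartialEquiv (CQ E Q) (E × (E →L[ℝ] ℝ)) :=
  extChartAt (cModel E) (⟨b, 0⟩ : CQ E Q)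

variable (E) in
/-- The chart of `TQ` induced by the preferred chart of `Q` at `b`. -/
def tanChart (b : Q) : PartialEquiv (TQ E Q) (E × E) :=
  extChartAt (tModel E) (⟨b, 0⟩ : TQ E Q)

/-- The covector underlying a point of `T*Q`, on the model space. -/
def covector (z : CQ E Q) : E →L[ℝ] ℝ := z.2

/-- The vector underlying a point of `TQ`, on the model space. -/
def vector (v : TQ E Q) : E := v.2

/-- Bundle charts depend only on the base point, so one chart over `b` can serve for all points over
its domain. -/
theorem extChartAt_cot (z : CQ E Q) : extChartAt (cModel E) z = cotChart E z.proj := by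
  unfold cotChart
  rw [FiberBundle.extChartAt, FiberBundle.extChartAt]

theorem extChartAt_tan (v : TQ E Q) : extChartAt (tModel E) v = tanChart E v.proj := by
  unfold tanChart
  rw [FiberBundle.extChartAt, FiberBundle.extChartAt]

theorem mem_cotChart_source {b : Q} {z : CQ E Q} :
    z ∈ (cotChart E b).source ↔ z.proj ∈ (chartAt E b).source := by
  unfold cotChart
  rw [FiberBundle.extChartAt]
  simp only [mfld_simps]
  exact ⟨fun h => h.1.1, fun h => ⟨⟨h, trivial⟩, h⟩⟩

theorem mem_tanChart_source {b : Q} {v : TQ E Q} :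
    v ∈ (tanChart E b).source ↔ v.proj ∈ (chartAt E b).source := by
  unfold tanChart
  rw [FiberBundle.extChartAt]
  simp

theorem isManifold_one : IsManifold 𝓘(ℝ, E) 1 Q :=
  IsManifold.of_le (n := ∞) (by exact_mod_cast le_top)

theorem dBase_self (b : Q) : dBase E b b = ContinuousLinearMap.id ℝ E := by
  have := isManifold_one (E := E) (Q := Q)
  exact mfderiv_extChartAt_self (I := 𝓘(ℝ, E)) (x := b)

theorem dBase_isInvertible {b q : Q} (hq : q ∈ (chartAt E b).source) :
    (dBase E b q).IsInvertible := by
  have := isManifold_one (E := E) (Q := Q)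
  exact isInvertible_mfderiv_extChartAt (I := 𝓘(ℝ, E)) (x := b) (by simpa using hq)

theorem cotChart_fst (b : Q) (z : CQ E Q) : (cotChart E b z).1 = extChartAt 𝓘(ℝ, E) b z.proj := by
  unfold cotChart; rw [FiberBundle.extChartAt]; rfl

theorem tanChart_fst (b : Q) (v : TQ E Q) : (tanChart E b v).1 = extChartAt 𝓘(ℝ, E) b v.proj := by
  unfold tanChart; rw [FiberBundle.extChartAt]; rfl

theorem tanChart_snd {b : Q} {v : TQ E Q} (hv : v.proj ∈ (chartAt E b).source) :
    (tanChart E b v).2 = dBase E b v.proj (vector v) := by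
  have := isManifold_one (E := E) (Q := Q)
  have h := TangentBundle.continuousLinearMapAt_trivializationAt (I := 𝓘(ℝ, E)) (x₀ := b) hv
  have h2 : (tanChart E b v).2 =
      (trivializationAt E (TangentSpace 𝓘(ℝ, E)) b).continuousLinearMapAt ℝ v.proj v.2 := by
    unfold tanChart
    rw [FiberBundle.extChartAt]
    rw [Bundle.Trivialization.continuousLinearMapAt_apply, Bundle.Trivialization.linearMapAt_apply,
      if_pos (by simpa using hv)]
    rfl
  rw [h2]
  exact DFunLike.congr_fun h v.2

/-- The trivialization of the homomorphism bundle precomposes a covector with the inverse of the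
tangent trivialization, and the latter is `dBase` on the fibre. Hence covectors transform dually to
vectors. -/
theorem cotChart_snd {b : Q} {z : CQ E Q} (hz : z.proj ∈ (chartAt E b).source) (ξ : E) :
    (cotChart E b z).2 (dBase E b z.proj ξ) = covector z ξ := by
  have := isManifold_one (E := E) (Q := Q)
  have h2 : (cotChart E b z).2 = (z.2 : TangentSpace 𝓘(ℝ, E) z.proj →L[ℝ] ℝ) ∘L
      (trivializationAt E (TangentSpace 𝓘(ℝ, E)) b).symmL ℝ z.proj := by
    unfold cotChart
    rw [FiberBundle.extChartAt]
    ext v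
    simp [hom_trivializationAt_apply, ContinuousLinearMap.inCoordinates]
  have h := TangentBundle.continuousLinearMapAt_trivializationAt (I := 𝓘(ℝ, E)) (x₀ := b) hz
  have h3 : (trivializationAt E (TangentSpace 𝓘(ℝ, E)) b).symmL ℝ z.proj
      ((trivializationAt E (TangentSpace 𝓘(ℝ, E)) b).continuousLinearMapAt ℝ z.proj ξ) = ξ :=
    (trivializationAt E (TangentSpace 𝓘(ℝ, E)) b).symmL_continuousLinearMapAt
      (by simpa using hz) ξ
  rw [h2]
  have h4 := DFunLike.congr_fun h ξ
  refine (congrArg (fun w => (z.2 : TangentSpace 𝓘(ℝ, E) z.proj →L[ℝ] ℝ)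
    ((trivializationAt E (TangentSpace 𝓘(ℝ, E)) b).symmL ℝ z.proj w)) h4.symm).trans ?_
  exact congrArg (z.2 : TangentSpace 𝓘(ℝ, E) z.proj →L[ℝ] ℝ) h3

theorem mem_cotChart_target {b : Q} {u : E × (E →L[ℝ] ℝ)} :
    u ∈ (cotChart E b).target ↔ u.1 ∈ (extChartAt 𝓘(ℝ, E) b).target := by
  unfold cotChart
  rw [FiberBundle.extChartAt_target]
  simp
  intro h
  simpa using (extChartAt 𝓘(ℝ, E) b).map_target (by simpa using h)

theorem mem_tanChart_target {b : Q} {u : E × E} :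
    u ∈ (tanChart E b).target ↔ u.1 ∈ (extChartAt 𝓘(ℝ, E) b).target := by
  unfold tanChart
  rw [FiberBundle.extChartAt_target]
  simp
  intro h
  simpa using (extChartAt 𝓘(ℝ, E) b).map_target (by simpa using h)

theorem proj_cotChart_symm {b : Q} {u : E × (E →L[ℝ] ℝ)}
    (hu : u.1 ∈ (extChartAt 𝓘(ℝ, E) b).target) :
    ((cotChart E b).symm u).proj = (extChartAt 𝓘(ℝ, E) b).symm u.1 := by
  have h := (cotChart E b).map_target (mem_cotChart_target.2 hu)
  rw [mem_cotChart_source] at h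
  have h2 := cotChart_fst b ((cotChart E b).symm u)
  rw [(cotChart E b).right_inv (mem_cotChart_target.2 hu)] at h2
  rw [h2, (extChartAt 𝓘(ℝ, E) b).left_inv (by simpa using h)]

theorem proj_tanChart_symm {b : Q} {u : E × E}
    (hu : u.1 ∈ (extChartAt 𝓘(ℝ, E) b).target) :
    ((tanChart E b).symm u).proj = (extChartAt 𝓘(ℝ, E) b).symm u.1 := by
  have h := (tanChart E b).map_target (mem_tanChart_target.2 hu)
  rw [mem_tanChart_source] at h
  have h2 := tanChart_fst b ((tanChart E b).symm u)
  rw [(tanChart E b).right_inv (mem_tanChart_target.2 hu)] at h2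
  rw [h2, (extChartAt 𝓘(ℝ, E) b).left_inv (by simpa using h)]

variable (E) in
/-- The derivative at `z` of the chart of `T*Q` over `b`, on the model space. -/
def dCot (b : Q) (z : CQ E Q) : E × (E →L[ℝ] ℝ) →L[ℝ] E × (E →L[ℝ] ℝ) :=
  mfderiv (cModel E) 𝓘(ℝ, E × (E →L[ℝ] ℝ)) (cotChart E b) z

variable (E) in
/-- The derivative at `v` of the chart of `TQ` over `b`, on the model space. -/
def dTan (b : Q) (v : TQ E Q) : E × E →L[ℝ] E × E :=
  mfderiv (tModel E) 𝓘(ℝ, E × E) (tanChart E b) v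

theorem hasMFDerivAt_cotChart {b : Q} {z : CQ E Q} (hz : z.proj ∈ (chartAt E b).source) :
    HasMFDerivAt (cModel E) 𝓘(ℝ, E × (E →L[ℝ] ℝ)) (cotChart E b) z (dCot E b z) := by
  have : IsManifold (cModel E) 1 (CQ E Q) := inferInstance
  refine (mdifferentiableAt_extChartAt (I := cModel E) (x := (⟨b, 0⟩ : CQ E Q)) ?_).hasMFDerivAt
  have := mem_cotChart_source.2 hz
  unfold cotChart at this
  rwa [extChartAt_source] at this

theorem hasMFDerivAt_tanChart {b : Q} {v : TQ E Q} (hv : v.proj ∈ (chartAt E b).source) :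
    HasMFDerivAt (tModel E) 𝓘(ℝ, E × E) (tanChart E b) v (dTan E b v) := by
  have : IsManifold (tModel E) 1 (TQ E Q) := inferInstance
  refine (mdifferentiableAt_extChartAt (I := tModel E) (x := (⟨b, 0⟩ : TQ E Q)) ?_).hasMFDerivAt
  have := mem_tanChart_source.2 hv
  unfold tanChart at this
  rwa [extChartAt_source] at this

theorem dTan_isInvertible {b : Q} {v : TQ E Q} (hv : v.proj ∈ (chartAt E b).source) :
    (dTan E b v).IsInvertible := by
  have : IsManifold (tModel E) 1 (TQ E Q) := inferInstance
  exact isInvertible_mfderiv_extChartAt (I := tModel E) (x := (⟨b, 0⟩ : TQ E Q))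
    (mem_tanChart_source.2 hv)

theorem dCot_self (z : CQ E Q) : dCot E z.proj z = ContinuousLinearMap.id ℝ _ := by
  have : IsManifold (cModel E) 1 (CQ E Q) := inferInstance
  have h := mfderiv_extChartAt_self (I := cModel E) (x := z)
  rw [extChartAt_cot] at h
  exact h

theorem dTan_self (v : TQ E Q) : dTan E v.proj v = ContinuousLinearMap.id ℝ _ := by
  have : IsManifold (tModel E) 1 (TQ E Q) := inferInstance
  have h := mfderiv_extChartAt_self (I := tModel E) (x := v)
  rw [extChartAt_tan] at h
  exact h

/-- In a chart over `b`, the projection of a tangent vector of `T*Q` to `TQ`. -/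
theorem dCot_fst {b : Q} {z : CQ E Q} (hz : z.proj ∈ (chartAt E b).source)
    (ζ : E × (E →L[ℝ] ℝ)) : (dCot E b z ζ).1 = dBase E b z.proj ζ.1 := by
  have h1 := hasFDerivAt_comp_extChartAt_symm (hasMFDerivAt_cotChart hz)
  rw [extChartAt_cot] at h1
  have hq : z.proj ∈ (chartAt E z.proj).source := mem_chart_source E _
  have hM := isManifold_one (E := E) (Q := Q)
  have hb : HasMFDerivAt 𝓘(ℝ, E) 𝓘(ℝ, E) (extChartAt 𝓘(ℝ, E) b) z.proj (dBase E b z.proj) :=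
    (mdifferentiableAt_extChartAt hz).hasMFDerivAt
  have h2 := hasFDerivAt_comp_extChartAt_symm hb
  rw [← cotChart_fst] at h2
  have h3 := h2.comp (cotChart E z.proj z) (hasFDerivAt_fst (𝕜 := ℝ))
  have h4 := (hasFDerivAt_fst (𝕜 := ℝ)).comp (cotChart E z.proj z) h1
  have h5 : Prod.fst ∘ cotChart E b ∘ (cotChart E z.proj).symm =ᶠ[𝓝 (cotChart E z.proj z)]
      (extChartAt 𝓘(ℝ, E) b ∘ (extChartAt 𝓘(ℝ, E) z.proj).symm) ∘ Prod.fst := by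
    have ht : (cotChart E z.proj).target ∈ 𝓝 (cotChart E z.proj z) := by
      rw [← extChartAt_cot]
      exact extChartAt_target_mem_nhds z
    filter_upwards [ht] with u hu
    simp only [Function.comp_apply, cotChart_fst, proj_cotChart_symm (mem_cotChart_target.1 hu)]
  exact DFunLike.congr_fun (h4.unique (h3.congr_of_eventuallyEq h5)) ζ

/-- In a chart over `b`, the projection of a tangent vector of `TQ` to `TQ`. -/
theorem dTan_fst {b : Q} {z : TQ E Q} (hz : z.proj ∈ (chartAt E b).source)
    (ζ : E × E) : (dTan E b z ζ).1 = dBase E b z.proj ζ.1 := by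
  have h1 := hasFDerivAt_comp_extChartAt_symm (hasMFDerivAt_tanChart hz)
  rw [extChartAt_tan] at h1
  have hq : z.proj ∈ (chartAt E z.proj).source := mem_chart_source E _
  have hM := isManifold_one (E := E) (Q := Q)
  have hb : HasMFDerivAt 𝓘(ℝ, E) 𝓘(ℝ, E) (extChartAt 𝓘(ℝ, E) b) z.proj (dBase E b z.proj) :=
    (mdifferentiableAt_extChartAt hz).hasMFDerivAt
  have h2 := hasFDerivAt_comp_extChartAt_symm hb
  rw [← tanChart_fst] at h2
  have h3 := h2.comp (tanChart E z.proj z) (hasFDerivAt_fst (𝕜 := ℝ))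
  have h4 := (hasFDerivAt_fst (𝕜 := ℝ)).comp (tanChart E z.proj z) h1
  have h5 : Prod.fst ∘ tanChart E b ∘ (tanChart E z.proj).symm =ᶠ[𝓝 (tanChart E z.proj z)]
      (extChartAt 𝓘(ℝ, E) b ∘ (extChartAt 𝓘(ℝ, E) z.proj).symm) ∘ Prod.fst := by
    have ht : (tanChart E z.proj).target ∈ 𝓝 (tanChart E z.proj z) := by
      rw [← extChartAt_tan]
      exact extChartAt_target_mem_nhds z
    filter_upwards [ht] with u hu
    simp only [Function.comp_apply, tanChart_fst, proj_tanChart_symm (mem_tanChart_target.1 hu)]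
  exact DFunLike.congr_fun (h4.unique (h3.congr_of_eventuallyEq h5)) ζ

end Charts

/-! ### Naturality of the pairing between `T*Q` and `TQ` -/

section Charts
variable [IsManifold 𝓘(ℝ, E) ∞ Q]

/-- The pairing of a covector with a vector over the same point, in a chart over `b`. -/
theorem pairing_chart {b : Q} {z : CQ E Q} {v : TQ E Q} (h : z.proj = v.proj)
    (hz : z.proj ∈ (chartAt E b).source) :
    (cotChart E b z).2 (tanChart E b v).2 = covector z (vector v) := by
  rw [tanChart_snd (h ▸ hz), ← h, cotChart_snd hz]

/-- The derivative of the pairing of covectors with vectors, in a chart over `b`. -/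
theorem pairing_deriv {b : Q} {z : CQ E Q} {v : TQ E Q} (h : z.proj = v.proj)
    (hz : z.proj ∈ (chartAt E b).source) (δ : E) (ϖ : E →L[ℝ] ℝ) (ε : E) :
    (dCot E b z (δ, ϖ)).2 (dBase E b z.proj (vector v)) + (cotChart E b z).2 (dTan E b v (δ, ε)).2 =
      ϖ (vector v) + covector z ε := by
  have hv : v.proj ∈ (chartAt E b).source := h ▸ hz
  have h1 := hasFDerivAt_comp_extChartAt_symm (hasMFDerivAt_cotChart hz)
  have h2 := hasFDerivAt_comp_extChartAt_symm (hasMFDerivAt_tanChart hv)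
  rw [extChartAt_cot] at h1
  rw [extChartAt_tan, ← h] at h2
  obtain ⟨q, hq⟩ : ∃ q, q = z.proj := ⟨_, rfl⟩
  rw [← hq] at h1 h2
  have hzq : z.proj ∈ (chartAt E q).source := hq ▸ mem_chart_source E _
  have hvq : v.proj ∈ (chartAt E q).source := h ▸ hzq
  have ezl : (cotChart E q).symm (cotChart E q z) = z :=
    (cotChart E q).left_inv (mem_cotChart_source.2 hzq)
  have evl : (tanChart E q).symm (tanChart E q v) = v :=
    (tanChart E q).left_inv (mem_tanChart_source.2 hvq)
  have hd : dBase E q q = ContinuousLinearMap.id ℝ E := dBase_self q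
  have ez1 : (cotChart E q z).1 = (tanChart E q v).1 := by rw [cotChart_fst, tanChart_fst, h]
  have ez2 : (cotChart E q z).2 = covector z := by
    ext ξ
    have := cotChart_snd hzq ξ
    rwa [← hq, hd] at this
  have ev2 : (tanChart E q v).2 = vector v := by
    rw [tanChart_snd hvq, ← h, ← hq, hd]; rfl
  -- coordinates `(y, π, w)` for a covector and a vector over the same point
  let y₀ : (E × (E →L[ℝ] ℝ)) × E := (cotChart E q z, (tanChart E q v).2)
  let i : (E × (E →L[ℝ] ℝ)) × E →L[ℝ] E × E :=
    ((ContinuousLinearMap.fst ℝ _ _).comp (ContinuousLinearMap.fst ℝ _ _)).prod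
      (ContinuousLinearMap.snd ℝ _ _)
  have hi : i y₀ = tanChart E q v := Prod.ext ez1 rfl
  have k1 := h1.comp (g := cotChart E b ∘ (cotChart E q).symm) y₀
    (hasFDerivAt_fst (𝕜 := ℝ) (p := y₀))
  rw [← hi] at h2
  have k2 := h2.comp y₀ i.hasFDerivAt
  have k3 := ((hasFDerivAt_snd (𝕜 := ℝ)).comp y₀ k1).clm_apply ((hasFDerivAt_snd (𝕜 := ℝ)).comp y₀ k2)
  have k4 : HasFDerivAt (fun y : (E × (E →L[ℝ] ℝ)) × E => y.1.2 y.2) _ y₀ :=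
    ((hasFDerivAt_snd (𝕜 := ℝ)).comp y₀ (hasFDerivAt_fst (𝕜 := ℝ) (p := y₀))).clm_apply
      (hasFDerivAt_snd (𝕜 := ℝ) (p := y₀))
  have htq : ∀ᶠ y in 𝓝 y₀, y.1.1 ∈ (extChartAt 𝓘(ℝ, E) q).target := by
    have hc : Continuous fun y : (E × (E →L[ℝ] ℝ)) × E => y.1.1 := by fun_prop
    refine hc.continuousAt.eventually_mem ((isOpen_extChartAt_target q).mem_nhds ?_)
    change (cotChart E q z).1 ∈ _
    exact mem_cotChart_target.1 ((cotChart E q).map_source (mem_cotChart_source.2 hzq))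
  have hbq : ∀ᶠ y in 𝓝 y₀, (extChartAt 𝓘(ℝ, E) q).symm y.1.1 ∈ (chartAt E b).source := by
    have hc : ContinuousAt (fun y : (E × (E →L[ℝ] ℝ)) × E => (extChartAt 𝓘(ℝ, E) q).symm y.1.1)
        y₀ := by
      refine ContinuousAt.comp (g := (extChartAt 𝓘(ℝ, E) q).symm) ?_
        (by fun_prop : Continuous fun y : (E × (E →L[ℝ] ℝ)) × E => y.1.1).continuousAt
      exact continuousAt_extChartAt_symm'' htq.self_of_nhds
    refine hc.eventually_mem ((chartAt E b).open_source.mem_nhds ?_)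
    change (extChartAt 𝓘(ℝ, E) q).symm (cotChart E q z).1 ∈ _
    rw [cotChart_fst, (extChartAt 𝓘(ℝ, E) q).left_inv (by simpa using hzq)]
    exact hz
  -- The charts over `b` and `q` compute the same pairing, so near `y₀` the expression through the
  -- chart over `b` is the plain evaluation `y.1.2 y.2`. Uniqueness of the derivative then gives the
  -- claim.
  have k5 : (fun y => (Prod.snd ∘ (cotChart E b ∘ (cotChart E q).symm) ∘ Prod.fst) y
      ((Prod.snd ∘ (tanChart E b ∘ (tanChart E q).symm) ∘ i) y)) =ᶠ[𝓝 y₀]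
      fun y : (E × (E →L[ℝ] ℝ)) × E => y.1.2 y.2 := by
    filter_upwards [htq, hbq] with y hy hyb
    have p1 := proj_cotChart_symm (u := y.1) hy
    have p2 := proj_tanChart_symm (u := i y) hy
    have p12 := p1.trans p2.symm
    have hy' : (extChartAt 𝓘(ℝ, E) q).symm y.1.1 ∈ (chartAt E q).source := by
      simpa using (extChartAt 𝓘(ℝ, E) q).map_target hy
    have r1 := pairing_chart (b := b) p12 (by rwa [p1])
    have r2 := pairing_chart (b := q) p12 (by rwa [p1])
    rw [(cotChart E q).right_inv (mem_cotChart_target.2 hy),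
      (tanChart E q).right_inv ((mem_tanChart_target (u := i y)).2 hy)] at r2
    exact r1.trans r2.symm
  have k6 := k3.unique (k4.congr_of_eventuallyEq k5)
  have i1 : (i ((δ, ϖ), ε)) = (δ, ε) := rfl
  have i2 : (tanChart E b ((tanChart E q).symm (i y₀))).2 = dBase E b z.proj (vector v) := by
    rw [hi, evl, tanChart_snd hv, ← h]
  have i3 : (cotChart E b ((cotChart E q).symm y₀.1)).2 = (cotChart E b z).2 :=
    congrArg (fun x => (cotChart E b x).2) ezl
  have i4 : y₀.1.2 = covector z := ez2
  have i5 : y₀.2 = vector v := ev2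
  have k7 := DFunLike.congr_fun k6 ((δ, ϖ), ε)
  simp only [add_apply, ContinuousLinearMap.comp_apply,
    ContinuousLinearMap.flip_apply, ContinuousLinearMap.coe_fst', ContinuousLinearMap.coe_snd',
    Function.comp_apply, i1, i2, i3, i4, i5] at k7
  rw [add_comm, k7, add_comm]

/-- The differential of a function on `T*Q`, on the model space. -/
def dModel (H : CQ E Q → ℝ) (z : CQ E Q) : E × (E →L[ℝ] ℝ) →L[ℝ] ℝ := dH H z

theorem contDiffAt_comp_cotChart_symm {H : CQ E Q → ℝ} (hH : ContMDiff (cModel E) 𝓘(ℝ, ℝ) ∞ H)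
    {b : Q} {u : E × (E →L[ℝ] ℝ)} (hu : u ∈ (cotChart E b).target) :
    ContDiffAt ℝ ∞ (H ∘ (cotChart E b).symm) u := by
  rw [← contMDiffAt_iff_contDiffAt]
  have : IsManifold (cModel E) ∞ (CQ E Q) := inferInstance
  have h1 := contMDiffOn_extChartAt_symm (I := cModel E) (n := ∞) (⟨b, 0⟩ : CQ E Q)
  exact hH.contMDiffAt.comp u (h1.contMDiffAt
    ((isOpen_extChartAt_target (I := cModel E) (⟨b, 0⟩ : CQ E Q)).mem_nhds hu))

theorem dModel_eq {H : CQ E Q → ℝ} (hH : ContMDiff (cModel E) 𝓘(ℝ, ℝ) ∞ H)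
    {b : Q} {z : CQ E Q} (hz : z.proj ∈ (chartAt E b).source) (η : E × (E →L[ℝ] ℝ)) :
    dModel H z η = fderiv ℝ (H ∘ (cotChart E b).symm) (cotChart E b z) (dCot E b z η) := by
  have hs := mem_cotChart_source.2 hz
  have h1 := (contDiffAt_comp_cotChart_symm hH ((cotChart E b).map_source hs)).differentiableAt
    (by simp)
  have h2 := h1.hasFDerivAt.hasMFDerivAt.comp z (hasMFDerivAt_cotChart hz)
  have h3 : (H ∘ (cotChart E b).symm) ∘ cotChart E b =ᶠ[𝓝 z] H := by
    have : (cotChart E b).source ∈ 𝓝 z :=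
      (isOpen_extChartAt_source (I := cModel E) (⟨b, 0⟩ : CQ E Q)).mem_nhds hs
    filter_upwards [this] with w hw
    simp only [Function.comp_apply, (cotChart E b).left_inv hw]
  exact DFunLike.congr_fun ((h2.congr_of_eventuallyEq h3.symm).mfderiv) η

end Charts

/-! ### Hamiltonian vector fields in a fixed chart -/

section Hamiltonian
variable [FiniteDimensional ℝ E]

variable (E) in
/-- The map `ω^♯` on the model space, `D ↦ (∂D/∂p, -∂D/∂q)`. -/
def sharpModel : (E × (E →L[ℝ] ℝ) →L[ℝ] ℝ) →L[ℝ] E × (E →L[ℝ] ℝ) :=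
  -- By `omega_apply` the form has the same constant coefficients at every point in preferred
  -- coordinates, so the origin of `T*E` serves as the model for all of them.
  let s : (E × (E →L[ℝ] ℝ) →L[ℝ] ℝ) →ₗ[ℝ] E × (E →L[ℝ] ℝ) :=
    (sharp (Q := E) (⟨0, 0⟩ : CQ E E)).toLinearMap
  have hs : Continuous s := LinearMap.continuous_of_finiteDimensional (𝕜 := ℝ)
    (E := E × (E →L[ℝ] ℝ) →L[ℝ] ℝ) (F' := E × (E →L[ℝ] ℝ)) s
  ⟨s, hs⟩

theorem sharpModel_spec (D : E × (E →L[ℝ] ℝ) →L[ℝ] ℝ) (η : E × (E →L[ℝ] ℝ)) :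
    D η = η.2 (sharpModel E D).1 - (sharpModel E D).2 η.1 := by
  have h : flat (Q := E) (⟨0, 0⟩ : CQ E E) (sharp (Q := E) (⟨0, 0⟩ : CQ E E) D) = D :=
    LinearEquiv.apply_symm_apply (LinearEquiv.ofBijective _ (flat_bijective _)) D
  refine (DFunLike.congr_fun h η).symm.trans ?_
  exact omega_apply (Q := E) (⟨0, 0⟩ : CQ E E) (sharpModel E D) η

variable [IsManifold 𝓘(ℝ, E) ∞ Q]

/-- The value of the Hamiltonian vector field of `h • H`, on the model space. -/
def hamVec (H : CQ E Q → ℝ) (h : ℝ) (z : CQ E Q) : E × (E →L[ℝ] ℝ) := sharp z (h • dH H z)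

theorem hamVec_spec (H : CQ E Q → ℝ) (h : ℝ) (z : CQ E Q) (η : E × (E →L[ℝ] ℝ)) :
    h * dModel H z η = η.2 (hamVec H h z).1 - (hamVec H h z).2 η.1 := by
  have h1 : flat z (sharp z (h • dH H z)) = h • dH H z :=
    LinearEquiv.apply_symm_apply (LinearEquiv.ofBijective _ (flat_bijective z)) _
  refine Eq.trans ?_ ((DFunLike.congr_fun h1 η).symm.trans (omega_apply z _ η))
  rfl

/-- The Hamiltonian vector field of `h • H` in the chart over `b`. -/
def hamChart (H : CQ E Q → ℝ) (b : Q) (h : ℝ) (u : E × (E →L[ℝ] ℝ)) : E × (E →L[ℝ] ℝ) :=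
  sharpModel E (h • fderiv ℝ (H ∘ (cotChart E b).symm) u)

theorem hamChart_spec (H : CQ E Q → ℝ) (b : Q) (h : ℝ) (u η : E × (E →L[ℝ] ℝ)) :
    h * fderiv ℝ (H ∘ (cotChart E b).symm) u η =
      η.2 (hamChart H b h u).1 - (hamChart H b h u).2 η.1 :=
  sharpModel_spec (h • fderiv ℝ (H ∘ (cotChart E b).symm) u) η

/-- The `q`-component of the field is seen by `dH` on vertical vectors, and a vertical vector `g ∘
dBase` becomes `g` in the chart. Testing against all `g` determines the component. -/
theorem hamChart_fst {H : CQ E Q → ℝ} (hH : ContMDiff (cModel E) 𝓘(ℝ, ℝ) ∞ H)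
    {b : Q} {z : CQ E Q} (hz : z.proj ∈ (chartAt E b).source) (h : ℝ) :
    (hamChart H b h (cotChart E b z)).1 = dBase E b z.proj (hamVec H h z).1 := by
  refine (SeparatingDual.eq_iff_forall_dual_eq (R := ℝ)).2 fun g => ?_
  have h0 : dCot E b z (0, g ∘L dBase E b z.proj) = (0, g) := by
    refine Prod.ext ((dCot_fst hz _).trans (map_zero _)) (ContinuousLinearMap.ext fun a => ?_)
    obtain ⟨A, hA⟩ := dBase_isInvertible hz
    -- With zero base and fibre variations of the vector, the pairing identity isolates the vertical
    -- variation of the covector.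
    have h1 := pairing_deriv (v := ⟨z.proj, A.symm a⟩) rfl hz 0 (g ∘L dBase E b z.proj) 0
    have h2 : vector (⟨z.proj, A.symm a⟩ : TQ E Q) = A.symm a := rfl
    have h3 : ((0 : E), (0 : E)) = 0 := rfl
    rw [h2, h3] at h1
    simpa [← hA] using h1
  have h1 := hamVec_spec H h z (0, g ∘L dBase E b z.proj)
  rw [dModel_eq hH hz, h0, hamChart_spec] at h1
  simpa using h1

/-- The canonical map `TT*Q → T*TQ` takes the Hamiltonian vector field to the covector
`(-∂H/∂q, p)` in every chart of `Q`. -/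
theorem alpha_hamVec {H : CQ E Q → ℝ} (hH : ContMDiff (cModel E) 𝓘(ℝ, ℝ) ∞ H)
    {b : Q} {z : CQ E Q} (hz : z.proj ∈ (chartAt E b).source) (h : ℝ) (ζ : E × E) :
    (hamChart H b h (cotChart E b z)).2 (dTan E b ⟨z.proj, (hamVec H h z).1⟩ ζ).1 +
      (cotChart E b z).2 (dTan E b ⟨z.proj, (hamVec H h z).1⟩ ζ).2 =
    (hamVec H h z).2 ζ.1 + covector z ζ.2 := by
  -- Hamilton's equations and the pairing identity are taken for the same variation `(ζ.1, 0)` of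
  -- `z`. The derivative of the chart in the fibre direction is common to both and cancels.
  have h1 := hamVec_spec H h z (ζ.1, 0)
  rw [dModel_eq hH hz, hamChart_spec, dCot_fst hz, hamChart_fst hH hz] at h1
  have h2 := pairing_deriv (v := ⟨z.proj, (hamVec H h z).1⟩) rfl hz ζ.1 0 ζ.2
  have h3 : vector (⟨z.proj, (hamVec H h z).1⟩ : TQ E Q) = (hamVec H h z).1 := rfl
  rw [h3] at h2
  rw [dTan_fst (z := ⟨z.proj, (hamVec H h z).1⟩) hz]
  simp only [zero_apply] at h1 h2
  change (hamChart H b h (cotChart E b z)).2 (dBase E b z.proj ζ.1) + _ = _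
  linarith

end Hamiltonian

/-! ### The inverse function theorem on manifolds without boundary -/

section InverseFunction

variable {F₁ F₂ K₁ K₂ M N : Type*} [NormedAddCommGroup F₁] [NormedSpace ℝ F₁]
  [NormedAddCommGroup F₂] [NormedSpace ℝ F₂] [TopologicalSpace K₁] [TopologicalSpace K₂]
  {I : ModelWithCorners ℝ F₁ K₁} {J : ModelWithCorners ℝ F₂ K₂}
  [TopologicalSpace M] [ChartedSpace K₁ M] [TopologicalSpace N] [ChartedSpace K₂ N]

theorem isLocalDiffeomorphAt_congr {f g : M → N} {x : M} (hf : IsLocalDiffeomorphAt I J ∞ f x)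
    (h : f =ᶠ[𝓝 x] g) : IsLocalDiffeomorphAt I J ∞ g x := by
  obtain ⟨Φ, hx, hΦ⟩ := hf
  obtain ⟨s, hs, hso, hxs⟩ := eventually_nhds_iff.1 h
  let e := Φ.toOpenPartialHomeomorph.restrOpen s hso
  refine ⟨⟨e.toPartialEquiv, e.open_source, e.open_target, ?_, ?_⟩, ⟨hx, hxs⟩, ?_⟩
  · exact Φ.contMDiffOn_toFun.mono fun y hy => hy.1
  · exact Φ.contMDiffOn_invFun.mono fun y hy => hy.1
  · intro y hy
    exact (hs y hy.2).symm.trans (hΦ hy.1)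

/-- The inverse function theorem makes the local inverse smooth at one point. Invertibility is an
open condition on the derivative, so after shrinking the source the same argument applies at every
point of the target. -/
theorem isLocalDiffeomorphAt_of_hasFDerivAt [CompleteSpace F₁] {f : F₁ → F₂} {a : F₁}
    {f' : F₁ ≃L[ℝ] F₂} (hf : ∀ᶠ y in 𝓝 a, ContDiffAt ℝ ∞ f y)
    (hf' : HasFDerivAt f (f' : F₁ →L[ℝ] F₂) a) :
    IsLocalDiffeomorphAt 𝓘(ℝ, F₁) 𝓘(ℝ, F₂) ∞ f a := by
  let e := hf.self_of_nhds.toOpenPartialHomeomorph f hf' (by simp)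
  have hc : ContinuousAt (fderiv ℝ f) a :=
    (hf.self_of_nhds.fderiv_right (m := 0) (by norm_num)).continuousAt
  have hi : ∀ᶠ y in 𝓝 a, fderiv ℝ f y ∈ Set.range ((↑) : (F₁ ≃L[ℝ] F₂) → F₁ →L[ℝ] F₂) := by
    refine hc.eventually_mem ?_
    rw [hf'.fderiv]
    exact f'.nhds
  obtain ⟨s, hs, hso, hxs⟩ := eventually_nhds_iff.1 (hf.and hi)
  let e' := e.restrOpen s hso
  refine ⟨⟨e'.toPartialEquiv, e'.open_source, e'.open_target, ?_, ?_⟩, ⟨?_, hxs⟩, fun y _ => rfl⟩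
  · intro y hy
    exact (hs y hy.2).1.contMDiffAt.contMDiffWithinAt
  · intro y hy
    have h1 := e'.map_target hy
    obtain ⟨h2, g, hg⟩ := hs _ h1.2
    have h3 : ContDiffAt ℝ ∞ e'.symm y := by
      refine e'.contDiffAt_symm (f₀' := g) hy ?_ h2
      rw [hg]
      exact (h2.differentiableAt (by simp)).hasFDerivAt
    exact h3.contMDiffAt.contMDiffWithinAt
  · exact hf.self_of_nhds.mem_toOpenPartialHomeomorph_source hf' (by simp)

variable [I.Boundaryless] [J.Boundaryless] [IsManifold I ∞ M] [IsManifold J ∞ N]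

theorem isLocalDiffeomorphAt_extChartAt {x y : M} (hy : y ∈ (extChartAt I x).source) :
    IsLocalDiffeomorphAt I 𝓘(ℝ, F₁) ∞ (extChartAt I x) y := by
  refine ⟨⟨extChartAt I x, isOpen_extChartAt_source x, isOpen_extChartAt_target x, ?_, ?_⟩, hy,
    fun y _ => rfl⟩
  · have := contMDiffOn_extChartAt (I := I) (n := ∞) (x := x)
    rwa [← extChartAt_source (I := I)] at this
  · exact contMDiffOn_extChartAt_symm x

theorem isLocalDiffeomorphAt_extChartAt_symm {x : M} {y : F₁} (hy : y ∈ (extChartAt I x).target) :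
    IsLocalDiffeomorphAt 𝓘(ℝ, F₁) I ∞ (extChartAt I x).symm y := by
  refine ⟨⟨(extChartAt I x).symm, isOpen_extChartAt_target x, isOpen_extChartAt_source x, ?_, ?_⟩,
    hy, fun y _ => rfl⟩
  · exact contMDiffOn_extChartAt_symm x
  · have := contMDiffOn_extChartAt (I := I) (n := ∞) (x := x)
    rwa [← extChartAt_source (I := I)] at this

/-- The inverse function theorem for maps between manifolds without boundary. -/
theorem isLocalDiffeomorphAt_of_hasMFDerivAt [CompleteSpace F₁] {f : M → N} {x : M}
    {f' : F₁ ≃L[ℝ] F₂} (hf : ∀ᶠ y in 𝓝 x, ContMDiffAt I J ∞ f y)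
    (hf' : HasMFDerivAt I J f x (f' : F₁ →L[ℝ] F₂)) : IsLocalDiffeomorphAt I J ∞ f x := by
  have h1 : HasFDerivWithinAt (writtenInExtChartAt I J x f) (f' : F₁ →L[ℝ] F₂) (Set.range I)
      (extChartAt I x x) := hf'.2
  rw [ModelWithCorners.range_eq_univ, hasFDerivWithinAt_univ] at h1
  have hxt := mem_extChartAt_target (I := I) x
  have hsx : (extChartAt I x).symm (extChartAt I x x) = x := extChartAt_to_inv x
  have hcont : ContinuousAt (extChartAt I x).symm (extChartAt I x x) := continuousAt_extChartAt_symm x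
  have hsrc : ∀ᶠ y in 𝓝 x, f y ∈ (extChartAt J (f x)).source :=
    hf.self_of_nhds.continuousAt.eventually_mem (extChartAt_source_mem_nhds (f x))
  have h2 : ∀ᶠ y in 𝓝 (extChartAt I x x), ContDiffAt ℝ ∞ (writtenInExtChartAt I J x f) y := by
    have h3 := (hf.and hsrc)
    rw [← hsx] at h3
    filter_upwards [hcont.eventually h3, (isOpen_extChartAt_target x).mem_nhds hxt]
      with y ⟨hy1, hy2⟩ hyt
    rw [← contMDiffAt_iff_contDiffAt]
    have h4 := (isLocalDiffeomorphAt_extChartAt (I := J) hy2).contMDiffAt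
    have h5 := (isLocalDiffeomorphAt_extChartAt_symm (I := I) hyt).contMDiffAt
    rw [hsx] at h4
    exact h4.comp y (hy1.comp y h5)
  have h6 := isLocalDiffeomorphAt_of_hasFDerivAt h2 h1
  have h7 := isLocalDiffeomorphAt_extChartAt (I := I) (mem_extChartAt_source (I := I) x)
  have h8 := h7.comp (K := 𝓘(ℝ, F₂)) (P := F₂) h6
  have h9 : (writtenInExtChartAt I J x f ∘ extChartAt I x) x ∈ (extChartAt J (f x)).target := by
    simp only [writtenInExtChartAt, Function.comp_apply, hsx]
    exact mem_extChartAt_target _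
  refine isLocalDiffeomorphAt_congr (h8.comp (K := J) (P := N) (isLocalDiffeomorphAt_extChartAt_symm h9)) ?_
  filter_upwards [hsrc, extChartAt_source_mem_nhds (I := I) x] with y hy hys
  simp only [writtenInExtChartAt, Function.comp_apply, (extChartAt I x).left_inv hys]
  exact (extChartAt J (f x)).left_inv hy

end InverseFunction

variable [IsManifold 𝓘(ℝ, E) ∞ Q]

/-! ### The discretization map in charts -/

section LocalExpression

/-- The differential of `R : TQ → Q × Q`, on the model spaces. -/
def dR (R : TQ E Q → Q × Q) (v : TQ E Q) : E × E →L[ℝ] E × E :=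
  mfderiv (tModel E) (𝓘(ℝ, E).prod 𝓘(ℝ, E)) R v

/-- The expression of `R : TQ → Q × Q` in the charts over `b` and `c`. -/
def localR (R : TQ E Q → Q × Q) (b : Q) (c : Q × Q) (t : E × E) : E × E :=
  (extChartAt 𝓘(ℝ, E) c.1 (R ((tanChart E b).symm t)).1,
    extChartAt 𝓘(ℝ, E) c.2 (R ((tanChart E b).symm t)).2)

theorem cotChart_contMDiffAt {b : Q} {z : CQ E Q} (hz : z.proj ∈ (chartAt E b).source) :
    ContMDiffAt (cModel E) 𝓘(ℝ, E × (E →L[ℝ] ℝ)) ∞ (cotChart E b) z :=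
  (isLocalDiffeomorphAt_extChartAt (I := cModel E) (x := (⟨b, 0⟩ : CQ E Q))
    (mem_cotChart_source.2 hz)).contMDiffAt

theorem tanChart_contMDiffAt {b : Q} {v : TQ E Q} (hv : v.proj ∈ (chartAt E b).source) :
    ContMDiffAt (tModel E) 𝓘(ℝ, E × E) ∞ (tanChart E b) v :=
  (isLocalDiffeomorphAt_extChartAt (I := tModel E) (x := (⟨b, 0⟩ : TQ E Q))
    (mem_tanChart_source.2 hv)).contMDiffAt

theorem cotChart_symm_contMDiffAt {b : Q} {u : E × (E →L[ℝ] ℝ)} (hu : u ∈ (cotChart E b).target) :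
    ContMDiffAt 𝓘(ℝ, E × (E →L[ℝ] ℝ)) (cModel E) ∞ (cotChart E b).symm u :=
  (isLocalDiffeomorphAt_extChartAt_symm (I := cModel E) (x := (⟨b, 0⟩ : CQ E Q)) hu).contMDiffAt

theorem tanChart_symm_contMDiffAt {b : Q} {t : E × E} (ht : t ∈ (tanChart E b).target) :
    ContMDiffAt 𝓘(ℝ, E × E) (tModel E) ∞ (tanChart E b).symm t :=
  (isLocalDiffeomorphAt_extChartAt_symm (I := tModel E) (x := (⟨b, 0⟩ : TQ E Q)) ht).contMDiffAt

theorem baseChart_contMDiffAt {b q : Q} (hq : q ∈ (chartAt E b).source) :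
    ContMDiffAt 𝓘(ℝ, E) 𝓘(ℝ, E) ∞ (extChartAt 𝓘(ℝ, E) b) q :=
  (isLocalDiffeomorphAt_extChartAt (I := 𝓘(ℝ, E)) (by simpa using hq)).contMDiffAt

variable {R : TQ E Q → Q × Q} {b : Q} {c : Q × Q} {v : TQ E Q}

theorem localR_contDiffAt (hR : ContMDiffAt (tModel E) (𝓘(ℝ, E).prod 𝓘(ℝ, E)) ∞ R v)
    (hv : v.proj ∈ (chartAt E b).source) (h1 : (R v).1 ∈ (chartAt E c.1).source)
    (h2 : (R v).2 ∈ (chartAt E c.2).source) :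
    ContDiffAt ℝ ∞ (localR R b c) (tanChart E b v) := by
  have hs := mem_tanChart_source.2 hv
  have hl : (tanChart E b).symm (tanChart E b v) = v := (tanChart E b).left_inv hs
  have ht := tanChart_symm_contMDiffAt ((tanChart E b).map_source hs)
  rw [← hl] at hR h1 h2
  have hR' := hR.comp _ ht
  have e1 := (baseChart_contMDiffAt h1).comp (tanChart E b v) (contMDiffAt_fst.comp _ hR')
  have e2 := (baseChart_contMDiffAt h2).comp (tanChart E b v) (contMDiffAt_snd.comp _ hR')
  rw [contMDiffAt_iff_contDiffAt] at e1 e2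
  exact e1.prodMk e2

/-- The chain rule applied to each component of `localR R b c ∘ tanChart E b`. It ties `dR`, which
is read in moving charts, to an ordinary derivative whose dependence on the point can be
differentiated again. -/
theorem fderiv_localR (hR : ContMDiffAt (tModel E) (𝓘(ℝ, E).prod 𝓘(ℝ, E)) ∞ R v)
    (hv : v.proj ∈ (chartAt E b).source) (h1 : (R v).1 ∈ (chartAt E c.1).source)
    (h2 : (R v).2 ∈ (chartAt E c.2).source) (ζ : E × E) :
    fderiv ℝ (localR R b c) (tanChart E b v) (dTan E b v ζ) =
      (dBase E c.1 (R v).1 (dR R v ζ).1, dBase E c.2 (R v).2 (dR R v ζ).2) := by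
  have hM := isManifold_one (E := E) (Q := Q)
  have k1 := ((localR_contDiffAt hR hv h1 h2).differentiableAt (by simp)).hasFDerivAt
  have k2 := k1.hasMFDerivAt.comp v (hasMFDerivAt_tanChart hv)
  have hRd : HasMFDerivAt (tModel E) (𝓘(ℝ, E).prod 𝓘(ℝ, E)) R v (dR R v) :=
    (hR.mdifferentiableAt (by simp)).hasMFDerivAt
  have d1 : HasMFDerivAt 𝓘(ℝ, E) 𝓘(ℝ, E) (extChartAt 𝓘(ℝ, E) c.1) (R v).1 (dBase E c.1 (R v).1) :=
    (mdifferentiableAt_extChartAt h1).hasMFDerivAt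
  have d2 : HasMFDerivAt 𝓘(ℝ, E) 𝓘(ℝ, E) (extChartAt 𝓘(ℝ, E) c.2) (R v).2 (dBase E c.2 (R v).2) :=
    (mdifferentiableAt_extChartAt h2).hasMFDerivAt
  have e1 := d1.comp v ((hasMFDerivAt_fst (I := 𝓘(ℝ, E)) (I' := 𝓘(ℝ, E)) (R v)).comp v hRd)
  have e2 := d2.comp v ((hasMFDerivAt_snd (I := 𝓘(ℝ, E)) (I' := 𝓘(ℝ, E)) (R v)).comp v hRd)
  have hl : ∀ᶠ w in 𝓝 v, (tanChart E b).symm (tanChart E b w) = w := by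
    have : (tanChart E b).source ∈ 𝓝 v :=
      (isOpen_extChartAt_source (I := tModel E) (⟨b, 0⟩ : TQ E Q)).mem_nhds
        (mem_tanChart_source.2 hv)
    filter_upwards [this] with w hw
    exact (tanChart E b).left_inv hw
  have k3 := ((ContinuousLinearMap.fst ℝ E E).hasMFDerivAt).comp v k2
  have k4 := ((ContinuousLinearMap.snd ℝ E E).hasMFDerivAt).comp v k2
  have ev1 : extChartAt 𝓘(ℝ, E) c.1 ∘ Prod.fst ∘ R =ᶠ[𝓝 v]
      ContinuousLinearMap.fst ℝ E E ∘ localR R b c ∘ tanChart E b := by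
    filter_upwards [hl] with w hw
    simp [localR, hw]
  have ev2 : extChartAt 𝓘(ℝ, E) c.2 ∘ Prod.snd ∘ R =ᶠ[𝓝 v]
      ContinuousLinearMap.snd ℝ E E ∘ localR R b c ∘ tanChart E b := by
    filter_upwards [hl] with w hw
    simp [localR, hw]
  exact Prod.ext (DFunLike.congr_fun (hasMFDerivAt_unique (k3.congr_of_eventuallyEq ev1) e1) ζ)
    (DFunLike.congr_fun (hasMFDerivAt_unique (k4.congr_of_eventuallyEq ev2) e2) ζ)

theorem fderiv_localR_isInvertible
    (hR : IsLocalDiffeomorphAt (tModel E) (𝓘(ℝ, E).prod 𝓘(ℝ, E)) ∞ R v)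
    (hv : v.proj ∈ (chartAt E b).source) (h1 : (R v).1 ∈ (chartAt E c.1).source)
    (h2 : (R v).2 ∈ (chartAt E c.2).source) :
    (fderiv ℝ (localR R b c) (tanChart E b v)).IsInvertible := by
  obtain ⟨D, hD⟩ : (dR R v).IsInvertible :=
    ⟨hR.mfderivToContinuousLinearEquiv (by simp), rfl⟩
  obtain ⟨T, hT⟩ := dTan_isInvertible hv
  obtain ⟨A₁, hA₁⟩ := dBase_isInvertible h1
  obtain ⟨A₂, hA₂⟩ := dBase_isInvertible h2
  refine ⟨(T.symm.trans D).trans (A₁.prodCongr A₂), ?_⟩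
  refine ContinuousLinearMap.ext fun ζ => ?_
  have h3 := fderiv_localR hR.contMDiffAt hv h1 h2 (T.symm ζ)
  rw [← hT, ← hD, ← hA₁, ← hA₂] at h3
  simp only [ContinuousLinearEquiv.coe_coe, ContinuousLinearEquiv.apply_symm_apply] at h3
  rw [h3]
  rfl

end LocalExpression

/-! ### Parametrization of the scheme by the base point -/

section Flow
variable [FiniteDimensional ℝ E]

/-- The pair `R_d^{T*}(X_{hH}(z))`. -/
def schemeMap (R : TQ E Q → Q × Q) (H : CQ E Q → ℝ) (h : ℝ) (z : CQ E Q) : CQ E Q × CQ E Q :=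
  cotangentLift R ⟨z, sharp z (h • dH H z)⟩

/-- The projection to `TQ` of the Hamiltonian vector field of `h • H`. -/
def legendre (H : CQ E Q → ℝ) (h : ℝ) (z : CQ E Q) : TQ E Q := ⟨z.proj, (hamVec H h z).1⟩

theorem schemeMap_fst_proj (R : TQ E Q → Q × Q) (H : CQ E Q → ℝ) (h : ℝ) (z : CQ E Q) :
    (schemeMap R H h z).1.proj = (R (legendre H h z)).1 := rfl

theorem schemeMap_snd_proj (R : TQ E Q → Q × Q) (H : CQ E Q → ℝ) (h : ℝ) (z : CQ E Q) :
    (schemeMap R H h z).2.proj = (R (legendre H h z)).2 := rfl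

/-- The equation fixes the fibre part of `ξ` once its base point is known, so the base point is the
only free parameter. -/
theorem mem_scheme_iff {R : TQ E Q → Q × Q} {V : Set (TQ E Q)} {H : CQ E Q → ℝ} {h : ℝ}
    {y : CQ E Q × CQ E Q} :
    y ∈ scheme R V H h ↔ ∃ z, legendre H h z ∈ V ∧ schemeMap R H h z = y := by
  constructor
  · rintro ⟨ξ, h1, h2, h3⟩
    refine ⟨ξ.proj, ?_, ?_⟩
    · rw [h3] at h1; exact h1
    · rw [h3] at h2; exact h2
  · rintro ⟨z, h1, h2⟩
    exact ⟨⟨z, sharp z (h • dH H z)⟩, h1, h2, rfl⟩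

/-- `Phi` splits the transported covector `β = (ṗ, p) ∘ (dR)⁻¹` into `(-p₀, p₁)`. Evaluating on `dR
ζ` cancels the inverse. -/
theorem covector_schemeMap {R : TQ E Q → Q × Q} {H : CQ E Q → ℝ} {h : ℝ} {z : CQ E Q}
    (hR : (dR R (legendre H h z)).IsInvertible) (ζ : E × E) :
    covector (schemeMap R H h z).2 (dR R (legendre H h z) ζ).2 -
      covector (schemeMap R H h z).1 (dR R (legendre H h z) ζ).1 =
      (hamVec H h z).2 ζ.1 + covector z ζ.2 := by
  let β : E × E →L[ℝ] ℝ := (hamVec H h z).2.coprod (covector z) ∘L (dR R (legendre H h z)).inverse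
  have h1 : covector (schemeMap R H h z).1 = -(β ∘L ContinuousLinearMap.inl ℝ E E) := rfl
  have h2 : covector (schemeMap R H h z).2 = β ∘L ContinuousLinearMap.inr ℝ E E := rfl
  rw [h1, h2]
  obtain ⟨D, hD⟩ := hR
  have h3 : β (D ζ) = (hamVec H h z).2 ζ.1 + covector z ζ.2 := by
    simp only [β, ← hD, ContinuousLinearMap.inverse_equiv]
    simp
  rw [← h3, ← hD]
  have h4 : D ζ = ((D ζ).1, 0) + (0, (D ζ).2) := by simp
  conv_rhs => rw [h4, map_add]
  simp
  ring

variable {R : TQ E Q → Q × Q} {H : CQ E Q → ℝ} {h : ℝ} {z : CQ E Q} {b : Q} {c : Q × Q}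

theorem tanChart_legendre (hH : ContMDiff (cModel E) 𝓘(ℝ, ℝ) ∞ H)
    (hz : z.proj ∈ (chartAt E b).source) :
    tanChart E b (legendre H h z) =
      ((cotChart E b z).1, (hamChart H b h (cotChart E b z)).1) := by
  refine Prod.ext ?_ ?_
  · rw [tanChart_fst, cotChart_fst]; rfl
  · rw [tanChart_snd hz, hamChart_fst hH hz]; rfl

/-- The equations of the scheme in charts. -/
theorem schemeMap_chart (hH : ContMDiff (cModel E) 𝓘(ℝ, ℝ) ∞ H)
    (hR : IsLocalDiffeomorphAt (tModel E) (𝓘(ℝ, E).prod 𝓘(ℝ, E)) ∞ R (legendre H h z))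
    (hz : z.proj ∈ (chartAt E b).source)
    (h1 : (R (legendre H h z)).1 ∈ (chartAt E c.1).source)
    (h2 : (R (legendre H h z)).2 ∈ (chartAt E c.2).source) (ζ : E × E) :
    (cotChart E c.2 (schemeMap R H h z).2).2
        (fderiv ℝ (localR R b c) (tanChart E b (legendre H h z)) ζ).2 -
      (cotChart E c.1 (schemeMap R H h z).1).2
        (fderiv ℝ (localR R b c) (tanChart E b (legendre H h z)) ζ).1 =
      (hamChart H b h (cotChart E b z)).2 ζ.1 + (cotChart E b z).2 ζ.2 := by
  have hz' : (legendre H h z).proj ∈ (chartAt E b).source := hz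
  obtain ⟨T, hT⟩ := dTan_isInvertible hz'
  -- The direction `T.symm ζ` is the one whose expression in the chart over `b` is `ζ`.
  have k1 := fderiv_localR hR.contMDiffAt hz' h1 h2 (T.symm ζ)
  have k2 := alpha_hamVec hH hz h (T.symm ζ)
  have k3 : dTan E b (legendre H h z) (T.symm ζ) = ζ := by rw [← hT]; simp
  rw [k3] at k1
  change (hamChart H b h (cotChart E b z)).2 (dTan E b (legendre H h z) (T.symm ζ)).1 +
      (cotChart E b z).2 (dTan E b (legendre H h z) (T.symm ζ)).2 = _ at k2
  rw [k3] at k2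
  rw [k2, k1]
  have k4 : (dR R (legendre H h z)).IsInvertible :=
    ⟨hR.mfderivToContinuousLinearEquiv (by simp), rfl⟩
  rw [← covector_schemeMap k4]
  simp only
  rw [← schemeMap_fst_proj, ← schemeMap_snd_proj, cotChart_snd, cotChart_snd]
  · exact h1
  · exact h2

end Flow

section ChartLemmas
variable {z : CQ E Q} {b : Q}

theorem cotChart_source_mem_nhds (hz : z.proj ∈ (chartAt E b).source) :
    (cotChart E b).source ∈ 𝓝 z :=
  (isOpen_extChartAt_source (I := cModel E) (⟨b, 0⟩ : CQ E Q)).mem_nhds (mem_cotChart_source.2 hz)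

theorem tanChart_source_mem_nhds {v : TQ E Q} (hv : v.proj ∈ (chartAt E b).source) :
    (tanChart E b).source ∈ 𝓝 v :=
  (isOpen_extChartAt_source (I := tModel E) (⟨b, 0⟩ : TQ E Q)).mem_nhds (mem_tanChart_source.2 hv)

/-- The chart `id × (chart over b)` of `ℝ × T*Q` is smooth. -/
theorem prodChart_contMDiffAt {y : ℝ × CQ E Q} (hy : y.2.proj ∈ (chartAt E b).source) :
    ContMDiffAt (𝓘(ℝ, ℝ).prod (cModel E)) 𝓘(ℝ, ℝ × (E × (E →L[ℝ] ℝ))) ∞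
      (fun y : ℝ × CQ E Q => (y.1, cotChart E b y.2)) y :=
  contMDiffAt_fst.prodMk_space ((cotChart_contMDiffAt hy).comp y contMDiffAt_snd)

end ChartLemmas

/-! ### Smoothness of the parametrization -/

section SchemeSmooth
variable [FiniteDimensional ℝ E]

/-- The expression of `(h, z) ↦ R_d^{T*}(X_{hH}(z))` in the charts over `b` and `c`. -/
def localScheme (R : TQ E Q → Q × Q) (H : CQ E Q → ℝ) (b : Q) (c : Q × Q)
    (y : ℝ × (E × (E →L[ℝ] ℝ))) : (E × (E →L[ℝ] ℝ)) × (E × (E →L[ℝ] ℝ)) :=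
  let X := hamChart H b y.1 y.2
  let t := (y.2.1, X.1)
  let β := (X.2 ∘L ContinuousLinearMap.fst ℝ E E + y.2.2 ∘L ContinuousLinearMap.snd ℝ E E) ∘L
    (fderiv ℝ (localR R b c) t).inverse
  (((localR R b c t).1, -(β ∘L ContinuousLinearMap.inl ℝ E E)),
    ((localR R b c t).2, β ∘L ContinuousLinearMap.inr ℝ E E))

variable {R : TQ E Q → Q × Q} {H : CQ E Q → ℝ} {h : ℝ} {z : CQ E Q} {b : Q} {c : Q × Q}

theorem hamChart_contDiffAt (hH : ContMDiff (cModel E) 𝓘(ℝ, ℝ) ∞ H)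
    {y : ℝ × (E × (E →L[ℝ] ℝ))} (hy : y.2 ∈ (cotChart E b).target) :
    ContDiffAt ℝ ∞ (fun y : ℝ × (E × (E →L[ℝ] ℝ)) => hamChart H b y.1 y.2) y := by
  have h1 : ContDiffAt ℝ ∞ (fderiv ℝ (H ∘ (cotChart E b).symm)) y.2 :=
    (contDiffAt_comp_cotChart_symm hH hy).fderiv_right (m := ∞) (by simp)
  have h2 : ContDiffAt ℝ ∞
      (fun y : ℝ × (E × (E →L[ℝ] ℝ)) => fderiv ℝ (H ∘ (cotChart E b).symm) y.2) y :=
    h1.comp (f := Prod.snd) y contDiffAt_snd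
  have h3 := (sharpModel E).contDiff.contDiffAt.comp y h2
  have h4 : (fun y : ℝ × (E × (E →L[ℝ] ℝ)) => hamChart H b y.1 y.2) = fun y =>
      y.1 • sharpModel E (fderiv ℝ (H ∘ (cotChart E b).symm) y.2) :=
    funext fun y => map_smul (sharpModel E) _ _
  rw [h4]
  exact contDiffAt_fst.smul h3

theorem localScheme_contDiffAt (hH : ContMDiff (cModel E) 𝓘(ℝ, ℝ) ∞ H)
    {y : ℝ × (E × (E →L[ℝ] ℝ))} (hy : y.2 ∈ (cotChart E b).target)
    (hr : ContDiffAt ℝ ∞ (localR R b c) (y.2.1, (hamChart H b y.1 y.2).1))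
    (hi : (fderiv ℝ (localR R b c) (y.2.1, (hamChart H b y.1 y.2).1)).IsInvertible) :
    ContDiffAt ℝ ∞ (localScheme R H b c) y := by
  have h1 := hamChart_contDiffAt (b := b) hH hy
  have ht : ContDiffAt ℝ ∞ (fun y : ℝ × (E × (E →L[ℝ] ℝ)) => (y.2.1, (hamChart H b y.1 y.2).1)) y :=
    ContDiffAt.prodMk (by fun_prop) (contDiffAt_fst.comp y h1)
  have hD : ContDiffAt ℝ ∞ (fderiv ℝ (localR R b c)) (y.2.1, (hamChart H b y.1 y.2).1) :=
    hr.fderiv_right (m := ∞) (by simp)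
  have hx := hr.comp y ht
  have hI := (hi.contDiffAt_map_inverse (n := ∞)).comp y (hD.comp y ht)
  have hβ : ContDiffAt ℝ ∞ (fun y : ℝ × (E × (E →L[ℝ] ℝ)) =>
      ((hamChart H b y.1 y.2).2 ∘L ContinuousLinearMap.fst ℝ E E +
        y.2.2 ∘L ContinuousLinearMap.snd ℝ E E) ∘L
      (fderiv ℝ (localR R b c) (y.2.1, (hamChart H b y.1 y.2).1)).inverse) y := by
    refine ContDiffAt.clm_comp (ContDiffAt.add ?_ ?_) hI
    · exact (contDiffAt_snd.comp y h1).clm_comp contDiffAt_const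
    · exact ContDiffAt.clm_comp (by fun_prop) contDiffAt_const
  exact ((contDiffAt_fst.comp y hx).prodMk (hβ.clm_comp contDiffAt_const).neg).prodMk
    ((contDiffAt_snd.comp y hx).prodMk (hβ.clm_comp contDiffAt_const))

/-- Since the derivative of `localR` is invertible, the identity of `schemeMap_chart` can be solved
for both momenta: its preimages of `(ε, 0)` and `(0, ε)` isolate `p₀` and `p₁`. -/
theorem cotChart_schemeMap (hH : ContMDiff (cModel E) 𝓘(ℝ, ℝ) ∞ H)
    (hR : IsLocalDiffeomorphAt (tModel E) (𝓘(ℝ, E).prod 𝓘(ℝ, E)) ∞ R (legendre H h z))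
    (hz : z.proj ∈ (chartAt E b).source)
    (h1 : (R (legendre H h z)).1 ∈ (chartAt E c.1).source)
    (h2 : (R (legendre H h z)).2 ∈ (chartAt E c.2).source) :
    (cotChart E c.1 (schemeMap R H h z).1, cotChart E c.2 (schemeMap R H h z).2) =
      localScheme R H b c (h, cotChart E b z) := by
  have hz' : (legendre H h z).proj ∈ (chartAt E b).source := hz
  have ht := tanChart_legendre (h := h) hH hz
  have hl : (tanChart E b).symm (tanChart E b (legendre H h z)) = legendre H h z :=
    (tanChart E b).left_inv (mem_tanChart_source.2 hz')
  obtain ⟨D, hD⟩ := fderiv_localR_isInvertible hR hz' h1 h2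
  have k := schemeMap_chart hH hR hz h1 h2
  rw [← hD] at k
  have k1 (ε : E × E) := k (D.symm ε)
  simp only [ContinuousLinearEquiv.coe_coe, ContinuousLinearEquiv.apply_symm_apply] at k1
  unfold localScheme
  simp only [← ht, ← hD, ContinuousLinearMap.inverse_equiv]
  refine Prod.ext (Prod.ext ?_ ?_) (Prod.ext ?_ ?_)
  · simp only [localR, hl, cotChart_fst, schemeMap_fst_proj]
  · ext ε
    have := k1 (ε, 0)
    simp at this ⊢
    linarith
  · simp only [localR, hl, cotChart_fst, schemeMap_snd_proj]
  · ext ε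
    have := k1 (0, ε)
    simp at this ⊢
    linarith

theorem legendre_contMDiff (hH : ContMDiff (cModel E) 𝓘(ℝ, ℝ) ∞ H) :
    ContMDiff (𝓘(ℝ, ℝ).prod (cModel E)) (tModel E) ∞
      (fun y : ℝ × CQ E Q => legendre H y.1 y.2) := by
  intro y
  have hy : y.2.proj ∈ (chartAt E y.2.proj).source := mem_chart_source E _
  have hu := (cotChart E y.2.proj).map_source (mem_cotChart_source.2 hy)
  have h1 : ContDiffAt ℝ ∞ (fun w : ℝ × (E × (E →L[ℝ] ℝ)) => (w.2.1, (hamChart H y.2.proj w.1 w.2).1))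
      (y.1, cotChart E y.2.proj y.2) :=
    ContDiffAt.prodMk (by fun_prop) (contDiffAt_fst.comp _ (hamChart_contDiffAt hH hu))
  have h2 := h1.contMDiffAt.comp y (prodChart_contMDiffAt hy)
  have hl := tanChart_legendre (h := y.1) hH hy
  have h3 : (tanChart E y.2.proj (legendre H y.1 y.2)) ∈ (tanChart E y.2.proj).target :=
    (tanChart E y.2.proj).map_source (mem_tanChart_source.2 hy)
  rw [hl] at h3
  refine ((tanChart_symm_contMDiffAt h3).comp y h2).congr_of_eventuallyEq ?_
  filter_upwards [continuousAt_snd.eventually (cotChart_source_mem_nhds hy)] with w hw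
  have hw' := mem_cotChart_source.1 hw
  simp only [Function.comp_apply]
  rw [← tanChart_legendre hH hw',
    (tanChart E y.2.proj).left_inv ((mem_tanChart_source (v := legendre H w.1 w.2)).2 hw')]

/-- The points `(h, z)` at which the scheme is parametrized by `schemeMap`. -/
def schemeDomain (V : Set (TQ E Q)) (H : CQ E Q → ℝ) : Set (ℝ × CQ E Q) :=
  {y | legendre H y.1 y.2 ∈ V}

theorem isOpen_schemeDomain {V : Set (TQ E Q)} (hV : IsOpen V)
    (hH : ContMDiff (cModel E) 𝓘(ℝ, ℝ) ∞ H) : IsOpen (schemeDomain V H) :=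
  hV.preimage (legendre_contMDiff hH).continuous

/-- Near `y` the map is `localScheme` conjugated by charts that are frozen at `y` and at its image,
so smoothness reduces to that of the explicit formula. -/
theorem schemeMap_contMDiffAt {U V : Set (TQ E Q)} (hV : IsInvertibleOn R U V)
    (hH : ContMDiff (cModel E) 𝓘(ℝ, ℝ) ∞ H) {y : ℝ × CQ E Q} (hy : y ∈ schemeDomain V H) :
    ContMDiffAt (𝓘(ℝ, ℝ).prod (cModel E)) ((cModel E).prod (cModel E)) ∞
      (fun y : ℝ × CQ E Q => schemeMap R H y.1 y.2) y := by
  obtain ⟨b, hb⟩ : ∃ b, b = y.2.proj := ⟨_, rfl⟩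
  obtain ⟨c, hc⟩ : ∃ c, c = R (legendre H y.1 y.2) := ⟨_, rfl⟩
  have hyb : y.2.proj ∈ (chartAt E b).source := hb ▸ mem_chart_source E _
  have hc1 : (R (legendre H y.1 y.2)).1 ∈ (chartAt E c.1).source := hc ▸ mem_chart_source E _
  have hc2 : (R (legendre H y.1 y.2)).2 ∈ (chartAt E c.2).source := hc ▸ mem_chart_source E _
  have hu := (cotChart E b).map_source (mem_cotChart_source.2 hyb)
  have hRv := hV.localDiffeo _ hy
  have hRc : ContinuousAt (fun y : ℝ × CQ E Q => R (legendre H y.1 y.2)) y :=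
    hRv.contMDiffAt.continuousAt.comp (f := fun y : ℝ × CQ E Q => legendre H y.1 y.2)
      (legendre_contMDiff hH).continuous.continuousAt
  have ht := tanChart_legendre (h := y.1) hH hyb
  have k1 := localR_contDiffAt (b := b) (c := c) hRv.contMDiffAt hyb hc1 hc2
  have k2 := fderiv_localR_isInvertible (b := b) (c := c) hRv hyb hc1 hc2
  rw [ht] at k1 k2
  have k3 := localScheme_contDiffAt (y := (y.1, cotChart E b y.2)) hH hu k1 k2
  have k4 := k3.contMDiffAt.comp y (prodChart_contMDiffAt hyb)
  have k5 := cotChart_schemeMap hH hRv hyb hc1 hc2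
  have m1 : (localScheme R H b c (y.1, cotChart E b y.2)).1 ∈ (cotChart E c.1).target := by
    rw [← k5]; exact (cotChart E c.1).map_source (mem_cotChart_source.2 hc1)
  have m2 : (localScheme R H b c (y.1, cotChart E b y.2)).2 ∈ (cotChart E c.2).target := by
    rw [← k5]; exact (cotChart E c.2).map_source (mem_cotChart_source.2 hc2)
  have k6 := ((cotChart_symm_contMDiffAt m1).comp y
      (contDiffAt_fst.contMDiffAt.comp y k4)).prodMk
    ((cotChart_symm_contMDiffAt m2).comp y (contDiffAt_snd.contMDiffAt.comp y k4))
  refine k6.congr_of_eventuallyEq ?_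
  have n1 : ∀ᶠ w in 𝓝 y, (R (legendre H w.1 w.2)).1 ∈ (chartAt E c.1).source :=
    (continuousAt_fst.comp hRc).eventually_mem ((chartAt E c.1).open_source.mem_nhds hc1)
  have n2 : ∀ᶠ w in 𝓝 y, (R (legendre H w.1 w.2)).2 ∈ (chartAt E c.2).source :=
    (continuousAt_snd.comp hRc).eventually_mem ((chartAt E c.2).open_source.mem_nhds hc2)
  filter_upwards [continuousAt_snd.eventually (cotChart_source_mem_nhds hyb), n1, n2,
    (isOpen_schemeDomain hV.isOpen hH).mem_nhds hy] with w hw hw1 hw2 hwV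
  have k7 := cotChart_schemeMap hH (hV.localDiffeo _ hwV) (mem_cotChart_source.1 hw) hw1 hw2
  simp only [Function.comp_apply]
  rw [← k7]
  refine Prod.ext ?_ ?_
  · exact ((cotChart E c.1).left_inv (mem_cotChart_source.2 hw1)).symm
  · exact ((cotChart E c.2).left_inv (mem_cotChart_source.2 hw2)).symm

end SchemeSmooth

/-! ### A smooth left inverse of the parametrization -/

section Recover

/-- By duality: for a covector whose chart expression is `g`, the pairing identity with `δ = 0` and
`ϖ = 0` computes `g` of the fibre component. -/
theorem dTan_vertical {b : Q} {v : TQ E Q} (hv : v.proj ∈ (chartAt E b).source) (ε : E) :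
    dTan E b v (0, ε) = (0, dBase E b v.proj ε) := by
  refine Prod.ext ((dTan_fst hv _).trans (map_zero _)) ?_
  refine (SeparatingDual.eq_iff_forall_dual_eq (R := ℝ)).2 fun g => ?_
  obtain ⟨A, hA⟩ := dBase_isInvertible hv
  have h1 := pairing_deriv (z := ⟨v.proj, g ∘L dBase E b v.proj⟩) (v := v) rfl hv 0 0 ε
  have h2 : (cotChart E b (⟨v.proj, g ∘L dBase E b v.proj⟩ : CQ E Q)).2 = g := by
    refine ContinuousLinearMap.ext fun a => ?_
    have h3 := cotChart_snd (z := ⟨v.proj, g ∘L dBase E b v.proj⟩) hv (A.symm a)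
    have h4 : dBase E b v.proj (A.symm a) = a := by rw [← hA]; simp
    have h5 : covector (⟨v.proj, g ∘L dBase E b v.proj⟩ : CQ E Q) (A.symm a) =
      g (dBase E b v.proj (A.symm a)) := rfl
    rw [h5] at h3
    change _ = _ at h3
    rw [h4] at h3
    exact h3
  have h6 : covector (⟨v.proj, g ∘L dBase E b v.proj⟩ : CQ E Q) ε = g (dBase E b v.proj ε) := rfl
  have h7 : ((0 : E), (0 : E →L[ℝ] ℝ)) = 0 := rfl
  rw [h2, h6, h7] at h1
  simpa using h1

/-- The base point `z` of `(R_d^{T*})⁻¹(y)`, if `v ∈ TQ` is its projection to `TQ`. -/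
def recoverAt (R : TQ E Q → Q × Q) (v : TQ E Q) (y : CQ E Q × CQ E Q) : CQ E Q :=
  -- This is `covector_schemeMap` on vertical vectors `(0, ε)`, where the term with `ṗ` disappears
  -- and only `p ε` remains.
  ⟨v.proj, (covector y.2 ∘L ContinuousLinearMap.snd ℝ E E -
    covector y.1 ∘L ContinuousLinearMap.fst ℝ E E) ∘L dR R v ∘L ContinuousLinearMap.inr ℝ E E⟩

open Classical in
/-- The base point of `(R_d^{T*})⁻¹(y)`, where `R_d` is restricted to `V`. -/
def recover (R : TQ E Q → Q × Q) (V : Set (TQ E Q)) (y : CQ E Q × CQ E Q) : CQ E Q :=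
  if h : ∃ v, v ∈ V ∧ R v = (y.1.proj, y.2.proj) then recoverAt R h.choose y else y.1

/-- The set of points at which the inverse of the cotangent lift of `R_d|_V` is defined. -/
def recoverDomain (R : TQ E Q → Q × Q) (V : Set (TQ E Q)) : Set (CQ E Q × CQ E Q) :=
  {y | (y.1.proj, y.2.proj) ∈ R '' V}

variable {R : TQ E Q → Q × Q} {U V : Set (TQ E Q)} {y : CQ E Q × CQ E Q} {v : TQ E Q}

theorem recover_eq (hV : IsInvertibleOn R U V) (hv : v ∈ V) (hy : R v = (y.1.proj, y.2.proj)) :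
    recover R V y = recoverAt R v y := by
  have h : ∃ v, v ∈ V ∧ R v = (y.1.proj, y.2.proj) := ⟨v, hv, hy⟩
  rw [recover, dif_pos h, hV.injOn h.choose_spec.1 hv (h.choose_spec.2.trans hy.symm)]

theorem contMDiff_projs : ContMDiff ((cModel E).prod (cModel E)) (𝓘(ℝ, E).prod 𝓘(ℝ, E)) ∞
    (fun y : CQ E Q × CQ E Q => (y.1.proj, y.2.proj)) :=
  ((Bundle.contMDiff_proj _).comp contMDiff_fst).prodMk
    ((Bundle.contMDiff_proj _).comp contMDiff_snd)

/-- At each point of `R '' V` a continuous local inverse of `R` sends nearby points back into the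
open set `V`. -/
theorem isOpen_recoverDomain (hV : IsInvertibleOn R U V) : IsOpen (recoverDomain R V) := by
  have h1 : IsOpen (R '' V) := by
    rw [isOpen_iff_mem_nhds]
    rintro _ ⟨v, hv, rfl⟩
    have hσ := (hV.localDiffeo v hv).localInverse_contMDiffAt.continuousAt
    have hσv := (hV.localDiffeo v hv).localInverse_left_inv
      (hV.localDiffeo v hv).localInverse_mem_target
    have hσ2 := hσ.eventually_mem (by rw [hσv]; exact hV.isOpen.mem_nhds hv)
    filter_upwards [hσ2, (hV.localDiffeo v hv).localInverse_eventuallyEq_right] with x hx hx2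
    exact ⟨_, hx, hx2⟩
  exact h1.preimage contMDiff_projs.continuous

theorem cotChart_recoverAt_snd {b : Q} {c : Q × Q}
    (hR : ContMDiffAt (tModel E) (𝓘(ℝ, E).prod 𝓘(ℝ, E)) ∞ R v)
    (hy : R v = (y.1.proj, y.2.proj))
    (hv : v.proj ∈ (chartAt E b).source) (h1 : (R v).1 ∈ (chartAt E c.1).source)
    (h2 : (R v).2 ∈ (chartAt E c.2).source) :
    (cotChart E b (recoverAt R v y)).2 =
      ((cotChart E c.2 y.2).2 ∘L ContinuousLinearMap.snd ℝ E E -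
        (cotChart E c.1 y.1).2 ∘L ContinuousLinearMap.fst ℝ E E) ∘L
      fderiv ℝ (localR R b c) (tanChart E b v) ∘L ContinuousLinearMap.inr ℝ E E := by
  refine ContinuousLinearMap.ext fun ε => ?_
  obtain ⟨A, hA⟩ := dBase_isInvertible hv
  have k1 : dBase E b v.proj (A.symm ε) = ε := by rw [← hA]; simp
  have k2 := fderiv_localR hR hv h1 h2 (0, A.symm ε)
  rw [dTan_vertical hv, k1] at k2
  have k3 := cotChart_snd (z := recoverAt R v y) hv (A.symm ε)
  change (cotChart E b (recoverAt R v y)).2 (dBase E b v.proj (A.symm ε)) = _ at k3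
  rw [k1] at k3
  rw [k3]
  have e1 : (R v).1 = y.1.proj := congrArg Prod.fst hy
  have e2 : (R v).2 = y.2.proj := congrArg Prod.snd hy
  have e3 : covector (recoverAt R v y) (A.symm ε) =
    covector y.2 (dR R v (0, A.symm ε)).2 - covector y.1 (dR R v (0, A.symm ε)).1 := rfl
  rw [e3]
  simp only [ContinuousLinearMap.comp_apply, ContinuousLinearMap.inr_apply, sub_apply,
    ContinuousLinearMap.coe_fst', ContinuousLinearMap.coe_snd', k2]
  rw [e1, e2, cotChart_snd (e2 ▸ h2), cotChart_snd (e1 ▸ h1)]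

/-- The vector chosen in `recover` agrees near `y` with a smooth local inverse `σ` of `R` applied to
the two base points. In fixed charts the recovered covector is then a composition of smooth maps. -/
theorem recover_contMDiffAt (hV : IsInvertibleOn R U V) (hy : y ∈ recoverDomain R V) :
    ContMDiffAt ((cModel E).prod (cModel E)) (cModel E) ∞ (recover R V) y := by
  obtain ⟨v, hv, hRv⟩ := hy
  have hld := hV.localDiffeo v hv
  obtain ⟨σ, hσ⟩ : ∃ σ : Q × Q → TQ E Q, σ = hld.localInverse := ⟨_, rfl⟩
  have hσs : ContMDiffAt (𝓘(ℝ, E).prod 𝓘(ℝ, E)) (tModel E) ∞ σ (y.1.proj, y.2.proj) := by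
    rw [← hRv, hσ]; exact hld.localInverse_contMDiffAt
  have hσv : σ (y.1.proj, y.2.proj) = v := by
    rw [← hRv, hσ]; exact hld.localInverse_left_inv hld.localInverse_mem_target
  have hσR : ∀ᶠ x in 𝓝 (y.1.proj, y.2.proj), R (σ x) = x := by
    rw [← hRv, hσ]; exact hld.localInverse_eventuallyEq_right
  have hπ : ContinuousAt (fun y : CQ E Q × CQ E Q => (y.1.proj, y.2.proj)) y :=
    contMDiff_projs.continuous.continuousAt
  have hτ := hσs.comp y contMDiff_projs.contMDiffAt
  obtain ⟨b, hb⟩ : ∃ b, b = v.proj := ⟨_, rfl⟩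
  obtain ⟨c, hc⟩ : ∃ c, c = (y.1.proj, y.2.proj) := ⟨_, rfl⟩
  have hvb : v.proj ∈ (chartAt E b).source := hb ▸ mem_chart_source E _
  have hc1 : y.1.proj ∈ (chartAt E c.1).source := hc ▸ mem_chart_source E _
  have hc2 : y.2.proj ∈ (chartAt E c.2).source := hc ▸ mem_chart_source E _
  have hrs : ContDiffAt ℝ ∞ (localR R b c) (tanChart E b v) :=
    localR_contDiffAt hld.contMDiffAt hvb (hRv ▸ hc1) (hRv ▸ hc2)
  have hD : ContDiffAt ℝ ∞ (fderiv ℝ (localR R b c)) (tanChart E b v) :=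
    hrs.fderiv_right (m := ∞) (by simp)
  have ht : ContMDiffAt ((cModel E).prod (cModel E)) 𝓘(ℝ, E × E) ∞
      (fun w : CQ E Q × CQ E Q => tanChart E b (σ (w.1.proj, w.2.proj))) y := by
    rw [← hσv] at hvb
    exact (tanChart_contMDiffAt hvb).comp y hτ
  have htv : tanChart E b (σ (y.1.proj, y.2.proj)) = tanChart E b v := by rw [hσv]
  have hDt : ContMDiffAt ((cModel E).prod (cModel E)) 𝓘(ℝ, E × E →L[ℝ] E × E) ∞
      (fun w : CQ E Q × CQ E Q =>
        fderiv ℝ (localR R b c) (tanChart E b (σ (w.1.proj, w.2.proj)))) y := by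
    rw [← htv] at hD
    exact hD.contMDiffAt.comp y ht
  have hq1 : ContMDiffAt ((cModel E).prod (cModel E)) 𝓘(ℝ, E →L[ℝ] ℝ) ∞
      (fun w : CQ E Q × CQ E Q => (cotChart E c.1 w.1).2) y :=
    contDiffAt_snd.contMDiffAt.comp y ((cotChart_contMDiffAt hc1).comp y contMDiffAt_fst)
  have hq2 : ContMDiffAt ((cModel E).prod (cModel E)) 𝓘(ℝ, E →L[ℝ] ℝ) ∞
      (fun w : CQ E Q × CQ E Q => (cotChart E c.2 w.2).2) y :=
    contDiffAt_snd.contMDiffAt.comp y ((cotChart_contMDiffAt hc2).comp y contMDiffAt_snd)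
  have hG : ContMDiffAt ((cModel E).prod (cModel E)) 𝓘(ℝ, E × (E →L[ℝ] ℝ)) ∞
      (fun w : CQ E Q × CQ E Q => ((tanChart E b (σ (w.1.proj, w.2.proj))).1,
        ((cotChart E c.2 w.2).2 ∘L ContinuousLinearMap.snd ℝ E E -
          (cotChart E c.1 w.1).2 ∘L ContinuousLinearMap.fst ℝ E E) ∘L
        fderiv ℝ (localR R b c) (tanChart E b (σ (w.1.proj, w.2.proj))) ∘L
          ContinuousLinearMap.inr ℝ E E)) y :=
    (contDiffAt_fst.contMDiffAt.comp y ht).prodMk_space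
      (((hq2.clm_comp contMDiffAt_const).sub (hq1.clm_comp contMDiffAt_const)).clm_comp
        (hDt.clm_comp contMDiffAt_const))
  have key : ∀ᶠ w in 𝓝 y, recover R V w = recoverAt R (σ (w.1.proj, w.2.proj)) w ∧
      (recoverAt R (σ (w.1.proj, w.2.proj)) w).proj ∈ (chartAt E b).source ∧
      cotChart E b (recoverAt R (σ (w.1.proj, w.2.proj)) w) =
        ((tanChart E b (σ (w.1.proj, w.2.proj))).1,
        ((cotChart E c.2 w.2).2 ∘L ContinuousLinearMap.snd ℝ E E -
          (cotChart E c.1 w.1).2 ∘L ContinuousLinearMap.fst ℝ E E) ∘L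
        fderiv ℝ (localR R b c) (tanChart E b (σ (w.1.proj, w.2.proj))) ∘L
          ContinuousLinearMap.inr ℝ E E) := by
    have n0 := hτ.continuousAt.eventually_mem
      (show V ∈ 𝓝 _ by simp only [Function.comp_apply, hσv]; exact hV.isOpen.mem_nhds hv)
    have n1 := hτ.continuousAt.eventually_mem
      (show (tanChart E b).source ∈ 𝓝 _ by
        simp only [Function.comp_apply, hσv]; exact tanChart_source_mem_nhds hvb)
    have n2 := hπ.eventually hσR
    have n3 := hπ.fst.eventually_mem ((chartAt E c.1).open_source.mem_nhds hc1)
    have n4 := hπ.snd.eventually_mem ((chartAt E c.2).open_source.mem_nhds hc2)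
    filter_upwards [n0, n1, n2, n3, n4] with w w0 w1 w2 w3 w4
    have w1' := mem_tanChart_source.1 w1
    refine ⟨recover_eq hV w0 w2, w1', Prod.ext ?_ ?_⟩
    · rw [cotChart_fst, tanChart_fst]; rfl
    · exact cotChart_recoverAt_snd (hV.localDiffeo _ w0).contMDiffAt w2 w1'
        (by rw [w2]; exact w3) (by rw [w2]; exact w4)
  obtain ⟨-, k2, k3⟩ := key.self_of_nhds
  have k4 := (cotChart E b).map_source (mem_cotChart_source.2 k2)
  rw [k3] at k4
  refine ((cotChart_symm_contMDiffAt k4).comp y hG).congr_of_eventuallyEq ?_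
  filter_upwards [key] with w ⟨w1, w2, w3⟩
  simp only [Function.comp_apply]
  rw [← w3, w1, (cotChart E b).left_inv (mem_cotChart_source.2 w2)]

variable [FiniteDimensional ℝ E] {H : CQ E Q → ℝ} {h : ℝ} {z : CQ E Q}

theorem schemeMap_mem_recoverDomain (hz : legendre H h z ∈ V) :
    schemeMap R H h z ∈ recoverDomain R V := ⟨_, hz, rfl⟩

theorem recover_schemeMap (hV : IsInvertibleOn R U V) (hz : legendre H h z ∈ V) :
    recover R V (schemeMap R H h z) = z := by
  rw [recover_eq hV hz rfl]
  have k4 : (dR R (legendre H h z)).IsInvertible :=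
    ⟨(hV.localDiffeo _ hz).mfderivToContinuousLinearEquiv (by simp), rfl⟩
  have k5 : ((covector (schemeMap R H h z).2 ∘L ContinuousLinearMap.snd ℝ E E -
      covector (schemeMap R H h z).1 ∘L ContinuousLinearMap.fst ℝ E E) ∘L
      dR R (legendre H h z) ∘L ContinuousLinearMap.inr ℝ E E) = covector z := by
    refine ContinuousLinearMap.ext fun ε => ?_
    have := covector_schemeMap k4 (0, ε)
    simpa using this
  exact congrArg (fun p : E →L[ℝ] ℝ => (⟨z.proj, p⟩ : CQ E Q)) k5

end Recover

/-! ### Isotropy from a generating function -/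

theorem minSmoothness_two_le : minSmoothness ℝ 2 ≤ (∞ : WithTop ℕ∞) := by
  rw [minSmoothness_of_isRCLikeNormedField]
  exact (WithTop.coe_le_coe.2 le_top : ((2 : ℕ∞) : WithTop ℕ∞) ≤ ((⊤ : ℕ∞) : WithTop ℕ∞))

theorem hasFDerivAt_fderiv {W G : Type*} [NormedAddCommGroup W] [NormedSpace ℝ W]
    [NormedAddCommGroup G] [NormedSpace ℝ G] {f : W → G} {u : W} (hf : ContDiffAt ℝ ∞ f u) :
    HasFDerivAt (fderiv ℝ f) (fderiv ℝ (fderiv ℝ f) u) u :=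
  ((hf.fderiv_right (m := ∞) (by simp)).differentiableAt (by simp)).hasFDerivAt

/-- If `p₁ dx₁ - p₀ dx₀` is exact, then `dx₁ ∧ dp₁ = dx₀ ∧ dp₀`. -/
theorem wedge_eq_of_exact {W : Type*} [NormedAddCommGroup W] [NormedSpace ℝ W]
    {x₀ x₁ : W → E} {p₀ p₁ : W → E →L[ℝ] ℝ} {L : W → ℝ} {u : W}
    (hx₀ : ContDiffAt ℝ ∞ x₀ u) (hx₁ : ContDiffAt ℝ ∞ x₁ u) (hp₀ : ContDiffAt ℝ ∞ p₀ u)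
    (hp₁ : ContDiffAt ℝ ∞ p₁ u) (hL : ContDiffAt ℝ ∞ L u)
    (h : ∀ᶠ w in 𝓝 u, ∀ ξ, p₁ w (fderiv ℝ x₁ w ξ) - p₀ w (fderiv ℝ x₀ w ξ) = fderiv ℝ L w ξ)
    (ξ η : W) :
    fderiv ℝ p₁ u η (fderiv ℝ x₁ u ξ) - fderiv ℝ p₁ u ξ (fderiv ℝ x₁ u η) =
      fderiv ℝ p₀ u η (fderiv ℝ x₀ u ξ) - fderiv ℝ p₀ u ξ (fderiv ℝ x₀ u η) := by
  have hd1 {G : Type _} [NormedAddCommGroup G] [NormedSpace ℝ G] {f : W → G}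
      (hf : ContDiffAt ℝ ∞ f u) : HasFDerivAt f (fderiv ℝ f u) u :=
    (hf.differentiableAt (by simp)).hasFDerivAt
  -- This differentiates the relation, evaluated on the constant vector `a`, in direction `c`.
  -- Exchanging `a` and `c` and subtracting cancels every second derivative by symmetry.
  have key (a c : W) : fderiv ℝ p₁ u c (fderiv ℝ x₁ u a) +
        p₁ u (fderiv ℝ (fderiv ℝ x₁) u c a) -
      (fderiv ℝ p₀ u c (fderiv ℝ x₀ u a) + p₀ u (fderiv ℝ (fderiv ℝ x₀) u c a)) =
      fderiv ℝ (fderiv ℝ L) u c a := by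
    have e1 := (hd1 hp₁).clm_apply ((hasFDerivAt_fderiv hx₁).clm_apply (hasFDerivAt_const a u))
    have e0 := (hd1 hp₀).clm_apply ((hasFDerivAt_fderiv hx₀).clm_apply (hasFDerivAt_const a u))
    have eL := (hasFDerivAt_fderiv hL).clm_apply (hasFDerivAt_const a u)
    have e := eL.congr_of_eventuallyEq (h.mono fun w hw => hw a)
    have := DFunLike.congr_fun ((e1.sub e0).unique e) c
    simp at this
    linarith
  have s0 := (hx₀.isSymmSndFDerivAt minSmoothness_two_le) ξ η
  have s1 := (hx₁.isSymmSndFDerivAt minSmoothness_two_le) ξ η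
  have sL := (hL.isSymmSndFDerivAt minSmoothness_two_le) ξ η
  have k1 := key ξ η
  have k2 := key η ξ
  rw [s0, s1, sL] at k2
  linarith

section Isotropic
variable [FiniteDimensional ℝ E]
  {R : TQ E Q → Q × Q} {H : CQ E Q → ℝ} {h : ℝ} {z : CQ E Q} {b : Q} {c : Q × Q}
  {U V : Set (TQ E Q)}

/-- The exactness relation has to be differentiated, so regularity is needed on a neighbourhood. It
persists there because `V` and the chart domains are open and `legendre` and `R` are continuous at
the points concerned. -/
theorem localScheme_regular (hV : IsInvertibleOn R U V) (hH : ContMDiff (cModel E) 𝓘(ℝ, ℝ) ∞ H)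
    (hzV : legendre H h z ∈ V) (hz : z.proj ∈ (chartAt E b).source)
    (h1 : (R (legendre H h z)).1 ∈ (chartAt E c.1).source)
    (h2 : (R (legendre H h z)).2 ∈ (chartAt E c.2).source) :
    ∀ᶠ y in 𝓝 (h, cotChart E b z), y.2 ∈ (cotChart E b).target ∧
      ContDiffAt ℝ ∞ (localR R b c) (y.2.1, (hamChart H b y.1 y.2).1) ∧
      (fderiv ℝ (localR R b c) (y.2.1, (hamChart H b y.1 y.2).1)).IsInvertible := by
  have hs := mem_cotChart_source.2 hz
  have hl : (cotChart E b).symm (cotChart E b z) = z := (cotChart E b).left_inv hs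
  have ht : (cotChart E b).target ∈ 𝓝 (cotChart E b z) :=
    (isOpen_extChartAt_target (I := cModel E) (⟨b, 0⟩ : CQ E Q)).mem_nhds
      ((cotChart E b).map_source hs)
  let g : ℝ × (E × (E →L[ℝ] ℝ)) → ℝ × CQ E Q := fun y => (y.1, (cotChart E b).symm y.2)
  have hg0 : g (h, cotChart E b z) = (h, z) := Prod.ext rfl hl
  have hg : ContinuousAt g (h, cotChart E b z) :=
    continuousAt_fst.prodMk ((cotChart_symm_contMDiffAt
      ((cotChart E b).map_source hs)).continuousAt.comp (f := Prod.snd) continuousAt_snd)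
  have hgl : ContinuousAt (fun y => legendre H (g y).1 (g y).2) (h, cotChart E b z) :=
    (legendre_contMDiff hH).continuous.continuousAt.comp hg
  have hgR : ContinuousAt (fun y => R (legendre H (g y).1 (g y).2)) (h, cotChart E b z) := by
    refine ContinuousAt.comp (g := R) ?_ hgl
    rw [hg0]; exact (hV.localDiffeo _ hzV).contMDiffAt.continuousAt
  have n1 := hgl.eventually_mem (show V ∈ _ by rw [hg0]; exact hV.isOpen.mem_nhds hzV)
  have n2 := hgR.fst.eventually_mem
    (show (chartAt E c.1).source ∈ _ by rw [hg0]; exact (chartAt E c.1).open_source.mem_nhds h1)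
  have n3 := hgR.snd.eventually_mem
    (show (chartAt E c.2).source ∈ _ by rw [hg0]; exact (chartAt E c.2).open_source.mem_nhds h2)
  filter_upwards [n1, n2, n3, continuousAt_snd.eventually_mem ht] with y y1 y2 y3 y4
  have hyl : cotChart E b (g y).2 = y.2 := (cotChart E b).right_inv y4
  have y5 : (g y).2.proj ∈ (chartAt E b).source :=
    mem_cotChart_source.1 ((cotChart E b).map_target y4)
  have hld := hV.localDiffeo _ y1
  have k0 := tanChart_legendre (h := (g y).1) hH y5
  have k1 := localR_contDiffAt hld.contMDiffAt y5 y2 y3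
  have k2 := fderiv_localR_isInvertible hld y5 y2 y3
  rw [k0, hyl] at k1 k2
  exact ⟨y4, k1, k2⟩

theorem localScheme_isotropic (hH : ContMDiff (cModel E) 𝓘(ℝ, ℝ) ∞ H)
    {u : E × (E →L[ℝ] ℝ)}
    (hu : ∀ᶠ w in 𝓝 u, w ∈ (cotChart E b).target ∧
      ContDiffAt ℝ ∞ (localR R b c) (w.1, (hamChart H b h w).1) ∧
      (fderiv ℝ (localR R b c) (w.1, (hamChart H b h w).1)).IsInvertible)
    {D : E × (E →L[ℝ] ℝ) →L[ℝ] (E × (E →L[ℝ] ℝ)) × (E × (E →L[ℝ] ℝ))}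
    (hD : HasFDerivAt (fun w => localScheme R H b c (h, w)) D u) (ξ η : E × (E →L[ℝ] ℝ)) :
    (D η).2.2 (D ξ).2.1 - (D ξ).2.2 (D η).2.1 = (D η).1.2 (D ξ).1.1 - (D ξ).1.2 (D η).1.1 := by
  let f : E × (E →L[ℝ] ℝ) → (E × (E →L[ℝ] ℝ)) × (E × (E →L[ℝ] ℝ)) :=
    fun w => localScheme R H b c (h, w)
  have hf : ContDiffAt ℝ ∞ f u :=
    (localScheme_contDiffAt hH (y := (h, u)) hu.self_of_nhds.1 hu.self_of_nhds.2.1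
      hu.self_of_nhds.2.2).comp u (contDiffAt_const.prodMk contDiffAt_id)
  have hX : ∀ w ∈ (cotChart E b).target, ContDiffAt ℝ ∞ (fun w => hamChart H b h w) w :=
    fun w hw => (hamChart_contDiffAt (y := (h, w)) hH hw).comp w
      (contDiffAt_const.prodMk contDiffAt_id)
  -- The generating function `p X_q - hH`. Since `h dH = X_q dp - X_p dq`, its differential is `X_p
  -- dq + p dX_q`.
  let L : E × (E →L[ℝ] ℝ) → ℝ := fun w =>
    w.2 (hamChart H b h w).1 - h * (H ∘ (cotChart E b).symm) w
  have hL : ContDiffAt ℝ ∞ L u := by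
    have hut := hu.self_of_nhds.1
    exact (contDiffAt_snd.clm_apply (contDiffAt_fst.comp u (hX u hut))).sub
      (contDiffAt_const.mul (contDiffAt_comp_cotChart_symm hH hut))
  have hrel : ∀ᶠ w in 𝓝 u, ∀ ζ, (f w).2.2 (fderiv ℝ (fun w => (f w).2.1) w ζ) -
      (f w).1.2 (fderiv ℝ (fun w => (f w).1.1) w ζ) = fderiv ℝ L w ζ := by
    filter_upwards [hu] with w ⟨hw, hr, hi⟩ ζ
    have dX := ((hX w hw).differentiableAt (by simp)).hasFDerivAt
    have dH := ((contDiffAt_comp_cotChart_symm hH hw).differentiableAt (by simp)).hasFDerivAt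
    have dr := (hr.differentiableAt (by simp)).hasFDerivAt
    have dt := (hasFDerivAt_fst (𝕜 := ℝ) (p := w)).prodMk (dX.fst)
    have dx := HasFDerivAt.comp (g := localR R b c) w dr dt
    have dL := ((hasFDerivAt_snd (𝕜 := ℝ) (p := w)).clm_apply dX.fst).sub (dH.const_mul h)
    have e1 : fderiv ℝ (fun w => (f w).2.1) w = _ := dx.snd.fderiv
    have e0 : fderiv ℝ (fun w => (f w).1.1) w = _ := dx.fst.fderiv
    have eL : fderiv ℝ L w = _ := dL.fderiv
    rw [e1, e0, eL]
    obtain ⟨A, hA⟩ := hi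
    have hs := hamChart_spec H b h w ζ
    let β : E × E →L[ℝ] ℝ := ((hamChart H b h w).2 ∘L ContinuousLinearMap.fst ℝ E E +
      w.2 ∘L ContinuousLinearMap.snd ℝ E E) ∘L
      (fderiv ℝ (localR R b c) (w.1, (hamChart H b h w).1)).inverse
    have e2 : (f w).2.2 = β ∘L ContinuousLinearMap.inr ℝ E E := rfl
    have e3 : (f w).1.2 = -(β ∘L ContinuousLinearMap.inl ℝ E E) := rfl
    have e4 (ε : E × E) : (f w).2.2 (A ε).2 - (f w).1.2 (A ε).1 =
        (hamChart H b h w).2 ε.1 + w.2 ε.2 := by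
      have e5 : β (A ε) = (hamChart H b h w).2 ε.1 + w.2 ε.2 := by
        simp only [β, ← hA, ContinuousLinearMap.inverse_equiv]
        simp
      have e6 : A ε = ((A ε).1, 0) + (0, (A ε).2) := by simp
      rw [← e5, e2, e3]
      conv_rhs => rw [e6, map_add]
      simp
      ring
    have e7 := e4 (ζ.1, (fderiv ℝ (fun w => hamChart H b h w) w ζ).1)
    simp [← hA] at e7 ⊢
    rw [e7]
    linarith
  have h3 := wedge_eq_of_exact hf.fst.fst hf.snd.fst hf.fst.snd hf.snd.snd hL hrel ξ η
  have g1 : fderiv ℝ (fun w => (f w).1.1) u = _ := hD.fst.fst.fderiv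
  have g2 : fderiv ℝ (fun w => (f w).2.1) u = _ := hD.snd.fst.fderiv
  have g3 : fderiv ℝ (fun w => (f w).1.2) u = _ := hD.fst.snd.fderiv
  have g4 : fderiv ℝ (fun w => (f w).2.2) u = _ := hD.snd.snd.fderiv
  rw [g1, g2, g3, g4] at h3
  exact h3

end Isotropic

/-! ### The form on the product, in coordinates -/

section Form

/-- The form `Ω₁₂` on the model space. -/
def form12 : LinearMap.BilinForm ℝ ((E × (E →L[ℝ] ℝ)) × (E × (E →L[ℝ] ℝ))) :=
  LinearMap.mk₂ ℝ (fun ξ η => (η.2.2 ξ.2.1 - ξ.2.2 η.2.1) - (η.1.2 ξ.1.1 - ξ.1.2 η.1.1))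
    (by intros; simp; ring) (by intros; simp; ring) (by intros; simp; ring) (by intros; simp; ring)

theorem form12_isRefl : LinearMap.IsRefl (form12 (E := E)) := fun ξ η hξ => by
  have h : form12 η ξ = - form12 ξ η := by simp [form12]; ring
  rw [h, hξ, neg_zero]

theorem omega12_eq (y : CQ E Q × CQ E Q) (ξ η : (E × (E →L[ℝ] ℝ)) × (E × (E →L[ℝ] ℝ))) :
    omega12 y ξ η = form12 ξ η := by
  have h1 := omega_apply y.1 ξ.1 η.1
  have h2 := omega_apply y.2 ξ.2 η.2
  exact congrArg₂ (· - ·) h2 h1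

theorem form12_nondegenerate : (form12 (E := E)).Nondegenerate := by
  refine (LinearMap.IsRefl.nondegenerate_iff_separatingLeft form12_isRefl).2 fun ξ hξ => ?_
  have h1 (g : E →L[ℝ] ℝ) := hξ (0, (0, g))
  have h2 (e : E) := hξ (0, (e, 0))
  have h3 (g : E →L[ℝ] ℝ) := hξ ((0, g), 0)
  have h4 (e : E) := hξ ((e, 0), 0)
  simp [form12] at h1 h2 h3 h4
  refine Prod.ext (Prod.ext ?_ (ContinuousLinearMap.ext h4))
    (Prod.ext ?_ (ContinuousLinearMap.ext h2))
  · exact SeparatingDual.eq_zero_of_forall_dual_eq_zero (R := ℝ) h3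
  · exact SeparatingDual.eq_zero_of_forall_dual_eq_zero (R := ℝ) h1

end Form

/-! ### The Lagrangian submanifold and maps with graph inside it -/

section Lagrangian
variable [FiniteDimensional ℝ E]
  {R : TQ E Q → Q × Q} {H : CQ E Q → ℝ} {h : ℝ} {z : CQ E Q} {b : Q} {c : Q × Q}
  {U V : Set (TQ E Q)}

theorem exists_continuousLinearEquiv {F G : Type*} [NormedAddCommGroup F] [NormedSpace ℝ F]
    [NormedAddCommGroup G] [NormedSpace ℝ G] [FiniteDimensional ℝ F] [FiniteDimensional ℝ G]
    (hFG : Module.finrank ℝ F = Module.finrank ℝ G) (T : F →L[ℝ] G) (hT : ∀ x, T x = 0 → x = 0) :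
    ∃ e : F ≃L[ℝ] G, (e : F →L[ℝ] G) = T := by
  have h1 : Function.Injective (T : F →ₗ[ℝ] G) := (injective_iff_map_eq_zero _).2 hT
  exact ⟨(LinearEquiv.ofInjectiveOfFinrankEq _ h1 hFG).toContinuousLinearEquiv, rfl⟩

theorem schemeMap_contMDiffAt_right (hV : IsInvertibleOn R U V)
    (hH : ContMDiff (cModel E) 𝓘(ℝ, ℝ) ∞ H) (hz : legendre H h z ∈ V) :
    ContMDiffAt (cModel E) ((cModel E).prod (cModel E)) ∞ (schemeMap R H h) z :=
  (schemeMap_contMDiffAt (y := (h, z)) hV hH hz).comp z (contMDiffAt_const.prodMk contMDiffAt_id)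

/-- The differential of `z ↦ R_d^{T*}(X_{hH}(z))`, on the model spaces. -/
def dScheme (R : TQ E Q → Q × Q) (H : CQ E Q → ℝ) (h : ℝ) (z : CQ E Q) :
    E × (E →L[ℝ] ℝ) →L[ℝ] (E × (E →L[ℝ] ℝ)) × (E × (E →L[ℝ] ℝ)) :=
  mfderiv (cModel E) ((cModel E).prod (cModel E)) (schemeMap R H h) z

theorem hasMFDerivAt_schemeMap (hV : IsInvertibleOn R U V)
    (hH : ContMDiff (cModel E) 𝓘(ℝ, ℝ) ∞ H) (hz : legendre H h z ∈ V) :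
    HasMFDerivAt (cModel E) ((cModel E).prod (cModel E)) (schemeMap R H h) z (dScheme R H h z) :=
  ((schemeMap_contMDiffAt_right hV hH hz).mdifferentiableAt (by simp)).hasMFDerivAt

/-- By definition `mfderiv` is the derivative of the expression in the preferred charts at `z` and
at its image. That expression is `localScheme` with `b` and `c` the corresponding base points. -/
theorem hasFDerivAt_localScheme (hV : IsInvertibleOn R U V)
    (hH : ContMDiff (cModel E) 𝓘(ℝ, ℝ) ∞ H) (hz : legendre H h z ∈ V) :
    HasFDerivAt (fun w => localScheme R H z.proj
      ((schemeMap R H h z).1.proj, (schemeMap R H h z).2.proj) (h, w)) (dScheme R H h z)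
      (cotChart E z.proj z) := by
  have h1 : HasFDerivWithinAt (writtenInExtChartAt (cModel E) ((cModel E).prod (cModel E)) z
      (schemeMap R H h)) (dScheme R H h z) (Set.range (cModel E)) (extChartAt (cModel E) z z) :=
    (hasMFDerivAt_schemeMap hV hH hz).2
  rw [ModelWithCorners.range_eq_univ, hasFDerivWithinAt_univ, extChartAt_cot] at h1
  refine h1.congr_of_eventuallyEq ?_
  have hzs : z.proj ∈ (chartAt E z.proj).source := mem_chart_source E _
  have hu := (cotChart E z.proj).map_source (mem_cotChart_source.2 hzs)
  have hl : (cotChart E z.proj).symm (cotChart E z.proj z) = z :=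
    (cotChart E z.proj).left_inv (mem_cotChart_source.2 hzs)
  have hg : Filter.Tendsto (cotChart E z.proj).symm (𝓝 (cotChart E z.proj z)) (𝓝 z) := by
    have := (cotChart_symm_contMDiffAt hu).continuousAt
    rwa [ContinuousAt, hl] at this
  have hS := (schemeMap_contMDiffAt_right hV hH hz).continuousAt
  have hleg : ContinuousAt (legendre H h) z :=
    ((legendre_contMDiff hH).continuous.comp (Continuous.prodMk_right h)).continuousAt
  have n1 := hg.eventually (hleg.eventually_mem (hV.isOpen.mem_nhds hz))
  have n2 := hg.eventually (hS.fst.eventually_mem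
    (cotChart_source_mem_nhds (b := (schemeMap R H h z).1.proj) (mem_chart_source E _)))
  have n3 := hg.eventually (hS.snd.eventually_mem
    (cotChart_source_mem_nhds (b := (schemeMap R H h z).2.proj) (mem_chart_source E _)))
  have n4 : ∀ᶠ w in 𝓝 (cotChart E z.proj z), w ∈ (cotChart E z.proj).target :=
    (isOpen_extChartAt_target (I := cModel E) (⟨z.proj, 0⟩ : CQ E Q)).mem_nhds hu
  filter_upwards [n1, n2, n3, n4] with w w1 w2 w3 w4
  have w5 := mem_cotChart_source.1 ((cotChart E z.proj).map_target w4)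
  have k := cotChart_schemeMap hH (hV.localDiffeo _ w1) w5
    (c := ((schemeMap R H h z).1.proj, (schemeMap R H h z).2.proj))
    (mem_cotChart_source.1 w2) (mem_cotChart_source.1 w3)
  rw [(cotChart E z.proj).right_inv w4] at k
  rw [← k, ← extChartAt_cot, ← extChartAt_cot]
  simp only [writtenInExtChartAt, Function.comp_apply, extChartAt_prod]
  rw [extChartAt_cot z]
  rfl

theorem dScheme_isotropic (hV : IsInvertibleOn R U V)
    (hH : ContMDiff (cModel E) 𝓘(ℝ, ℝ) ∞ H) (hz : legendre H h z ∈ V) (ξ η : E × (E →L[ℝ] ℝ)) :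
    (dScheme R H h z η).2.2 (dScheme R H h z ξ).2.1 -
      (dScheme R H h z ξ).2.2 (dScheme R H h z η).2.1 =
    (dScheme R H h z η).1.2 (dScheme R H h z ξ).1.1 -
      (dScheme R H h z ξ).1.2 (dScheme R H h z η).1.1 := by
  refine localScheme_isotropic hH ?_ (hasFDerivAt_localScheme hV hH hz) ξ η
  have h1 := localScheme_regular (c := ((schemeMap R H h z).1.proj, (schemeMap R H h z).2.proj))
    hV hH hz (mem_chart_source E _) (mem_chart_source E _) (mem_chart_source E _)
  exact (Continuous.prodMk_right h).continuousAt.eventually h1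

/-- The differential of `recover` is a left inverse. -/
theorem dScheme_injective (hV : IsInvertibleOn R U V)
    (hH : ContMDiff (cModel E) 𝓘(ℝ, ℝ) ∞ H) (hz : legendre H h z ∈ V) :
    Function.Injective (dScheme R H h z) := by
  have h1 := ((recover_contMDiffAt hV (schemeMap_mem_recoverDomain (R := R) hz)).mdifferentiableAt
    (by simp)).hasMFDerivAt
  have h2 := h1.comp z (hasMFDerivAt_schemeMap hV hH hz)
  have hleg : ContinuousAt (legendre H h) z :=
    ((legendre_contMDiff hH).continuous.comp (Continuous.prodMk_right h)).continuousAt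
  have h3 : id =ᶠ[𝓝 z] recover R V ∘ schemeMap R H h := by
    filter_upwards [hleg.eventually_mem (hV.isOpen.mem_nhds hz)] with w hw
    exact (recover_schemeMap hV hw).symm
  have h4 := hasMFDerivAt_unique (h2.congr_of_eventuallyEq h3) (hasMFDerivAt_id z)
  refine Function.LeftInverse.injective (g := mfderiv ((cModel E).prod (cModel E)) (cModel E)
    (recover R V) (schemeMap R H h z)) fun ξ => DFunLike.congr_fun h4 ξ

/-- An isotropic subspace of half the dimension is Lagrangian. -/
theorem mem_range_iff_of_isotropic
    {T : E × (E →L[ℝ] ℝ) →L[ℝ] (E × (E →L[ℝ] ℝ)) × (E × (E →L[ℝ] ℝ))}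
    (hT : Function.Injective T) (hiso : ∀ ξ η, form12 (T ξ) (T η) = 0)
    (η : (E × (E →L[ℝ] ℝ)) × (E × (E →L[ℝ] ℝ))) :
    η ∈ Set.range T ↔ ∀ ζ ∈ Set.range T, form12 η ζ = 0 := by
  constructor
  · rintro ⟨ξ, rfl⟩ _ ⟨ζ, rfl⟩
    exact hiso ξ ζ
  · intro hη
    let S := LinearMap.range (T : E × (E →L[ℝ] ℝ) →ₗ[ℝ] (E × (E →L[ℝ] ℝ)) × (E × (E →L[ℝ] ℝ)))
    have h1 : S ≤ form12.orthogonal S := by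
      rintro _ ⟨ξ, rfl⟩ _ ⟨ζ, rfl⟩
      exact hiso ζ ξ
    have h2 : η ∈ form12.orthogonal S := by
      rintro _ ⟨ζ, rfl⟩
      exact form12_isRefl _ _ (hη _ ⟨ζ, rfl⟩)
    have h3 := LinearMap.BilinForm.finrank_orthogonal (form12_nondegenerate (E := E)) S
    have h4 : Module.finrank ℝ S = Module.finrank ℝ (E × (E →L[ℝ] ℝ)) :=
      LinearMap.finrank_range_of_inj hT
    have h5 : Module.finrank ℝ ((E × (E →L[ℝ] ℝ)) × (E × (E →L[ℝ] ℝ))) =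
      Module.finrank ℝ (E × (E →L[ℝ] ℝ)) + Module.finrank ℝ (E × (E →L[ℝ] ℝ)) :=
        Module.finrank_prod
    have h6 : S = form12.orthogonal S := Submodule.eq_of_le_of_finrank_eq h1 (by omega)
    rw [← h6] at h2
    exact h2

/-- The parametrization is `schemeMap` after an inverse chart of `T*Q`. The left inverse `recover`
provides injectivity, the embedding property and the immersion property; the tangent spaces are
isotropic of half the dimension. -/
theorem scheme_isLagrangian (hV : IsInvertibleOn R U V)
    (hH : ContMDiff (cModel E) 𝓘(ℝ, ℝ) ∞ H) (h : ℝ) :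
    IsLagrangianSubmanifold (scheme R V H h) := by
  intro y hy
  obtain ⟨z, hz, rfl⟩ := mem_scheme_iff.1 hy
  obtain ⟨b, hb⟩ : ∃ b, b = z.proj := ⟨_, rfl⟩
  have hzb : z ∈ (cotChart E b).source := mem_cotChart_source.2 (hb ▸ mem_chart_source E _)
  have hleg : Continuous (legendre H h) :=
    (legendre_contMDiff hH).continuous.comp (Continuous.prodMk_right h)
  have htop : IsOpen (cotChart E b).target :=
    isOpen_extChartAt_target (I := cModel E) (⟨b, 0⟩ : CQ E Q)
  have hsop : IsOpen (cotChart E b).source :=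
    isOpen_extChartAt_source (I := cModel E) (⟨b, 0⟩ : CQ E Q)
  have hsc : ContinuousOn (cotChart E b).symm (cotChart E b).target := fun u hu =>
    (cotChart_symm_contMDiffAt hu).continuousAt.continuousWithinAt
  have hrc : ContinuousOn (recover R V) (recoverDomain R V) := fun u hu =>
    (recover_contMDiffAt hV hu).continuousAt.continuousWithinAt
  let N : Set (CQ E Q) := {w | w ∈ (cotChart E b).source ∧ legendre H h w ∈ V}
  have hN : IsOpen N := hsop.inter (hV.isOpen.preimage hleg)
  let D : Set (E × (E →L[ℝ] ℝ)) := (cotChart E b).target ∩ (cotChart E b).symm ⁻¹' N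
  -- Requiring the recovered base point to lie in `N` excludes every other sheet of the scheme from
  -- `W`.
  let W : Set (CQ E Q × CQ E Q) := recoverDomain R V ∩ recover R V ⁻¹' N
  let f : E × (E →L[ℝ] ℝ) → CQ E Q × CQ E Q := schemeMap R H h ∘ (cotChart E b).symm
  have hWo : IsOpen W := hrc.isOpen_inter_preimage (isOpen_recoverDomain hV) hN
  have hfW : ∀ u ∈ D, f u ∈ W := fun u hu => by
    refine ⟨schemeMap_mem_recoverDomain hu.2.2, ?_⟩
    change recover R V (schemeMap R H h _) ∈ N
    rw [recover_schemeMap hV hu.2.2]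
    exact hu.2
  have hfs : ∀ u ∈ D, ContMDiffAt 𝓘(ℝ, E × (E →L[ℝ] ℝ)) ((cModel E).prod (cModel E)) ∞ f u :=
    fun u hu => (schemeMap_contMDiffAt_right hV hH hu.2.2).comp u (cotChart_symm_contMDiffAt hu.1)
  refine ⟨D, f, W, hsc.isOpen_inter_preimage htop hN, hWo, ?_, ?_,
    fun u hu => (hfs u hu).contMDiffWithinAt, ?_, ?_⟩
  · refine ⟨schemeMap_mem_recoverDomain hz, ?_⟩
    change recover R V (schemeMap R H h _) ∈ N
    rw [recover_schemeMap hV hz]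
    exact ⟨hzb, hz⟩
  · ext y
    constructor
    · rintro ⟨u, hu, rfl⟩
      exact ⟨mem_scheme_iff.2 ⟨_, hu.2.2, rfl⟩, hfW u hu⟩
    · rintro ⟨hyS, hyW⟩
      obtain ⟨w, hw, rfl⟩ := mem_scheme_iff.1 hyS
      have h1 : recover R V (schemeMap R H h w) ∈ N := hyW.2
      rw [recover_schemeMap hV hw] at h1
      have h2 := (cotChart E b).left_inv h1.1
      refine ⟨cotChart E b w, ⟨(cotChart E b).map_source h1.1, ?_⟩, ?_⟩
      · rw [Set.mem_preimage, h2]; exact h1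
      · simp only [f, Function.comp_apply, h2]
  · let f' : D → W := fun u => ⟨f u, hfW u u.2⟩
    have hf' : Continuous f' := by
      refine Continuous.subtype_mk (continuous_iff_continuousAt.2 fun u => ?_) _
      exact (hfs u u.2).continuousAt.comp continuous_subtype_val.continuousAt
    let g : W → E × (E →L[ℝ] ℝ) := fun y => cotChart E b (recover R V y)
    have hg : Continuous g := by
      refine continuous_iff_continuousAt.2 fun y => ?_
      have h1 := (cotChart_contMDiffAt (mem_cotChart_source.1 y.2.2.1)).continuousAt
      have h2 := (recover_contMDiffAt hV y.2.1).continuousAt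
      exact ContinuousAt.comp (f := fun y : W => recover R V y) h1
        (h2.comp continuous_subtype_val.continuousAt)
    have hgf : g ∘ f' = Subtype.val := by
      funext u
      change cotChart E b (recover R V (schemeMap R H h _)) = _
      rw [recover_schemeMap hV u.2.2.2]
      exact (cotChart E b).right_inv u.2.1
    have h1 : Topology.IsEmbedding f' :=
      Topology.IsEmbedding.of_comp hf' hg (hgf ▸ Topology.IsEmbedding.subtypeVal)
    exact Topology.IsEmbedding.subtypeVal.comp h1
  · intro u hu
    have hld : IsLocalDiffeomorphAt 𝓘(ℝ, E × (E →L[ℝ] ℝ)) (cModel E) ∞ (cotChart E b).symm u :=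
      isLocalDiffeomorphAt_extChartAt_symm (I := cModel E) (x := (⟨b, 0⟩ : CQ E Q)) hu.1
    obtain ⟨A, hA⟩ : ∃ A : (E × (E →L[ℝ] ℝ)) ≃L[ℝ] (E × (E →L[ℝ] ℝ)),
        HasMFDerivAt 𝓘(ℝ, E × (E →L[ℝ] ℝ)) (cModel E) (cotChart E b).symm u
          (A : E × (E →L[ℝ] ℝ) →L[ℝ] E × (E →L[ℝ] ℝ)) :=
      ⟨hld.mfderivToContinuousLinearEquiv (by simp), (hld.mdifferentiableAt (by simp)).hasMFDerivAt⟩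
    have h1 := (hasMFDerivAt_schemeMap hV hH hu.2.2).comp u hA
    let T : E × (E →L[ℝ] ℝ) →L[ℝ] (E × (E →L[ℝ] ℝ)) × (E × (E →L[ℝ] ℝ)) :=
      dScheme R H h ((cotChart E b).symm u) ∘L (A : E × (E →L[ℝ] ℝ) →L[ℝ] E × (E →L[ℝ] ℝ))
    have h2 : mfderiv 𝓘(ℝ, E × (E →L[ℝ] ℝ)) ((cModel E).prod (cModel E)) f u = T := h1.mfderiv
    have hTi : Function.Injective T := (dScheme_injective hV hH hu.2.2).comp A.injective
    have hT0 (ξ η) : form12 (T ξ) (T η) = 0 :=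
      sub_eq_zero.2 (dScheme_isotropic hV hH hu.2.2 (A ξ) (A η))
    rw [h2]
    refine ⟨hTi, fun η => (mem_range_iff_of_isotropic hTi hT0 η).trans ?_⟩
    refine forall₂_congr fun ζ _ => ?_
    rw [← omega12_eq (f u) η ζ]

/-- The vectors `(ξ, dφ ξ)` lie in the isotropic range of `dScheme`, which is the identity `φ^*ω =
ω`. It makes `dφ` injective, as `ω` is nondegenerate, and injectivity suffices in equal finite
dimensions. -/
theorem isLocalSymplectomorphismOn_of_graph_subset (hV : IsInvertibleOn R U V)
    (hH : ContMDiff (cModel E) 𝓘(ℝ, ℝ) ∞ H) {D : Set (CQ E Q)} {φ : CQ E Q → CQ E Q}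
    (hD : IsOpen D) (hφ : ContMDiffOn (cModel E) (cModel E) ∞ φ D)
    (hg : ∀ z ∈ D, (z, φ z) ∈ scheme R V H h) : IsLocalSymplectomorphismOn φ D := by
  intro z hz
  have hφz : ∀ᶠ w in 𝓝 z, ContMDiffAt (cModel E) (cModel E) ∞ φ w :=
    (hD.eventually_mem hz).mono fun w hw => hφ.contMDiffAt (hD.mem_nhds hw)
  obtain ⟨dφ, hdφ⟩ : ∃ L : E × (E →L[ℝ] ℝ) →L[ℝ] E × (E →L[ℝ] ℝ),
      HasMFDerivAt (cModel E) (cModel E) φ z L :=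
    ⟨mfderiv (cModel E) (cModel E) φ z,
      (hφz.self_of_nhds.mdifferentiableAt (by simp)).hasMFDerivAt⟩
  obtain ⟨w, hw, hwz⟩ := mem_scheme_iff.1 (hg z hz)
  have hrd : (z, φ z) ∈ recoverDomain R V := hwz ▸ schemeMap_mem_recoverDomain hw
  have hrw : recover R V (z, φ z) = w := by rw [← hwz, recover_schemeMap hV hw]
  have k1 := (hasMFDerivAt_id (I := cModel E) z).prodMk hdφ
  have k2 := ((recover_contMDiffAt hV hrd).mdifferentiableAt (by simp)).hasMFDerivAt.comp z k1
  have k3 := hasMFDerivAt_schemeMap hV hH (z := recover R V (z, φ z)) (h := h) (by rwa [hrw])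
  have k4 := k3.comp z k2
  -- The graph map factors through `schemeMap ∘ recover`; differentiating this factorization lifts
  -- `(ξ, dφ ξ)` to a vector `γ ξ`.
  have k5 : (fun w => (w, φ w)) =ᶠ[𝓝 z]
      schemeMap R H h ∘ recover R V ∘ fun w => (id w, φ w) := by
    filter_upwards [hD.mem_nhds hz] with x hx
    obtain ⟨y, hy, hyx⟩ := mem_scheme_iff.1 (hg x hx)
    simp only [Function.comp_apply, id]
    rw [← hyx, recover_schemeMap hV hy]
  have k6 := hasMFDerivAt_unique (k4.congr_of_eventuallyEq k5) k1
  obtain ⟨γ, hγ⟩ : ∃ γ : E × (E →L[ℝ] ℝ) →L[ℝ] E × (E →L[ℝ] ℝ), ∀ ξ,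
      dScheme R H h (recover R V (z, φ z)) (γ ξ) = (ξ, dφ ξ) :=
    ⟨_, fun ξ => DFunLike.congr_fun k6 ξ⟩
  have hsymp (ξ η : E × (E →L[ℝ] ℝ)) : (dφ η).2 (dφ ξ).1 - (dφ ξ).2 (dφ η).1 =
      η.2 ξ.1 - ξ.2 η.1 := by
    have := dScheme_isotropic hV hH (z := recover R V (z, φ z)) (h := h) (by rwa [hrw])
      (γ ξ) (γ η)
    rwa [hγ, hγ] at this
  have hker (ξ : E × (E →L[ℝ] ℝ)) (hξ : dφ ξ = 0) : ξ = 0 := by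
    refine omega_nondegenerate z ξ fun η => ?_
    refine (omega_apply z ξ η).trans ?_
    refine (hsymp ξ η).symm.trans ?_
    simp [hξ]
  obtain ⟨e, he⟩ := exists_continuousLinearEquiv rfl dφ hker
  refine ⟨isLocalDiffeomorphAt_of_hasMFDerivAt (f' := e) hφz (he ▸ hdφ), fun ξ η => ?_⟩
  have h1 : mfderiv (cModel E) (cModel E) φ z = dφ := hdφ.mfderiv
  rw [h1]
  exact (omega_apply (φ z) (dφ ξ) (dφ η)).trans ((hsymp ξ η).trans (omega_apply z ξ η).symm)

end Lagrangian

/-! ### The discretization conditions in charts and local invertibility -/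

section Rigidity
variable {R : TQ E Q → Q × Q} {U V : Set (TQ E Q)}

/-- The inclusion of a fibre into `TQ` has the vertical inclusion as its differential at zero. -/
theorem hasMFDerivAt_fiber (q : Q) :
    HasMFDerivAt 𝓘(ℝ, E) (tModel E) (fun v : E => (⟨q, v⟩ : TQ E Q)) 0
      (ContinuousLinearMap.inr ℝ E E) := by
  have hM : IsManifold (tModel E) 1 (TQ E Q) := inferInstance
  have hq : q ∈ (chartAt E q).source := mem_chart_source E q
  have h0 (v : E) : tanChart E q (⟨q, v⟩ : TQ E Q) = (extChartAt 𝓘(ℝ, E) q q, v) := by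
    refine Prod.ext (tanChart_fst _ _) ((tanChart_snd (v := ⟨q, v⟩) hq).trans ?_)
    change dBase E q q v = v
    rw [dBase_self]; rfl
  have h1 : (fun v : E => (⟨q, v⟩ : TQ E Q)) =
      (tanChart E q).symm ∘ fun v : E => (extChartAt 𝓘(ℝ, E) q q, v) := by
    funext v
    rw [Function.comp_apply, ← h0,
      (tanChart E q).left_inv ((mem_tanChart_source (v := ⟨q, v⟩)).2 hq)]
  have ht : (extChartAt 𝓘(ℝ, E) q q, (0 : E)) ∈ (tanChart E q).target := by
    rw [← h0]; exact (tanChart E q).map_source ((mem_tanChart_source (v := ⟨q, 0⟩)).2 hq)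
  rw [← h0] at ht
  have h2 := ((tanChart_symm_contMDiffAt ht).mdifferentiableAt (by simp)).hasMFDerivAt
  have h3 := mfderivWithin_range_extChartAt_symm (I := tModel E) (x := (⟨q, 0⟩ : TQ E Q))
  rw [ModelWithCorners.range_eq_univ, mfderivWithin_univ, extChartAt_tan] at h3
  have hL : ∀ x : E × E, x = tanChart E q (⟨q, 0⟩ : TQ E Q) → HasMFDerivAt 𝓘(ℝ, E × E) (tModel E)
      (tanChart E q).symm x (ContinuousLinearMap.id ℝ (E × E)) := by
    rintro _ rfl
    obtain ⟨L, hL, hL'⟩ : ∃ L : E × E →L[ℝ] E × E, HasMFDerivAt 𝓘(ℝ, E × E) (tModel E)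
        (tanChart E q).symm (tanChart E q (⟨q, 0⟩ : TQ E Q)) L ∧ L = ContinuousLinearMap.id ℝ _ :=
      ⟨_, h2, h3⟩
    rwa [hL'] at hL
  have h4 : HasFDerivAt (fun v : E => (extChartAt 𝓘(ℝ, E) q q, v)) (ContinuousLinearMap.inr ℝ E E)
      0 := (hasFDerivAt_const _ _).prodMk (hasFDerivAt_id 0)
  have h5 := (hL _ (h0 0).symm).comp (0 : E) h4.hasMFDerivAt
  rw [h1]
  exact h5

theorem contMDiffAt_zero (hR : IsDiscretizationMap R U) (q : Q) :
    ContMDiffAt (tModel E) (𝓘(ℝ, E).prod 𝓘(ℝ, E)) ∞ R (⟨q, 0⟩ : TQ E Q) :=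
  hR.smooth.contMDiffAt (hR.isOpen.mem_nhds (hR.zero_mem q))

theorem dR_vertical (hR : IsDiscretizationMap R U) (q : Q) (e : E) :
    (dR R (⟨q, 0⟩ : TQ E Q) (0, e)).2 - (dR R (⟨q, 0⟩ : TQ E Q) (0, e)).1 = e := by
  have h0 : HasMFDerivAt (tModel E) (𝓘(ℝ, E).prod 𝓘(ℝ, E)) R (⟨q, 0⟩ : TQ E Q) (dR R ⟨q, 0⟩) :=
    ((contMDiffAt_zero hR q).mdifferentiableAt (by simp)).hasMFDerivAt
  have h1 := h0.comp (0 : E) (hasMFDerivAt_fiber q)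
  have h2 := (hasMFDerivAt_fst (I := 𝓘(ℝ, E)) (I' := 𝓘(ℝ, E)) (R ⟨q, 0⟩)).comp (0 : E) h1
  have h3 := (hasMFDerivAt_snd (I := 𝓘(ℝ, E)) (I' := 𝓘(ℝ, E)) (R ⟨q, 0⟩)).comp (0 : E) h1
  have h4 := DFunLike.congr_fun h2.mfderiv e
  have h5 := DFunLike.congr_fun h3.mfderiv e
  have h6 := DFunLike.congr_fun (hR.rigidity q) e
  have h7 : fiberDeriv (fun v => (R v).2) q e - fiberDeriv (fun v => (R v).1) q e = e := h6
  have h8 : fiberDeriv (fun v => (R v).1) q e = (dR R (⟨q, 0⟩ : TQ E Q) (0, e)).1 := h4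
  have h9 : fiberDeriv (fun v => (R v).2) q e = (dR R (⟨q, 0⟩ : TQ E Q) (0, e)).2 := h5
  rw [← h8, ← h9, h7]

theorem tanChart_zero {b q : Q} (hq : q ∈ (chartAt E b).source) :
    tanChart E b (⟨q, 0⟩ : TQ E Q) = (extChartAt 𝓘(ℝ, E) b q, 0) :=
  Prod.ext (tanChart_fst _ _) ((tanChart_snd (v := ⟨q, 0⟩) hq).trans (map_zero _))

theorem localR_contDiffAt_zero (hR : IsDiscretizationMap R U) {b q : Q}
    (hq : q ∈ (chartAt E b).source) :
    ContDiffAt ℝ ∞ (localR R b (b, b)) (extChartAt 𝓘(ℝ, E) b q, 0) := by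
  rw [← tanChart_zero hq]
  exact localR_contDiffAt (contMDiffAt_zero hR q) hq (by rw [hR.map_zero]; exact hq)
    (by rw [hR.map_zero]; exact hq)

/-- In charts, a discretization map satisfies the rigidity condition. -/
theorem fderiv_localR_vertical (hR : IsDiscretizationMap R U) {b q : Q}
    (hq : q ∈ (chartAt E b).source) (e : E) :
    (fderiv ℝ (localR R b (b, b)) (extChartAt 𝓘(ℝ, E) b q, 0) (0, e)).2 -
      (fderiv ℝ (localR R b (b, b)) (extChartAt 𝓘(ℝ, E) b q, 0) (0, e)).1 = e := by
  have hq' : (⟨q, 0⟩ : TQ E Q).proj ∈ (chartAt E b).source := hq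
  obtain ⟨A, hA⟩ := dBase_isInvertible hq
  have h1 := fderiv_localR (b := b) (c := (b, b)) (contMDiffAt_zero hR q) hq'
    (by rw [hR.map_zero]; exact hq) (by rw [hR.map_zero]; exact hq) (0, A.symm e)
  have h2 : dBase E b q (A.symm e) = e := by rw [← hA]; simp
  have h3 := dTan_vertical hq' (A.symm e)
  change _ = ((0 : E), dBase E b q (A.symm e)) at h3
  rw [h3, h2, tanChart_zero hq, hR.map_zero] at h1
  rw [h1]
  simp only
  rw [← map_sub, dR_vertical hR, h2]

/-- Along the zero section `R` is the diagonal, so in charts `(y, 0) ↦ (y, y)`. -/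
theorem fderiv_localR_horizontal (hR : IsDiscretizationMap R U) {b q : Q}
    (hq : q ∈ (chartAt E b).source) (δ : E) :
    fderiv ℝ (localR R b (b, b)) (extChartAt 𝓘(ℝ, E) b q, 0) (δ, 0) = (δ, δ) := by
  have h1 := ((localR_contDiffAt_zero hR hq).differentiableAt (by simp)).hasFDerivAt
  have h2 : HasFDerivAt (fun y : E => (y, (0 : E))) (ContinuousLinearMap.inl ℝ E E)
      (extChartAt 𝓘(ℝ, E) b q) := (ContinuousLinearMap.inl ℝ E E).hasFDerivAt
  have h3 := HasFDerivAt.comp (g := localR R b (b, b)) (extChartAt 𝓘(ℝ, E) b q) h1 h2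
  have h4 : HasFDerivAt (fun y : E => (y, y)) ((ContinuousLinearMap.id ℝ E).prod
    (ContinuousLinearMap.id ℝ E)) (extChartAt 𝓘(ℝ, E) b q) :=
      (hasFDerivAt_id _).prodMk (hasFDerivAt_id _)
  have h5 : (fun y : E => (y, y)) =ᶠ[𝓝 (extChartAt 𝓘(ℝ, E) b q)]
      localR R b (b, b) ∘ fun y : E => (y, (0 : E)) := by
    filter_upwards [(isOpen_extChartAt_target b).mem_nhds
      ((extChartAt 𝓘(ℝ, E) b).map_source (by simpa using hq))] with y hy
    have hys : (extChartAt 𝓘(ℝ, E) b).symm y ∈ (chartAt E b).source := by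
      simpa using (extChartAt 𝓘(ℝ, E) b).map_target hy
    have h6 := tanChart_zero hys
    rw [(extChartAt 𝓘(ℝ, E) b).right_inv hy] at h6
    simp only [Function.comp_apply, localR, ← h6]
    rw [(tanChart E b).left_inv ((mem_tanChart_source (v := ⟨_, 0⟩)).2 hys), hR.map_zero,
      (extChartAt 𝓘(ℝ, E) b).right_inv hy]
  exact DFunLike.congr_fun (h3.unique (h4.congr_of_eventuallyEq h5.symm)) δ

/-- A discretization map is a local diffeomorphism near the zero section. -/
theorem exists_isInvertibleOn [FiniteDimensional ℝ E] (hR : IsDiscretizationMap R U) (q : Q) :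
    ∃ V : Set (TQ E Q), IsInvertibleOn R U V ∧ (⟨q, 0⟩ : TQ E Q) ∈ V := by
  have hq : q ∈ (chartAt E q).source := mem_chart_source E q
  have hd : HasMFDerivAt (tModel E) (𝓘(ℝ, E).prod 𝓘(ℝ, E)) R (⟨q, 0⟩ : TQ E Q) (dR R ⟨q, 0⟩) :=
    ((contMDiffAt_zero hR q).mdifferentiableAt (by simp)).hasMFDerivAt
  have h1 (ζ : E × E) : fderiv ℝ (localR R q (q, q)) (extChartAt 𝓘(ℝ, E) q q, 0) ζ =
      dR R ⟨q, 0⟩ ζ := by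
    have hm : (R ⟨q, 0⟩).1 ∈ (chartAt E q).source := by rw [hR.map_zero]; exact hq
    have hm' : (R ⟨q, 0⟩).2 ∈ (chartAt E q).source := by rw [hR.map_zero]; exact hq
    have h2 := fderiv_localR (b := q) (c := (q, q)) (contMDiffAt_zero hR q) hq hm hm' ζ
    have h3 : dTan E q (⟨q, 0⟩ : TQ E Q) = ContinuousLinearMap.id ℝ _ := dTan_self ⟨q, 0⟩
    rw [h3, tanChart_zero hq, hR.map_zero] at h2
    simp only [dBase_self] at h2
    exact h2
  -- The components of the image of `(δ, ε)` have the form `δ + a` and `δ + a'` with `a' - a = ε`.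
  -- If both vanish, then `ε = 0`, hence `a = 0` and `δ = 0`.
  have hker (ζ : E × E) (hζ : dR R (⟨q, 0⟩ : TQ E Q) ζ = 0) : ζ = 0 := by
    obtain ⟨δ, ε⟩ := ζ
    rw [← h1] at hζ
    have h2 : ((δ, ε) : E × E) = (δ, 0) + (0, ε) := by simp
    rw [h2, map_add, fderiv_localR_horizontal hR hq] at hζ
    have h3 := fderiv_localR_vertical hR hq ε
    have h4 : δ + (fderiv ℝ (localR R q (q, q)) (extChartAt 𝓘(ℝ, E) q q, 0) (0, ε)).1 = 0 :=
      congrArg Prod.fst hζ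
    have h5 : δ + (fderiv ℝ (localR R q (q, q)) (extChartAt 𝓘(ℝ, E) q q, 0) (0, ε)).2 = 0 :=
      congrArg Prod.snd hζ
    have h6 : ε = 0 := by
      rw [← h3]
      exact sub_eq_zero.2 (add_left_cancel (h5.trans h4.symm))
    have h7 : ((0 : E), (0 : E)) = 0 := rfl
    rw [h6, h7, map_zero] at h4
    rw [h6]
    simp at h4
    rw [h4]; rfl
  obtain ⟨e, he⟩ := exists_continuousLinearEquiv rfl (dR R (⟨q, 0⟩ : TQ E Q)) hker
  have hev : ∀ᶠ v in 𝓝 (⟨q, 0⟩ : TQ E Q), ContMDiffAt (tModel E) (𝓘(ℝ, E).prod 𝓘(ℝ, E)) ∞ R v :=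
    (hR.isOpen.eventually_mem (hR.zero_mem q)).mono fun v hv =>
      hR.smooth.contMDiffAt (hR.isOpen.mem_nhds hv)
  obtain ⟨Φ, hΦ, hΦR⟩ := isLocalDiffeomorphAt_of_hasMFDerivAt (f' := e) hev (he ▸ hd)
  refine ⟨Φ.source ∩ U, ⟨Φ.open_source.inter hR.isOpen, Set.inter_subset_right, ?_, ?_⟩, hΦ,
    hR.zero_mem q⟩
  · intro v hv w hw hvw
    rw [hΦR hv.1, hΦR hw.1] at hvw
    exact Φ.injOn hv.1 hw.1 hvw
  · exact fun v hv => ⟨Φ, hv.1, hΦR⟩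

end Rigidity

section Curves
variable {F G : Type*} [NormedAddCommGroup F] [NormedSpace ℝ F] [NormedAddCommGroup G]
  [NormedSpace ℝ G] {f : ℝ → F × G} {f' : F × G} {x : ℝ}

theorem hasDerivAt_fst (h : HasDerivAt f f' x) : HasDerivAt (fun y => (f y).1) f'.1 x :=
  (ContinuousLinearMap.fst ℝ F G).hasFDerivAt.comp_hasDerivAt x h

theorem hasDerivAt_snd (h : HasDerivAt f f' x) : HasDerivAt (fun y => (f y).2) f'.2 x :=
  (ContinuousLinearMap.snd ℝ F G).hasFDerivAt.comp_hasDerivAt x h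

end Curves

/-! ### Consistency of the scheme at `h = 0` -/

section Velocity
variable [FiniteDimensional ℝ E] {R : TQ E Q → Q × Q} {U V : Set (TQ E Q)} {H : CQ E Q → ℝ}

theorem hamChart_self (hH : ContMDiff (cModel E) 𝓘(ℝ, ℝ) ∞ H) (h : ℝ) (z : CQ E Q) :
    hamChart H z.proj h (cotChart E z.proj z) = hamVec H h z := by
  have hz : z.proj ∈ (chartAt E z.proj).source := mem_chart_source E _
  refine Prod.ext ?_ (ContinuousLinearMap.ext fun δ => ?_)
  · rw [hamChart_fst hH hz, dBase_self]; rfl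
  · have h1 := alpha_hamVec hH hz h (δ, 0)
    have h2 : dTan E z.proj (⟨z.proj, (hamVec H h z).1⟩ : TQ E Q) = ContinuousLinearMap.id ℝ _ :=
      dTan_self ⟨z.proj, (hamVec H h z).1⟩
    rw [h2] at h1
    simpa using h1

theorem hamChart_smul (H : CQ E Q → ℝ) (b : Q) (h : ℝ) (u : E × (E →L[ℝ] ℝ)) :
    hamChart H b h u = h • hamChart H b 1 u := by
  simp only [hamChart, one_smul]
  exact map_smul (sharpModel E) _ _

theorem legendre_zero (H : CQ E Q → ℝ) (z : CQ E Q) : legendre H 0 z = ⟨z.proj, 0⟩ := by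
  have h1 : hamVec H 0 z = 0 := by
    unfold hamVec
    rw [zero_smul]
    exact map_zero (sharp z)
  unfold legendre
  rw [h1]
  rfl

/-- At `h = 0` the transported covector is `p dv` at a zero vector. Rigidity says that the fibre
component of the preimage of `(e₀, e₁)` under the differential is `e₁ - e₀`, so `p₁ e₁ - p₀ e₀ = p
(e₁ - e₀)` and both momenta equal `p`. -/
theorem schemeMap_zero (hR : IsDiscretizationMap R U) (hV : IsInvertibleOn R U V)
    (hH : ContMDiff (cModel E) 𝓘(ℝ, ℝ) ∞ H) {z : CQ E Q} (hz : (⟨z.proj, 0⟩ : TQ E Q) ∈ V) :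
    schemeMap R H 0 z = (z, z) := by
  have hb : z.proj ∈ (chartAt E z.proj).source := mem_chart_source E _
  have hzV : legendre H 0 z ∈ V := by rwa [legendre_zero]
  have hp : R (legendre H 0 z) = (z.proj, z.proj) := by rw [legendre_zero, hR.map_zero]
  have h1 : (R (legendre H 0 z)).1 ∈ (chartAt E z.proj).source := by rw [hp]; exact hb
  have h2 : (R (legendre H 0 z)).2 ∈ (chartAt E z.proj).source := by rw [hp]; exact hb
  have hi := fderiv_localR_isInvertible (b := z.proj) (c := (z.proj, z.proj))
    (hV.localDiffeo _ hzV) hb h1 h2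
  have k := schemeMap_chart (b := z.proj) (c := (z.proj, z.proj)) hH (hV.localDiffeo _ hzV) hb h1 h2
  have ht : tanChart E z.proj (legendre H 0 z) = (extChartAt 𝓘(ℝ, E) z.proj z.proj, 0) := by
    rw [legendre_zero, tanChart_zero hb]
  have hX : hamChart H z.proj 0 (cotChart E z.proj z) = 0 := by rw [hamChart_smul, zero_smul]
  rw [ht] at k hi
  rw [hX] at k
  have s1 : (schemeMap R H 0 z).1.proj = z.proj := congrArg Prod.fst hp
  have s2 : (schemeMap R H 0 z).2.proj = z.proj := congrArg Prod.snd hp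
  have hs := (cotChart E z.proj).injOn
  obtain ⟨D, hD⟩ := hi
  have kk (e0 e1 : E) := k (D.symm (e0, e1))
  have hDD (ε : E × E) : fderiv ℝ (localR R z.proj (z.proj, z.proj))
      (extChartAt 𝓘(ℝ, E) z.proj z.proj, 0) (D.symm ε) = ε := by rw [← hD]; simp
  simp only [hDD] at kk
  have hD2 (ε : E × E) : (D.symm ε).2 = ε.2 - ε.1 := by
    have m1 := hDD ε
    have m2 : D.symm ε = ((D.symm ε).1, 0) + (0, (D.symm ε).2) := by simp
    rw [m2, map_add, fderiv_localR_horizontal hR hb] at m1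
    have m3 := fderiv_localR_vertical hR hb (D.symm ε).2
    have c1 := congrArg Prod.fst m1
    have c2 := congrArg Prod.snd m1
    simp only [Prod.fst_add, Prod.snd_add] at c1 c2
    rw [← c2, ← c1, add_sub_add_left_eq_sub]
    exact m3.symm
  simp only [hD2] at kk
  refine Prod.ext ?_ ?_
  · refine hs (mem_cotChart_source.2 (s1 ▸ hb)) (mem_cotChart_source.2 hb) (Prod.ext ?_ ?_)
    · rw [cotChart_fst, cotChart_fst, s1]
    · refine ContinuousLinearMap.ext fun e => ?_
      have := kk e 0
      simp at this
      exact this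
  · refine hs (mem_cotChart_source.2 (s2 ▸ hb)) (mem_cotChart_source.2 hb) (Prod.ext ?_ ?_)
    · rw [cotChart_fst, cotChart_fst, s2]
    · refine ContinuousLinearMap.ext fun e => ?_
      have := kk 0 e
      simp at this
      exact this

/-- Consistency of the scheme: a curve `h ↦ z₁` of endpoints with fixed starting point `z` has the
Hamiltonian vector field as its velocity at `h = 0`. -/
theorem hasDerivAt_scheme_curve (hR : IsDiscretizationMap R U) (hV : IsInvertibleOn R U V)
    (hH : ContMDiff (cModel E) 𝓘(ℝ, ℝ) ∞ H) {w c : ℝ → CQ E Q} {z : CQ E Q}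
    {u' c' : E × (E →L[ℝ] ℝ)}
    (hw0 : w 0 = z) (hc0 : c 0 = z) (hwc : ContinuousAt w 0)
    (hw : HasDerivAt (fun h => cotChart E z.proj (w h)) u' 0)
    (hc : HasDerivAt (fun h => cotChart E z.proj (c h)) c' 0)
    (hwV : ∀ᶠ h in 𝓝 0, legendre H h (w h) ∈ V ∧ schemeMap R H h (w h) = (z, c h))
    (hcc : ContinuousAt c 0) : c' = hamVec H 1 z := by
  obtain ⟨b, hb⟩ : ∃ b, b = z.proj := ⟨_, rfl⟩
  rw [← hamChart_self hH]
  rw [← hb] at hw hc ⊢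
  have hzb : z.proj ∈ (chartAt E b).source := hb ▸ mem_chart_source E _
  obtain ⟨u₀, hu₀⟩ : ∃ u₀, u₀ = cotChart E b z := ⟨_, rfl⟩
  obtain ⟨q₀, hq₀⟩ : ∃ q₀, q₀ = extChartAt 𝓘(ℝ, E) b b := ⟨_, rfl⟩
  have hu₀1 : u₀.1 = q₀ := by rw [hu₀, cotChart_fst, ← hb, hq₀]
  rw [← hu₀]
  have hbb : b ∈ (chartAt E b).source := mem_chart_source E _
  have hut : u₀ ∈ (cotChart E b).target :=
    hu₀ ▸ (cotChart E b).map_source (mem_cotChart_source.2 hzb)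
  let r := localR R b (b, b)
  have hr : ContDiffAt ℝ ∞ r (q₀, 0) := hq₀ ▸ localR_contDiffAt_zero hR hbb
  let u : ℝ → E × (E →L[ℝ] ℝ) := fun h => cotChart E b (w h)
  have hu0 : u 0 = u₀ := by simp only [u, hw0, hu₀]
  let X : E × (E →L[ℝ] ℝ) → E × (E →L[ℝ] ℝ) := hamChart H b 1
  let t : ℝ → E × E := fun h => ((u h).1, (h • X (u h)).1)
  have ht0 : t 0 = (q₀, 0) := by simp [t, hu0, hu₀1]
  -- the equations of the scheme along the curve
  have hev : ∀ᶠ h in 𝓝 (0 : ℝ), (cotChart E b z).1 = (r (t h)).1 ∧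
      (cotChart E b (c h)).1 = (r (t h)).2 ∧ ∀ ζ, (cotChart E b (c h)).2 (fderiv ℝ r (t h) ζ).2 -
        (cotChart E b z).2 (fderiv ℝ r (t h) ζ).1 = (h • X (u h)).2 ζ.1 + (u h).2 ζ.2 := by
    have n1 := hwc.eventually_mem (show (cotChart E b).source ∈ _ by
      rw [hw0]; exact cotChart_source_mem_nhds hzb)
    have n2 := hcc.eventually_mem (show (cotChart E b).source ∈ _ by
      rw [hc0]; exact cotChart_source_mem_nhds hzb)
    filter_upwards [hwV, n1, n2] with h ⟨h1, h2⟩ h3 h4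
    have m1 : (R (legendre H h (w h))).1 = z.proj :=
      congrArg (fun y : CQ E Q × CQ E Q => y.1.proj) h2
    have m2 : (R (legendre H h (w h))).2 = (c h).proj :=
      congrArg (fun y : CQ E Q × CQ E Q => y.2.proj) h2
    have h3' := mem_cotChart_source.1 h3
    have k := schemeMap_chart (c := (b, b)) hH (hV.localDiffeo _ h1) h3'
      (by rw [m1]; exact hzb) (by rw [m2]; exact mem_cotChart_source.1 h4)
    have k0 := tanChart_legendre (h := h) hH h3'
    have kX := hamChart_smul H b h (cotChart E b (w h))
    have kl : (tanChart E b).symm (tanChart E b (legendre H h (w h))) = legendre H h (w h) :=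
      (tanChart E b).left_inv ((mem_tanChart_source (v := legendre H h (w h))).2 h3')
    rw [kX] at k0 k
    rw [k0, h2] at k
    rw [k0] at kl
    refine ⟨?_, ?_, k⟩
    · rw [cotChart_fst]
      change _ = extChartAt 𝓘(ℝ, E) b (R ((tanChart E b).symm ((cotChart E b (w h)).1,
        (h • hamChart H b 1 (cotChart E b (w h))).1))).1
      rw [kl, m1]
    · rw [cotChart_fst]
      change _ = extChartAt 𝓘(ℝ, E) b (R ((tanChart E b).symm ((cotChart E b (w h)).1,
        (h • hamChart H b 1 (cotChart E b (w h))).1))).2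
      rw [kl, m2]
  -- derivatives at zero
  have hXd : DifferentiableAt ℝ X u₀ :=
    ((hamChart_contDiffAt (y := (1, u₀)) hH hut).comp u₀
      (contDiffAt_const.prodMk contDiffAt_id)).differentiableAt (by simp)
  have hu : HasDerivAt u u' 0 := hw
  -- The factor `h` vanishes at `0`, so the derivative of `X` along the unknown curve drops out.
  have hXu : HasDerivAt (fun h : ℝ => h • X (u h)) (X u₀) 0 := by
    rw [← hu0] at hXd
    have := (hasDerivAt_id (0 : ℝ)).smul (hXd.hasFDerivAt.comp_hasDerivAt 0 hu)
    simp only [id_eq, zero_smul, zero_add, one_smul, Function.comp_apply, hu0] at this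
    exact this
  have ht : HasDerivAt t (u'.1, (X u₀).1) 0 := (hasDerivAt_fst hu).prodMk (hasDerivAt_fst hXu)
  have hrd : HasFDerivAt r (fderiv ℝ r (q₀, 0)) (t 0) := by
    rw [ht0]; exact (hr.differentiableAt (by simp)).hasFDerivAt
  have hrt := hrd.comp_hasDerivAt 0 ht
  have hsplit : ((u'.1, (X u₀).1) : E × E) = (u'.1, 0) + (0, (X u₀).1) := by simp
  have hhor (δ : E) : fderiv ℝ r (q₀, 0) (δ, 0) = (δ, δ) :=
    hq₀ ▸ fderiv_localR_horizontal hR hbb δ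
  have hver (e : E) : (fderiv ℝ r (q₀, 0) (0, e)).2 - (fderiv ℝ r (q₀, 0) (0, e)).1 = e :=
    hq₀ ▸ fderiv_localR_vertical hR hbb e
  -- The starting point is fixed, so the first component of `r ∘ t` is constant. Subtracting this
  -- from the second component eliminates the unknown `u'.1`, and rigidity leaves `(X u₀).1`.
  have e1 : (fderiv ℝ r (q₀, 0) (u'.1, (X u₀).1)).1 = 0 :=
    (hasDerivAt_fst hrt).unique ((hasDerivAt_const (0 : ℝ) (cotChart E b z).1).congr_of_eventuallyEq
      (hev.mono fun h hh => hh.1.symm))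
  have e2 : c'.1 = (fderiv ℝ r (q₀, 0) (u'.1, (X u₀).1)).2 :=
    (hasDerivAt_fst hc).unique ((hasDerivAt_snd hrt).congr_of_eventuallyEq (hev.mono fun h hh => hh.2.1))
  refine Prod.ext ?_ (ContinuousLinearMap.ext fun δ => ?_)
  · rw [hsplit, map_add, hhor] at e1 e2
    have e3 := hver (X u₀).1
    rw [e2]
    change u'.1 + (fderiv ℝ r (q₀, 0) (0, (X u₀).1)).2 = (X u₀).1
    change u'.1 + (fderiv ℝ r (q₀, 0) (0, (X u₀).1)).1 = 0 at e1
    calc u'.1 + (fderiv ℝ r (q₀, 0) (0, (X u₀).1)).2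
        = (u'.1 + (fderiv ℝ r (q₀, 0) (0, (X u₀).1)).1) +
          ((fderiv ℝ r (q₀, 0) (0, (X u₀).1)).2 - (fderiv ℝ r (q₀, 0) (0, (X u₀).1)).1) := by abel
      _ = (X u₀).1 := by rw [e1, e3, zero_add]
  · obtain ⟨t', ht'⟩ : ∃ t' : E × E, t' = (u'.1, (X u₀).1) := ⟨_, rfl⟩
    rw [← ht'] at ht
    have hD2 : HasFDerivAt (fderiv ℝ r) (fderiv ℝ (fderiv ℝ r) (q₀, 0)) (q₀, 0) :=
      hasFDerivAt_fderiv hr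
    -- Symmetry moves the outer derivative to the direction `(δ, 0)` along the zero section, where
    -- rigidity holds identically and can be differentiated.
    have hsymm := (hr.isSymmSndFDerivAt minSmoothness_two_le) t' (δ, 0)
    have hD2' : HasFDerivAt (fderiv ℝ r) (fderiv ℝ (fderiv ℝ r) (q₀, 0)) (t 0) := by
      rw [ht0]; exact hD2
    -- The covector equation is tested on `(δ, 0)`: the term `(u h).2 ζ.2` vanishes, and at `h = 0`
    -- both components of the differential of `r` are `δ`. What remains are `c'.2 δ`, `(X u₀).2 δ`
    -- and `p` applied to a mixed second derivative.
    have hDt := (hD2'.comp_hasDerivAt 0 ht).clm_apply (hasDerivAt_const (0 : ℝ) ((δ, 0) : E × E))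
    have hl := ((hasDerivAt_snd hc).clm_apply (hasDerivAt_snd hDt)).sub
      ((hasDerivAt_const (0 : ℝ) (cotChart E b z).2).clm_apply (hasDerivAt_fst hDt))
    have hrhs := (hasDerivAt_snd hXu).clm_apply (hasDerivAt_const (0 : ℝ) δ)
    have e4 := hl.unique (hrhs.congr_of_eventuallyEq (hev.mono fun h hh => by
      simpa using hh.2.2 (δ, 0)))
    -- the mixed second derivative vanishes by the rigidity condition
    have e5 : (fderiv ℝ (fderiv ℝ r) (q₀, 0) (δ, 0) t').2 -
        (fderiv ℝ (fderiv ℝ r) (q₀, 0) (δ, 0) t').1 = 0 := by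
      have g1 : HasFDerivAt (fun y : E => (y, (0 : E))) (ContinuousLinearMap.inl ℝ E E) q₀ :=
        (ContinuousLinearMap.inl ℝ E E).hasFDerivAt
      have g2 := (HasFDerivAt.comp (g := fderiv ℝ r) q₀ hD2 g1).clm_apply (hasFDerivAt_const t' q₀)
      have g3 := g2.snd.sub g2.fst
      have g4 : (fun y : E => (fderiv ℝ r (y, 0) t').2 - (fderiv ℝ r (y, 0) t').1) =ᶠ[𝓝 q₀]
          fun _ => t'.2 := by
        have hq₀t : q₀ ∈ (extChartAt 𝓘(ℝ, E) b).target := hq₀ ▸ mem_extChartAt_target b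
        filter_upwards [(isOpen_extChartAt_target b).mem_nhds hq₀t] with y hy
        have hys : (extChartAt 𝓘(ℝ, E) b).symm y ∈ (chartAt E b).source := by
          simpa using (extChartAt 𝓘(ℝ, E) b).map_target hy
        have f1 := fderiv_localR_horizontal hR hys t'.1
        have f2 := fderiv_localR_vertical hR hys t'.2
        rw [(extChartAt 𝓘(ℝ, E) b).right_inv hy] at f1 f2
        have f3 : t' = (t'.1, 0) + (0, t'.2) := by simp
        rw [f3, map_add]
        simp only [r] at f1 f2 ⊢
        rw [f1]
        simpa using f2
      have g5 := g3.unique ((hasFDerivAt_const t'.2 q₀).congr_of_eventuallyEq g4)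
      have := DFunLike.congr_fun g5 δ
      simpa using this
    have k0 : (cotChart E b (c 0)).2 = (cotChart E b z).2 := by rw [hc0]
    have k1 : (fderiv ℝ r ∘ t) 0 = fderiv ℝ r (q₀, 0) := by rw [Function.comp_apply, ht0]
    rw [k1, hhor, k0, map_zero, add_zero, hsymm, zero_apply, zero_add, map_zero, add_zero,
      add_sub_assoc, ← map_sub, e5, map_zero, add_zero] at e4
    exact e4

end Velocity

/-! ### Local invertibility of families that start at the identity -/

section Suspension
variable {F K M : Type*} [NormedAddCommGroup F] [NormedSpace ℝ F] [FiniteDimensional ℝ F]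
  [TopologicalSpace K] {I : ModelWithCorners ℝ F K} [I.Boundaryless]
  [TopologicalSpace M] [ChartedSpace K M] [IsManifold I ∞ M]

/-- A family of maps that is the identity at time zero gives a local diffeomorphism
`(h, w) ↦ (h, G (h, w))`. -/
theorem isLocalDiffeomorphAt_suspension {G : ℝ × M → M} {x : M}
    (hG : ∀ᶠ y in 𝓝 ((0 : ℝ), x), ContMDiffAt (𝓘(ℝ, ℝ).prod I) I ∞ G y)
    (h0 : ∀ᶠ w in 𝓝 x, G (0, w) = w) :
    IsLocalDiffeomorphAt (𝓘(ℝ, ℝ).prod I) (𝓘(ℝ, ℝ).prod I) ∞ (fun y : ℝ × M => (y.1, G y))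
      (0, x) := by
  have hcomplete : CompleteSpace F := FiniteDimensional.complete ℝ F
  obtain ⟨L, hL⟩ : ∃ L : ℝ × F →L[ℝ] F, HasMFDerivAt (𝓘(ℝ, ℝ).prod I) I G ((0 : ℝ), x) L :=
    ⟨_, (hG.self_of_nhds.mdifferentiableAt (by simp)).hasMFDerivAt⟩
  have hinr : HasMFDerivAt I (𝓘(ℝ, ℝ).prod I) (fun w : M => ((0 : ℝ), w)) x
      (ContinuousLinearMap.inr ℝ ℝ F) :=
    (hasMFDerivAt_const (I := I) (I' := 𝓘(ℝ, ℝ)) (0 : ℝ) x).prodMk (hasMFDerivAt_id x)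
  -- Since `G (0, ·)` is the identity near `x`, the differential `(τ, ξ) ↦ (τ, L (τ, ξ))` is block
  -- triangular with identity diagonal blocks.
  have h1 : L ∘L ContinuousLinearMap.inr ℝ ℝ F = ContinuousLinearMap.id ℝ F :=
    hasMFDerivAt_unique (hL.comp x hinr) ((hasMFDerivAt_id (I := I) x).congr_of_eventuallyEq h0)
  obtain ⟨e, he⟩ := exists_continuousLinearEquiv (F := ℝ × F) (G := ℝ × F) rfl
    ((ContinuousLinearMap.fst ℝ ℝ F).prod L) (fun ζ hζ => by
      obtain ⟨τ, ξ⟩ := ζ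
      have h2 : τ = 0 := congrArg Prod.fst hζ
      have h3 : L (τ, ξ) = 0 := congrArg Prod.snd hζ
      have h4 : L (0, ξ) = ξ := DFunLike.congr_fun h1 ξ
      rw [h2, h4] at h3
      rw [h2, h3]; rfl)
  refine isLocalDiffeomorphAt_of_hasMFDerivAt (f' := e)
    (hG.mono fun y hy => contMDiffAt_fst.prodMk hy) ?_
  rw [he]
  exact (hasMFDerivAt_fst (I := 𝓘(ℝ, ℝ)) (I' := I) ((0 : ℝ), x)).prodMk hL

end Suspension

/-! ### Existence and local uniqueness of the discrete flow -/

section DiscreteFlow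

/-- The preferred chart at `c 0` has identity differential there, so the velocity is the ordinary
derivative of the coordinate curve. -/
theorem hasDerivAt_velocityAtZero {c : ℝ → CQ E Q} (hc : ContMDiffAt 𝓘(ℝ, ℝ) (cModel E) ∞ c 0)
    {v : E × (E →L[ℝ] ℝ)} (hv : velocityAtZero c = v) :
    HasDerivAt (fun h => cotChart E (c 0).proj (c h)) v 0 := by
  obtain ⟨L, hL, hLv⟩ : ∃ L : ℝ →L[ℝ] E × (E →L[ℝ] ℝ),
      HasMFDerivAt 𝓘(ℝ, ℝ) (cModel E) c 0 L ∧ L 1 = v :=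
    ⟨_, (hc.mdifferentiableAt (by simp)).hasMFDerivAt, hv⟩
  have h1 := (hasMFDerivAt_cotChart (mem_chart_source E (c 0).proj)).comp 0 hL
  rw [dCot_self] at h1
  have h2 : HasFDerivAt (fun h => cotChart E (c 0).proj (c h)) L 0 := h1.hasFDerivAt
  rw [← hLv]
  exact h2.hasDerivAt

variable [FiniteDimensional ℝ E] {R : TQ E Q → Q × Q} {U V : Set (TQ E Q)} {H : CQ E Q → ℝ}

/-- The conclusion is an equality in the tangent bundle because the two vectors live over `c 0` and
`z`, which are equal only through `hc0`. -/
theorem velocityAtZero_scheme_curve (hR : IsDiscretizationMap R U) (hV : IsInvertibleOn R U V)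
    (hH : ContMDiff (cModel E) 𝓘(ℝ, ℝ) ∞ H) {w c : ℝ → CQ E Q} {z : CQ E Q}
    (hw0 : w 0 = z) (hc0 : c 0 = z) (hw : ContMDiffAt 𝓘(ℝ, ℝ) (cModel E) ∞ w 0)
    (hc : ContMDiffAt 𝓘(ℝ, ℝ) (cModel E) ∞ c 0)
    (hwV : ∀ᶠ h in 𝓝 0, legendre H h (w h) ∈ V ∧ schemeMap R H h (w h) = (z, c h)) :
    (⟨c 0, velocityAtZero c⟩ : TangentBundle (cModel E) (CQ E Q)) = ⟨z, hamiltonianVF H z⟩ := by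
  subst hc0
  have hw' := hasDerivAt_velocityAtZero hw rfl
  rw [hw0] at hw'
  have h := hasDerivAt_scheme_curve hR hV hH hw0 rfl hw.continuousAt hw'
    (hasDerivAt_velocityAtZero hc rfl) hwV hc.continuousAt
  refine congrArg (fun ξ => (⟨c 0, ξ⟩ : TangentBundle (cModel E) (CQ E Q))) ?_
  refine Eq.trans h ?_
  unfold hamVec
  rw [one_smul]
  rfl

/-- Near a point and for small steps, the scheme is the graph of a discrete flow. -/
theorem exists_discreteFlow (hR : IsDiscretizationMap R U) (hV : IsInvertibleOn R U V)
    (hH : ContMDiff (cModel E) 𝓘(ℝ, ℝ) ∞ H) {x : CQ E Q} (hx : (⟨x.proj, 0⟩ : TQ E Q) ∈ V) :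
    ∃ (ε : ℝ) (A B : Set (CQ E Q)) (φ : ℝ → CQ E Q → CQ E Q),
      0 < ε ∧ IsOpen A ∧ IsOpen B ∧ x ∈ A ∧ x ∈ B ∧
      ContMDiffOn (𝓘(ℝ, ℝ).prod (cModel E)) (cModel E) ∞
        (fun y : ℝ × CQ E Q => φ y.1 y.2) (Set.Ioo (-ε) ε ×ˢ A) ∧
      (∀ h ∈ Set.Ioo (-ε) ε,
        (∀ z₀ ∈ A, φ h z₀ ∈ B ∧ ∀ z₁ ∈ B, (z₀, z₁) ∈ scheme R V H h ↔ z₁ = φ h z₀) ∧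
        Set.InjOn (φ h) A ∧ IsLocalSymplectomorphismOn (φ h) A) ∧
      ∀ z ∈ A, φ 0 z = z ∧
        (⟨φ 0 z, velocityAtZero (fun h => φ h z)⟩ : TangentBundle (cModel E) (CQ E Q)) =
          ⟨z, hamiltonianVF H z⟩ := by
  let G : ℝ × CQ E Q → CQ E Q × CQ E Q := fun y => schemeMap R H y.1 y.2
  have hdom := isOpen_schemeDomain hV.isOpen hH
  have hzero {w : CQ E Q} (hw : ((0 : ℝ), w) ∈ schemeDomain V H) : G (0, w) = (w, w) := by
    refine schemeMap_zero hR hV hH ?_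
    have h1 : legendre H 0 w ∈ V := hw
    rwa [legendre_zero] at h1
  have hxd : ((0 : ℝ), x) ∈ schemeDomain V H := by
    change legendre H 0 x ∈ V
    rwa [legendre_zero]
  have hG {y} (hy : y ∈ schemeDomain V H) := schemeMap_contMDiffAt hV hH hy
  have hd1 : ∀ᶠ y in 𝓝 ((0 : ℝ), x), y ∈ schemeDomain V H := hdom.eventually_mem hxd
  have hd0 : ∀ᶠ w in 𝓝 x, ((0 : ℝ), w) ∈ schemeDomain V H :=
    (Continuous.prodMk_right (0 : ℝ)).continuousAt.eventually hd1
  -- `Φ₀` straightens the starting point and defines the flow; `Φ₁` straightens the endpoint and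
  -- makes each `φ_h` injective.
  obtain ⟨Φ₀, hx0, e0⟩ := isLocalDiffeomorphAt_suspension (I := cModel E)
    (G := fun y => (G y).1) (hd1.mono fun y hy => contMDiffAt_fst.comp y (hG hy))
    (hd0.mono fun w hw => congrArg Prod.fst (hzero hw))
  obtain ⟨Φ₁, hx1, e1⟩ := isLocalDiffeomorphAt_suspension (I := cModel E)
    (G := fun y => (G y).2) (hd1.mono fun y hy => contMDiffAt_snd.comp y (hG hy))
    (hd0.mono fun w hw => congrArg Prod.snd (hzero hw))
  -- a box of intermediate points
  obtain ⟨u, K, hu, hK, h0u, hxK, huK⟩ := isOpen_prod_iff.1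
    ((Φ₀.open_source.inter Φ₁.open_source).inter hdom) 0 x ⟨⟨hx0, hx1⟩, hxd⟩
  -- Continuity of `recover` forces every scheme point with `z₀` and `z₁` near `x` to have its
  -- intermediate point in `K`, where `Φ₀` is injective. Hence `A × B` contains no solutions besides
  -- the graph.
  have hW : IsOpen (recoverDomain R V ∩ recover R V ⁻¹' K) :=
    ContinuousOn.isOpen_inter_preimage (fun y hy =>
      (recover_contMDiffAt hV hy).continuousAt.continuousWithinAt) (isOpen_recoverDomain hV) hK
  have hxx : schemeMap R H 0 x = (x, x) := hzero hxd
  obtain ⟨A₁, B, hA₁, hB, hxA₁, hxB, hAB⟩ := isOpen_prod_iff.1 hW x x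
    ⟨hxx ▸ schemeMap_mem_recoverDomain hxd, by
      rw [Set.mem_preimage, ← hxx, recover_schemeMap hV hxd]; exact hxK⟩
  let ψ : ℝ × CQ E Q → ℝ × CQ E Q := Φ₀.toPartialEquiv.symm
  have hψ : ContMDiffOn (𝓘(ℝ, ℝ).prod (cModel E)) (𝓘(ℝ, ℝ).prod (cModel E)) ∞ ψ Φ₀.target :=
    Φ₀.contMDiffOn_invFun
  have hψx : ψ (0, x) = (0, x) := by
    have h1 := Φ₀.toPartialEquiv.left_inv hx0
    have h2 : Φ₀.toPartialEquiv (0, x) = (0, x) :=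
      (e0 hx0).symm.trans (Prod.ext rfl (congrArg Prod.fst hxx))
    rwa [h2] at h1
  have hGB : IsOpen ((u ×ˢ K) ∩ (fun y => (G y).2) ⁻¹' B) :=
    ContinuousOn.isOpen_inter_preimage (fun y hy =>
      (continuous_snd.continuousAt.comp (hG (huK hy).2).continuousAt).continuousWithinAt)
      (hu.prod hK) hB
  -- The final box is shrunk so that the intermediate point stays in `u × K`, the endpoint in `B`
  -- and the starting point in `A₁`.
  have hO := (hψ.continuousOn.isOpen_inter_preimage Φ₀.open_target hGB).inter
    (isOpen_univ.prod hA₁)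
  obtain ⟨s, A, hs, hA, h0s, hxA, hsA⟩ := isOpen_prod_iff.1 hO 0 x
    ⟨⟨by
      have h1 := Φ₀.toPartialEquiv.map_source hx0
      have h2 : Φ₀.toPartialEquiv (0, x) = (0, x) :=
        (e0 hx0).symm.trans (Prod.ext rfl (congrArg Prod.fst hxx))
      rwa [h2] at h1, by
      rw [Set.mem_preimage, hψx]
      exact ⟨⟨h0u, hxK⟩, by simp only [Set.mem_preimage, G, hxx]; exact hxB⟩⟩,
      ⟨trivial, hxA₁⟩⟩
  obtain ⟨ε, hε, hεs⟩ := Metric.isOpen_iff.1 hs 0 h0s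
  rw [Real.ball_eq_Ioo, zero_sub, zero_add] at hεs
  let φ : ℝ → CQ E Q → CQ E Q := fun h z => (G (ψ (h, z))).2
  have hbox {h z} (hh : h ∈ s) (hz : z ∈ A) :
      (h, z) ∈ Φ₀.target ∧ ψ (h, z) ∈ u ×ˢ K ∧ φ h z ∈ B ∧ z ∈ A₁ :=
    have hm := hsA (Set.mk_mem_prod hh hz)
    ⟨hm.1.1, hm.1.2.1, hm.1.2.2, hm.2.2⟩
  have hψG {h z} (hh : h ∈ s) (hz : z ∈ A) : (ψ (h, z)).1 = h ∧ (G (ψ (h, z))).1 = z := by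
    have h1 := (e0 (huK (hbox hh hz).2.1).1.1).trans
      (Φ₀.toPartialEquiv.right_inv (hbox hh hz).1)
    exact ⟨congrArg Prod.fst h1, congrArg Prod.snd h1⟩
  have hscheme {h z} (hh : h ∈ s) (hz : z ∈ A) : legendre H h (ψ (h, z)).2 ∈ V ∧
      schemeMap R H h (ψ (h, z)).2 = (z, φ h z) := by
    have h1 : legendre H (ψ (h, z)).1 (ψ (h, z)).2 ∈ V := (huK (hbox hh hz).2.1).2
    have h2 : schemeMap R H (ψ (h, z)).1 (ψ (h, z)).2 = (z, φ h z) :=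
      Prod.ext (hψG hh hz).2 rfl
    rw [(hψG hh hz).1] at h1 h2
    exact ⟨h1, h2⟩
  have hgraph {h z} (hh : h ∈ s) (hz : z ∈ A) : (z, φ h z) ∈ scheme R V H h :=
    mem_scheme_iff.2 ⟨_, hscheme hh hz⟩
  have hψs : ContMDiffOn (𝓘(ℝ, ℝ).prod (cModel E)) (𝓘(ℝ, ℝ).prod (cModel E)) ∞ ψ (s ×ˢ A) :=
    hψ.mono fun y hy => (hsA hy).1.1
  have hφs : ContMDiffOn (𝓘(ℝ, ℝ).prod (cModel E)) (cModel E) ∞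
      (fun y : ℝ × CQ E Q => φ y.1 y.2) (s ×ˢ A) := fun y hy =>
    (contMDiffAt_snd.comp (ψ y) (hG (huK (hsA hy).1.2.1).2)).comp_contMDiffWithinAt y (hψs y hy)
  have hu0 {z} (hz : z ∈ A) : (ψ (0, z)).2 = z ∧ φ 0 z = z := by
    have h1 : ((0 : ℝ), (ψ (0, z)).2) ∈ schemeDomain V H := (hscheme h0s hz).1
    have h2 : schemeMap R H 0 (ψ (0, z)).2 = _ := hzero h1
    have h3 := (hscheme h0s hz).2.symm.trans h2
    have h4 : z = (ψ (0, z)).2 := congrArg Prod.fst h3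
    have h5 : φ 0 z = (ψ (0, z)).2 := congrArg Prod.snd h3
    exact ⟨h4.symm, h5.trans h4.symm⟩
  refine ⟨ε, A, B, φ, hε, hA, hB, hxA, hxB, hφs.mono (Set.prod_mono hεs subset_rfl), ?_, ?_⟩
  · intro h hh
    replace hh := hεs hh
    refine ⟨fun z₀ hz₀ => ⟨(hbox hh hz₀).2.2.1, fun z₁ hz₁ => ⟨fun hS => ?_, fun hS => ?_⟩⟩,
      fun z hz z' hz' hzz => ?_, ?_⟩
    · obtain ⟨w, hwV, hw⟩ := mem_scheme_iff.1 hS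
      have h1 : recover R V (schemeMap R H h w) = w := recover_schemeMap hV hwV
      have h2 : w ∈ K := by
        rw [← h1, hw]; exact (hAB (Set.mk_mem_prod (hbox hh hz₀).2.2.2 hz₁)).2
      have hhu : h ∈ u := by
        have := (hbox hh hz₀).2.1.1
        rwa [(hψG hh hz₀).1] at this
      have h3 := (huK (Set.mk_mem_prod hhu h2)).1.1
      have h4 : Φ₀.toPartialEquiv (h, w) = (h, z₀) :=
        (e0 h3).symm.trans (Prod.ext rfl (congrArg Prod.fst hw))
      have h5 : ψ (h, z₀) = (h, w) := by
        rw [← h4]; exact Φ₀.toPartialEquiv.left_inv h3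
      change z₁ = (G (ψ (h, z₀))).2
      rw [h5]
      exact (congrArg Prod.snd hw).symm
    · rw [hS]; exact hgraph hh hz₀
    -- Equal endpoints at the same `h` give equal intermediate points by injectivity of `Φ₁`, hence
    -- equal starting points.
    · have h1 := (huK (hbox hh hz).2.1).1.2
      have h2 := (huK (hbox hh hz').2.1).1.2
      have h4 : ((ψ (h, z)).1, (G (ψ (h, z))).2) = ((ψ (h, z')).1, (G (ψ (h, z'))).2) :=
        Prod.ext ((hψG hh hz).1.trans (hψG hh hz').1.symm) hzz
      have h3 : ψ (h, z) = ψ (h, z') :=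
        Φ₁.toPartialEquiv.injOn h1 h2 ((e1 h1).symm.trans (h4.trans (e1 h2)))
      rw [← (hψG hh hz).2, h3, (hψG hh hz').2]
    · exact isLocalSymplectomorphismOn_of_graph_subset hV hH hA
        (hφs.comp (contMDiff_const.prodMk contMDiff_id).contMDiffOn
          fun z hz => Set.mk_mem_prod hh hz) fun z hz => hgraph hh hz
  · intro z hz
    have hn : s ×ˢ A ∈ 𝓝 ((0 : ℝ), z) := (hs.prod hA).mem_nhds (Set.mk_mem_prod h0s hz)
    have hl : ContMDiffAt 𝓘(ℝ, ℝ) (𝓘(ℝ, ℝ).prod (cModel E)) ∞ (fun h : ℝ => (h, z)) 0 :=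
      contMDiffAt_id.prodMk contMDiffAt_const
    refine ⟨(hu0 hz).2, velocityAtZero_scheme_curve hR hV hH (w := fun h => (ψ (h, z)).2)
      (hu0 hz).1 (hu0 hz).2 ?_ ?_ ((hs.eventually_mem h0s).mono fun h hh => hscheme hh hz)⟩
    · exact ContMDiffAt.comp (g := fun y : ℝ × CQ E Q => (ψ y).2) (0 : ℝ)
        (contMDiffAt_snd.comp ((0 : ℝ), z) (hψs.contMDiffAt hn)) hl
    · exact ContMDiffAt.comp (g := fun y : ℝ × CQ E Q => φ y.1 y.2) (0 : ℝ)
        (hφs.contMDiffAt hn) hl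

end DiscreteFlow

end Discretization

end

theorem mainTheorem4 {E : Type*} [NormedAddCommGroup E] [NormedSpace ℝ E] [FiniteDimensional ℝ E]
    {Q : Type*} [TopologicalSpace Q] [ChartedSpace E Q] [IsManifold 𝓘(ℝ, E) ∞ Q]
    (R : Discretization.TQ E Q → Q × Q) (U : Set (Discretization.TQ E Q))
    (hR : Discretization.IsDiscretizationMap R U)
    (H : Discretization.CQ E Q → ℝ)
    (hH : ContMDiff (Discretization.cModel E) 𝓘(ℝ, ℝ) ∞ H) :
    -- `R_d` is invertible near each point of the zero section
    (∀ q : Q, ∃ V : Set (Discretization.TQ E Q),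
      Discretization.IsInvertibleOn R U V ∧ (⟨q, 0⟩ : Discretization.TQ E Q) ∈ V) ∧
    -- wherever `R_d` is inverted:
    ∀ V : Set (Discretization.TQ E Q), Discretization.IsInvertibleOn R U V →
      -- the scheme is a Lagrangian submanifold
      (∀ h : ℝ, Discretization.IsLagrangianSubmanifold (Discretization.scheme R V H h)) ∧
      -- every smooth map whose graph lies in the scheme is a local symplectomorphism
      (∀ (h : ℝ) (D : Set (Discretization.CQ E Q))
        (φ : Discretization.CQ E Q → Discretization.CQ E Q), IsOpen D →
        ContMDiffOn (Discretization.cModel E) (Discretization.cModel E) ∞ φ D →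
        (∀ z ∈ D, (z, φ z) ∈ Discretization.scheme R V H h) →
        Discretization.IsLocalSymplectomorphismOn φ D) ∧
      -- near each point and for small steps, the scheme is the graph of a discrete flow
      (∀ x : Discretization.CQ E Q, (⟨x.proj, 0⟩ : Discretization.TQ E Q) ∈ V →
        ∃ (ε : ℝ) (A B : Set (Discretization.CQ E Q))
          (φ : ℝ → Discretization.CQ E Q → Discretization.CQ E Q),
          0 < ε ∧ IsOpen A ∧ IsOpen B ∧ x ∈ A ∧ x ∈ B ∧
          ContMDiffOn (𝓘(ℝ, ℝ).prod (Discretization.cModel E)) (Discretization.cModel E) ∞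
            (fun y : ℝ × Discretization.CQ E Q => φ y.1 y.2) (Set.Ioo (-ε) ε ×ˢ A) ∧
          (∀ h ∈ Set.Ioo (-ε) ε,
            (∀ z₀ ∈ A, φ h z₀ ∈ B ∧
              ∀ z₁ ∈ B, (z₀, z₁) ∈ Discretization.scheme R V H h ↔ z₁ = φ h z₀) ∧
            Set.InjOn (φ h) A ∧ Discretization.IsLocalSymplectomorphismOn (φ h) A) ∧
          ∀ z ∈ A, φ 0 z = z ∧
            (⟨φ 0 z, Discretization.velocityAtZero (fun h => φ h z)⟩ :
              TangentBundle (Discretization.cModel E) (Discretization.CQ E Q)) =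
              ⟨z, Discretization.hamiltonianVF H z⟩) :=
  ⟨Discretization.exists_isInvertibleOn hR, fun _ hV =>
    ⟨Discretization.scheme_isLagrangian hV hH,
      fun _ _ _ hD hφ hg =>
        Discretization.isLocalSymplectomorphismOn_of_graph_subset hV hH hD hφ hg,
      fun _ hx => Discretization.exists_discreteFlow hR hV hH hx⟩⟩
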